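/- **Notation.** Let $d\in\mathbb N$, $\mathfrak e=(1,\dots,1)\in\mathbb R^d$, $I=(0,1)$, $B^d=[-1,1]^d$; operations and inequalities between vectors are coordinatewise, $t_+=\max(t,0)$. All functions are real-valued. For $J\subset\{1,\dots,d\}$ let $\chi_J\in\{0,1\}^d$ be its indicator vector; for $x\in\mathbb R^d$ put $x^J=(x_j)_{j\in J}$, and $A^J=\{x^J:x\in A\}$ for $A\subset\mathbb R^d$. For $l\in\mathbb Z_+^d$ put $\mathbb Z_+^d(l)=\{k\in\mathbb Z_+^d: k\le l\}$ and let $\mathcal P^{d,l}$ be the span of the monomials $x^k$, $k\in\mathbb Z_+^d(l)$. For $h\in\mathbb R^d$ let $$(I^d)_h^l=\{x\in I^d: x+t\,l\,h\in I^d\ \ \forall t\in[0,1]^d\},\qquad \Delta_h^l f(x)=\sum_{k\in\mathbb Z_+^d(l)}\Bigl(\prod_{j=1}^d(-1)^{l_j-k_j}\binom{l_j}{k_j}\Bigr)f(x+kh);$$ for $l\chi_J$ in place of $l$ these depend on $h^J$ only. $\mathcal D^\lambda$ denotes the generalized (weak) derivative in $I^d$. *Local polynomial approximations.* For a cell $Q=x^0+\delta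 I^d$ ($\delta_j>0$) and $f\in L_1(Q)$ let $P^{d,l}_{\delta,x^0}f$ be the unique $g\in\mathcal P^{d,l}$ with $\int_Q(f-g)h\,dx=0$ for all $h\in\mathcal P^{d,l}$. For $f\in L_1(I^d)$, $\kappa\in\mathbb Z_+^d$ and $\nu\in\mathbb Z^d$ with $0\le\nu\le2^\kappa-\mathfrak e$ put $\mathcal S^{d,l}_{\kappa,\nu}f=P^{d,l}_{2^{-\kappa},\,2^{-\kappa}\nu}f$, where $2^{\kappa}=(2^{\kappa_1},\dots,2^{\kappa_d})$. *B-splines.* Let $\psi^{1,0}$ be the characteristic function of $I$, $\psi^{1,n}(x)=\int_I\psi^{1,n-1}(x-y)\,dy$ for $n\ge1$, and $g^{d,m}_{\kappa,\nu}(x)=\prod_{j=1}^d\psi^{1,m_j}(2^{\kappa_j}x_j-\nu_j)$ for $m\in\mathbb Z_+^d$. *Operators.* With $\nu_\kappa(\nu)=(2^\kappa-m-\mathfrak e)_+-(2^\kappa-m-\mathfrak e-\nu_+)_+$ put, on $I^d$, $$E^{d,l,m}_\kappa f=\sum_{\nu\in\mathbb Z^d:\,-m\le\nu\le2^\kappa-\mathfrak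 e}\bigl(\mathcal S^{d,l}_{\kappa,\nu_\kappa(\nu)}f\bigr)\,g^{d,m}_{\kappa,\nu},\qquad \mathcal E^{d,l,m}_\kappa f=\sum_{\epsilon}(-1)^{\epsilon_1+\dots+\epsilon_d}E^{d,l,m}_{\kappa-\epsilon}f,$$ the last sum being over all $\epsilon\in\{0,1\}^d$ such that $\epsilon_j=0$ whenever $\kappa_j=0$. **Theorem.** Let $d\in\mathbb N$ and $m\in\mathbb Z_+^d$. There is a constant $c_{12}=c_{12}(d,m)>0$ such that the following holds for all $l\in\mathbb N^d$ (so $l_j\ge1$), $1\le p<\infty$, $1\le q\le\infty$, $\lambda\in\mathbb Z_+^d$ with $\lambda\le m$, and $f\in L_p(I^d)$. Suppose that for every nonempty $J\subset\{1,\dots,d\}$ the function $$t^J\longmapsto\Bigl(\prod_{j\in J}t_j^{-\lambda_j-p^{-1}-(p^{-1}-q^{-1})_+-1}\Bigr)\Bigl(\int_{(c_{12}tB^d)^J}\int_{(I^d)_\xi^{l\chi_J}}|\Delta_\xi^{l\chi_J}f(x)|^p\,dx\,d\xi^J\Bigr)^{1/p}$$ belongs to $L_1((I^d)^J)$. Then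 the generalized derivative $\mathcal D^\lambda f$ exists and lies in $L_q(I^d)$, all $\mathcal D^\lambda\mathcal E^{d,l-\mathfrak e,m}_\kappa f$ exist and lie in $L_q(I^d)$, and in $L_q(I^d)$ $$\mathcal D^\lambda f=\sum_{\kappa\in\mathbb Z_+^d}\mathcal D^\lambda\mathcal E^{d,l-\mathfrak e,m}_\kappa f,$$ that is, $\bigl\|\mathcal D^\lambda f-\sum_{\kappa\in\mathbb Z_+^d(k)}\mathcal D^\lambda\mathcal E^{d,l-\mathfrak e,m}_\kappa f\bigr\|_{L_q(I^d)}\to0$ as $\min_j k_j\to\infty$. -/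

import Mathlib

open MeasureTheory Filter Topology
open scoped ENNReal

noncomputable section

namespace MixedApprox

open scoped ContDiff

/-! ### Cubes, cells and polynomials of bounded coordinate degrees -/

/-- The open unit cube `I^d`. -/
def unitCube (d : ℕ) : Set (Fin d → ℝ) := {x | ∀ j, 0 < x j ∧ x j < 1}

/-- The open cell `x⁰ + δ I^d`. -/
def cell {d : ℕ} (x₀ δ : Fin d → ℝ) : Set (Fin d → ℝ) :=
  {x | ∀ j, x₀ j < x j ∧ x j < x₀ j + δ j}

/-- The space of real polynomials on `ℝ^d` whose degree in the variable `x_j` is at most `l_j`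
for every `j` (as functions on `ℝ^d`). -/
def polySpace {d : ℕ} (l : Fin d → ℕ) : Submodule ℝ ((Fin d → ℝ) → ℝ) :=
  Submodule.span ℝ ((fun (a : Fin d → ℕ) (x : Fin d → ℝ) => ∏ j, x j ^ a j) '' {a | a ≤ l})

/-- `g` is the projection of `f` to the polynomials of degrees at most `l` on the cell
`Q = x⁰ + δ I^d`: `g` is such a polynomial, and `f - g` is orthogonal on `Q` to all of them. -/
def IsPolyProj {d : ℕ} (l : Fin d → ℕ) (δ x₀ : Fin d → ℝ) (f g : (Fin d → ℝ) → ℝ) : Prop :=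
  g ∈ polySpace l ∧ ∀ h ∈ polySpace l, ∫ x in cell x₀ δ, (f x - g x) * h x = 0

/-- The operator `P_{δ,x⁰}^{d,l} : L_1(x⁰ + δ I^d) → 𝒫^{d,l}`, i.e. the linear projection onto
`𝒫^{d,l}` whose kernel consists of the functions orthogonal to `𝒫^{d,l}` on the cell.
See `existsUnique_isPolyProj` for the existence and uniqueness of the value on integrable
functions. -/
def polyProj {d : ℕ} (l : Fin d → ℕ) (δ x₀ : Fin d → ℝ) (f : (Fin d → ℝ) → ℝ) :
    (Fin d → ℝ) → ℝ :=
  Classical.epsilon (IsPolyProj l δ x₀ f)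

section Projection

variable {d : ℕ} {l : Fin d → ℕ}

theorem continuous_of_mem_polySpace {g : (Fin d → ℝ) → ℝ} (hg : g ∈ polySpace l) :
    Continuous g := by
  refine Submodule.span_induction (p := fun g _ => Continuous g) ?_ ?_ ?_ ?_ hg
  · rintro _ ⟨a, -, rfl⟩
    exact continuous_finsetProd _ fun j _ => (continuous_apply j).pow _
  · exact continuous_zero
  · exact fun _ _ _ _ h₁ h₂ => h₁.add h₂
  · exact fun c _ _ h => h.const_smul c

theorem exists_mvPolynomial_of_mem_polySpace {g : (Fin d → ℝ) → ℝ} (hg : g ∈ polySpace l) :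
    ∃ P : MvPolynomial (Fin d) ℝ, ∀ x, g x = MvPolynomial.eval x P := by
  refine Submodule.span_induction
    (p := fun g _ => ∃ P : MvPolynomial (Fin d) ℝ, ∀ x, g x = MvPolynomial.eval x P) ?_ ?_ ?_ ?_ hg
  · rintro _ ⟨a, -, rfl⟩
    exact ⟨∏ j, MvPolynomial.X j ^ a j, fun x => by simp⟩
  · exact ⟨0, fun x => by simp⟩
  · rintro _ _ _ _ ⟨P, hP⟩ ⟨R, hR⟩
    exact ⟨P + R, fun x => by simp [hP, hR]⟩
  · rintro c _ _ ⟨P, hP⟩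
    exact ⟨MvPolynomial.C c * P, fun x => by simp [hP]⟩

theorem cell_eq_pi (x₀ δ : Fin d → ℝ) :
    cell x₀ δ = Set.univ.pi fun j => Set.Ioo (x₀ j) (x₀ j + δ j) := by
  ext x; simp [cell]

theorem isOpen_cell (x₀ δ : Fin d → ℝ) : IsOpen (cell x₀ δ) := by
  rw [cell_eq_pi]
  exact isOpen_set_pi Set.finite_univ fun _ _ => isOpen_Ioo

theorem integrableOn_cell_mul {x₀ δ : Fin d → ℝ} {f g : (Fin d → ℝ) → ℝ}
    (hf : IntegrableOn f (cell x₀ δ)) (hg : g ∈ polySpace l) :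
    IntegrableOn (fun x => f x * g x) (cell x₀ δ) := by
  refine hf.mul_continuousOn_of_subset (continuous_of_mem_polySpace hg).continuousOn
    (isOpen_cell x₀ δ).measurableSet (isCompact_Icc (a := x₀) (b := x₀ + δ)) ?_
  intro x hx
  exact ⟨fun j => (hx j).1.le, fun j => (hx j).2.le⟩

theorem integrableOn_cell {x₀ δ : Fin d → ℝ} {g : (Fin d → ℝ) → ℝ} (hg : g ∈ polySpace l) :
    IntegrableOn g (cell x₀ δ) := by
  refine ((continuous_of_mem_polySpace hg).continuousOn.integrableOn_compact
    (isCompact_Icc (a := x₀) (b := x₀ + δ))).mono_set ?_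
  intro x hx
  exact ⟨fun j => (hx j).1.le, fun j => (hx j).2.le⟩

theorem eq_zero_of_integral_sq {x₀ δ : Fin d → ℝ} (hδ : ∀ j, 0 < δ j) {g : (Fin d → ℝ) → ℝ}
    (hg : g ∈ polySpace l) (h : ∫ x in cell x₀ δ, g x * g x = 0) : g = 0 := by
  have hc := continuous_of_mem_polySpace hg
  have h0 : (fun x => g x * g x) =ᵐ[volume.restrict (cell x₀ δ)] 0 :=
    (integral_eq_zero_iff_of_nonneg (fun x => mul_self_nonneg (g x))
      (integrableOn_cell_mul (integrableOn_cell hg) hg)).1 h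
  have h1 : Set.EqOn (fun x => g x * g x) 0 (cell x₀ δ) :=
    Measure.eqOn_open_of_ae_eq h0 (isOpen_cell x₀ δ) (hc.mul hc).continuousOn
      continuous_zero.continuousOn
  obtain ⟨P, hP⟩ := exists_mvPolynomial_of_mem_polySpace hg
  have hP0 : P = 0 := by
    refine MvPolynomial.funext_set (fun j => Set.Ioo (x₀ j) (x₀ j + δ j))
      (fun j => Set.Ioo_infinite (by linarith [hδ j])) fun x hx => ?_
    rw [← cell_eq_pi] at hx
    have := h1 hx
    simpa [hP] using this
  funext x
  simp [hP, hP0]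

/-- On every cell, each integrable function has exactly one projection to the polynomials of
degrees at most `l`. -/
theorem existsUnique_isPolyProj (l : Fin d → ℕ) {δ : Fin d → ℝ} (hδ : ∀ j, 0 < δ j)
    (x₀ : Fin d → ℝ) {f : (Fin d → ℝ) → ℝ} (hf : IntegrableOn f (cell x₀ δ)) :
    ∃! g, IsPolyProj l δ x₀ f g := by
  have hfin : FiniteDimensional ℝ (polySpace l) :=
    FiniteDimensional.span_of_finite ℝ ((Set.finite_Iic l).image _)
  let T : polySpace l →ₗ[ℝ] Module.Dual ℝ (polySpace l) :=
    LinearMap.mk₂ ℝ (fun g h => ∫ x in cell x₀ δ, g.1 x * h.1 x)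
      (fun a b h => by
        simp only [Submodule.coe_add, Pi.add_apply, add_mul]
        exact integral_add (integrableOn_cell_mul (integrableOn_cell a.2) h.2)
          (integrableOn_cell_mul (integrableOn_cell b.2) h.2))
      (fun c a h => by
        simp only [Submodule.coe_smul, Pi.smul_apply, smul_eq_mul, mul_assoc]
        exact integral_const_mul c _)
      (fun h a b => by
        simp only [Submodule.coe_add, Pi.add_apply, mul_add]
        exact integral_add (integrableOn_cell_mul (integrableOn_cell h.2) a.2)
          (integrableOn_cell_mul (integrableOn_cell h.2) b.2))
      (fun c h a => by
        simp only [Submodule.coe_smul, Pi.smul_apply, smul_eq_mul, mul_left_comm _ c]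
        exact integral_const_mul c _)
  have hT : Function.Injective T := by
    rw [← LinearMap.ker_eq_bot, LinearMap.ker_eq_bot']
    intro g hg
    have := congrArg (fun φ => φ g) hg
    exact Subtype.ext (eq_zero_of_integral_sq hδ g.2 this)
  have hTs : Function.Surjective T :=
    (LinearMap.injective_iff_surjective_of_finrank_eq_finrank
      (Subspace.dual_finrank_eq).symm).1 hT
  let Φ : Module.Dual ℝ (polySpace l) :=
    { toFun := fun h => ∫ x in cell x₀ δ, f x * h.1 x
      map_add' := fun a b => by
        simp only [Submodule.coe_add, Pi.add_apply, mul_add]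
        exact integral_add (integrableOn_cell_mul hf a.2) (integrableOn_cell_mul hf b.2)
      map_smul' := fun c a => by
        simp only [Submodule.coe_smul, Pi.smul_apply, smul_eq_mul, mul_left_comm _ c]
        exact integral_const_mul c _ }
  obtain ⟨g, hg⟩ := hTs Φ
  have hsub : ∀ u ∈ polySpace l, ∀ h ∈ polySpace l,
      ∫ x in cell x₀ δ, (f x - u x) * h x
        = (∫ x in cell x₀ δ, f x * h x) - ∫ x in cell x₀ δ, u x * h x := by
    intro u hu h hh
    simp only [sub_mul]
    exact integral_sub (integrableOn_cell_mul hf hh)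
      (integrableOn_cell_mul (integrableOn_cell hu) hh)
  refine ⟨g.1, ⟨g.2, fun h hh => ?_⟩, ?_⟩
  · have h2 : (∫ x in cell x₀ δ, g.1 x * h x) = ∫ x in cell x₀ δ, f x * h x :=
      congrArg (fun φ => φ (⟨h, hh⟩ : polySpace l)) hg
    rw [hsub g.1 g.2 h hh, h2, sub_self]
  · rintro u ⟨hu, hu'⟩
    have h3 : T ⟨u, hu⟩ = T g := by
      rw [hg]
      ext h
      have := hu' h.1 h.2
      rw [hsub u hu h.1 h.2] at this
      exact (sub_eq_zero.1 this).symm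
    exact congrArg Subtype.val (hT h3)

theorem isPolyProj_polyProj (l : Fin d → ℕ) {δ : Fin d → ℝ} (hδ : ∀ j, 0 < δ j)
    (x₀ : Fin d → ℝ) {f : (Fin d → ℝ) → ℝ} (hf : IntegrableOn f (cell x₀ δ)) :
    IsPolyProj l δ x₀ f (polyProj l δ x₀ f) :=
  Classical.epsilon_spec (existsUnique_isPolyProj l hδ x₀ hf).exists

end Projection

/-! ### B-splines and the approximation operators -/

/-- The univariate B-splines: `ψ^{1,0}` is the characteristic function of `(0,1)` and
`ψ^{1,m+1}(x) = ∫_0^1 ψ^{1,m}(x - y) dy`. -/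
def bspline : ℕ → ℝ → ℝ
  | 0 => Set.indicator (Set.Ioo 0 1) fun _ => 1
  | m + 1 => fun x => ∫ y in Set.Ioo (0 : ℝ) 1, bspline m (x - y)

/-- `g_{κ,ν}^{d,m}(x) = ∏_j ψ^{1,m_j}(2^{κ_j} x_j - ν_j)`. -/
def dyadicBspline {d : ℕ} (m κ : Fin d → ℕ) (ν : Fin d → ℤ) (x : Fin d → ℝ) : ℝ :=
  ∏ j, bspline (m j) ((2 : ℝ) ^ κ j * x j - ν j)

/-- `𝒮_{κ,ν}^{d,l}`: the polynomial projection on the dyadic cell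
`Q_{κ,ν} = 2^{-κ} ν + 2^{-κ} I^d`. -/
def localProj {d : ℕ} (l κ : Fin d → ℕ) (ν : Fin d → ℤ) (f : (Fin d → ℝ) → ℝ) :
    (Fin d → ℝ) → ℝ :=
  polyProj l (fun j => ((2 : ℝ) ^ κ j)⁻¹) (fun j => ((2 : ℝ) ^ κ j)⁻¹ * ν j) f

/-- `ν_κ^{d,m}(ν) = (2^κ - m - 𝔢)_+ - (2^κ - m - 𝔢 - ν_+)_+`, coordinatewise. -/
def cellIndex {d : ℕ} (m κ : Fin d → ℕ) (ν : Fin d → ℤ) : Fin d → ℤ := fun j =>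
  max ((2 : ℤ) ^ κ j - m j - 1) 0 - max ((2 : ℤ) ^ κ j - m j - 1 - max (ν j) 0) 0

/-- `E_κ^{d,l,m} f = ∑_{-m ≤ ν ≤ 2^κ - 𝔢} (𝒮_{κ,ν_κ(ν)}^{d,l} f) g_{κ,ν}^{d,m}`. -/
def approxOp {d : ℕ} (l m κ : Fin d → ℕ) (f : (Fin d → ℝ) → ℝ) (x : Fin d → ℝ) : ℝ :=
  ∑ ν ∈ Finset.Icc (fun j => -(m j : ℤ)) (fun j => (2 : ℤ) ^ κ j - 1),
    localProj l κ (cellIndex m κ ν) f x * dyadicBspline m κ ν x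

/-- `𝓔_κ^{d,l,m} f = ∑_ε (-1)^{|ε|} E_{κ-ε}^{d,l,m} f`, the sum over all `ε ∈ {0,1}^d` such that
`κ_j ≠ 0` whenever `ε_j ≠ 0`. -/
def mixedApproxOp {d : ℕ} (l m κ : Fin d → ℕ) (f : (Fin d → ℝ) → ℝ) (x : Fin d → ℝ) : ℝ :=
  ∑ ε ∈ (Finset.Iic (1 : Fin d → ℕ)).filter (fun ε => ∀ j, ε j ≠ 0 → κ j ≠ 0),
    (-1 : ℝ) ^ (∑ j, ε j) * approxOp l m (fun j => κ j - ε j) f x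

/-! ### Mixed differences -/

/-- `D_h^l = {x ∈ D : x + t l h ∈ D for all t ∈ [0,1]^d}`. -/
def diffDomain {d : ℕ} (D : Set (Fin d → ℝ)) (h : Fin d → ℝ) (l : Fin d → ℕ) :
    Set (Fin d → ℝ) :=
  {x | x ∈ D ∧ ∀ t : Fin d → ℝ, (∀ j, 0 ≤ t j ∧ t j ≤ 1) →
    (fun j => x j + t j * l j * h j) ∈ D}

/-- The mixed difference `Δ_h^l f(x) = ∑_{0 ≤ k ≤ l} (-1)^{|l-k|} C_l^k f(x + k h)`. -/
def mixedDiff {d : ℕ} (h : Fin d → ℝ) (l : Fin d → ℕ) (f : (Fin d → ℝ) → ℝ)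
    (x : Fin d → ℝ) : ℝ :=
  ∑ k ∈ Finset.Iic l, (∏ j, (-1 : ℝ) ^ (l j - k j) * ((l j).choose (k j) : ℝ)) *
    f (fun j => x j + k j * h j)

/-- The multi-index `l χ_J`. -/
def restrictIndex {d : ℕ} (J : Finset (Fin d)) (l : Fin d → ℕ) : Fin d → ℕ :=
  fun j => if j ∈ J then l j else 0

/-- The extension by zero of a vector with coordinates indexed by `J`. -/
def extendZero {d : ℕ} (J : Finset (Fin d)) (ξ : J → ℝ) : Fin d → ℝ :=
  fun j => if hj : j ∈ J then ξ ⟨j, hj⟩ else 0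

/-- `(∫_{(c t B^d)^J} ∫_{(I^d)_ξ^{lχ_J}} |Δ_ξ^{lχ_J} f(x)|^p dx dξ^J)^{1/p}`
as an extended nonnegative number. -/
def diffMean {d : ℕ} (c p : ℝ) (l : Fin d → ℕ) (J : Finset (Fin d)) (f : (Fin d → ℝ) → ℝ)
    (t : J → ℝ) : ℝ≥0∞ :=
  (∫⁻ ξ in {ξ : J → ℝ | ∀ j, |ξ j| ≤ c * t j},
    ∫⁻ x in diffDomain (unitCube d) (extendZero J ξ) (restrictIndex J l),
      ‖mixedDiff (extendZero J ξ) (restrictIndex J l) f x‖ₑ ^ p) ^ (1 / p)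

/-! ### Generalized derivatives -/

/-- The partial derivative `∂φ/∂x_j`. -/
def partialDeriv {d : ℕ} (j : Fin d) (φ : (Fin d → ℝ) → ℝ) (x : Fin d → ℝ) : ℝ :=
  fderiv ℝ φ x (Pi.single j 1)

/-- The classical derivative `𝓓^a φ = ∂^{|a|} φ / ∂x_1^{a_1} … ∂x_d^{a_d}`. -/
def multiDeriv {d : ℕ} (a : Fin d → ℕ) (φ : (Fin d → ℝ) → ℝ) : (Fin d → ℝ) → ℝ :=
  (List.finRange d).foldr (fun j ψ => (partialDeriv j)^[a j] ψ) φ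

/-- `g` is the generalized derivative `𝓓^a f` in the open set `U`. -/
def IsGeneralizedDeriv {d : ℕ} (U : Set (Fin d → ℝ)) (a : Fin d → ℕ)
    (f g : (Fin d → ℝ) → ℝ) : Prop :=
  LocallyIntegrableOn f U ∧ LocallyIntegrableOn g U ∧
    ∀ φ : (Fin d → ℝ) → ℝ, ContDiff ℝ ∞ φ → HasCompactSupport φ → tsupport φ ⊆ U →
      ∫ x in U, f x * multiDeriv a φ x = (-1 : ℝ) ^ (∑ j, a j) * ∫ x in U, g x * φ x

end MixedApprox

end

open MixedApprox

noncomputable section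

namespace MixedApprox

open scoped ContDiff Polynomial

/-! ### B-splines -/

/-! The operators are integral operators with product kernels. In one variable the polynomial
projection on a dyadic cell is integration against the reproducing kernel `cellKer`, so `E_κ` has
the kernel `∏ j, splineKer`, its mixed differences `𝓔_κ` have the kernel `tensorKer = ∏ j, diffKer`
(`mixedApproxOp_eq_integral`), and the weak derivative of order `a` in `x` is taken factor by factor
on products of a B-spline and a polynomial (`isGeneralizedDeriv_mixedApproxOp`).

The heart of the matter is cancellation. Each univariate operator reproduces polynomials of degree
less than `l`, so for `κ ≥ 1` the function `diffKer l m a κ x` has vanishing moments of order less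
than `l`, first for `a = 0` and then, by weak differentiation, for every `a ≤ m`. A bounded function
on an interval with these vanishing moments is an average over steps `ξ` of adjoint differences of
order `l` of bounded kernels, all nodes staying inside the interval (`exists_isDiffRep`). Moving the
differences onto `f` bounds `|𝓓^a 𝓔_κ f(x)|` by `2^{κ(a+2)}` times the integral of `|Δ_ξ^{lχ_J}
f(y)|` over steps and points at distance of order `2^{-κ}`, where `J` is the set of coordinates with
`κ_j ≠ 0` (`exists_enorm_tensorOp_le`).

Hölder's inequality and Fubini's theorem turn this, for `q ≥ p`, into an `L_q` bound of order
`2^{κ(a + 1/p + (1/p - 1/q))}` times `diffMean` at `t = 2^{-κ}`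
(`exists_eLpNorm_tensorOp_le_diffMean`). As `diffMean` is monotone in `t`, this is at most a
constant times the integral of the function in the hypothesis over the dyadic box of level `κ`; for
fixed `J` these boxes are disjoint, so the norms are summable (`tsum_eLpNorm_tensorOp_lt_top`).

The series of derivatives therefore converges in `L_q`. The series of the operators telescopes to
`E_k f`, which tends to `f` in `L_1` (`tendsto_lintegral_splineOp_sub`), and testing against smooth
functions identifies the sum of the derivatives as `𝓓^a f`
(`exists_isGeneralizedDeriv_of_tsum_lt_top`). For `q < p` the argument is run with exponent `p`,
because the hypothesis is then the same and the cube has measure one. -/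

theorem measurable_bspline (m : ℕ) : Measurable (bspline m) := by
  induction m with
  | zero => exact measurable_const.indicator measurableSet_Ioo
  | succ m ih =>
    have h : Measurable fun z : ℝ × ℝ => bspline m (z.1 - z.2) :=
      ih.comp (measurable_fst.sub measurable_snd)
    exact (h.stronglyMeasurable.integral_prod_right
      (ν := volume.restrict (Set.Ioo (0 : ℝ) 1))).measurable

theorem abs_bspline_le_one (m : ℕ) (x : ℝ) : |bspline m x| ≤ 1 := by
  induction m generalizing x with
  | zero =>
    by_cases hx : x ∈ Set.Ioo (0 : ℝ) 1 <;> simp [bspline, Set.indicator, hx]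
  | succ m ih =>
    have h := norm_setIntegral_le_of_norm_le_const (μ := volume) (s := Set.Ioo (0 : ℝ) 1)
      (f := fun y => bspline m (x - y)) (C := 1) (by simp) (fun y _ => ih (x - y))
    simpa [bspline] using h

theorem bspline_eq_zero (m : ℕ) {x : ℝ} (hx : x ∉ Set.Ioo (0 : ℝ) (m + 1)) :
    bspline m x = 0 := by
  induction m generalizing x with
  | zero => exact Set.indicator_of_notMem (by simpa using hx) _
  | succ m ih =>
    refine setIntegral_eq_zero_of_forall_eq_zero fun y hy => ih fun h => hx ?_
    have h1 := hy.1; have h2 := hy.2; have h3 := h.1; have h4 := h.2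
    push_cast
    constructor <;> linarith

theorem integrable_bspline (m : ℕ) : Integrable (bspline m) := by
  have h : IntegrableOn (bspline m) (Set.Ioo (0 : ℝ) (m + 1)) :=
    Measure.integrableOn_of_bounded (M := 1) (by simp) (measurable_bspline m).aestronglyMeasurable
      (ae_of_all _ (abs_bspline_le_one m))
  refine h.integrable_of_forall_notMem_eq_zero fun x hx => bspline_eq_zero m hx

/-- Fubini's theorem: `ψ^{1,m}` is the density of a sum of `m + 1` independent uniform variables,
and the last variable is split off. This replaces explicit formulas for B-splines. -/
theorem integral_bspline_succ_mul (m : ℕ) {h : ℝ → ℝ} (hm : Measurable h) {C : ℝ}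
    (hC : ∀ x, |h x| ≤ C) :
    ∫ x, bspline (m + 1) x * h x =
      ∫ y in Set.Ioo (0 : ℝ) 1, ∫ z, bspline m z * h (z + y) := by
  have h1 : Integrable (fun z : ℝ × ℝ => bspline m (z.1 - z.2) * h z.1)
      (volume.prod (volume.restrict (Set.Ioo (0 : ℝ) 1))) := by
    refine Integrable.mul_bdd (c := C) ?_ (hm.comp measurable_fst).aestronglyMeasurable
      (ae_of_all _ fun z => hC z.1)
    refine (integrable_prod_iff' ?_).2 ⟨ae_of_all _ fun y => ?_, ?_⟩
    · exact ((measurable_bspline m).comp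
        (measurable_fst.sub measurable_snd)).aestronglyMeasurable
    · exact (integrable_bspline m).comp_sub_right y
    · have : ∀ y : ℝ, ∫ x, ‖bspline m (x - y)‖ = ∫ x, ‖bspline m x‖ := fun y =>
        integral_sub_right_eq_self (fun x => ‖bspline m x‖) y
      simp only [this]
      exact integrable_const _
  calc ∫ x, bspline (m + 1) x * h x
      = ∫ x, ∫ y in Set.Ioo (0 : ℝ) 1, bspline m (x - y) * h x := by
        simp only [bspline, integral_mul_const]
    _ = ∫ y in Set.Ioo (0 : ℝ) 1, ∫ x, bspline m (x - y) * h x := integral_integral_swap h1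
    _ = _ := by
        congr 1 with y
        rw [← integral_add_right_eq_self (fun x => bspline m (x - y) * h x) y]
        simp

/-- The rule `(ψ^{1,m+1})' = ψ^{1,m} - ψ^{1,m}(· - 1)` in weak form, so that the jumps of `ψ^{1,0}`
need no separate treatment. -/
theorem integral_bspline_succ_mul_deriv (m : ℕ) {χ : ℝ → ℝ} (hχ : ContDiff ℝ 1 χ)
    (hc : HasCompactSupport χ) :
    ∫ x, bspline (m + 1) x * deriv χ x = -∫ x, (bspline m x - bspline m (x - 1)) * χ x := by
  have hd : Continuous (deriv χ) := hχ.continuous_deriv le_rfl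
  obtain ⟨C, hC⟩ := hc.deriv.exists_bound_of_continuous hd
  obtain ⟨C', hC'⟩ := hc.exists_bound_of_continuous hχ.continuous
  rw [integral_bspline_succ_mul m hd.measurable hC]
  have h1 : Integrable (fun z : ℝ × ℝ => bspline m z.2 * deriv χ (z.2 + z.1))
      ((volume.restrict (Set.Ioo (0 : ℝ) 1)).prod volume) := by
    refine Integrable.mul_bdd (c := C) ?_
      (hd.measurable.comp (measurable_snd.add measurable_fst)).aestronglyMeasurable
      (ae_of_all _ fun z => hC _)
    simpa using (integrable_const (1 : ℝ)).mul_prod (integrable_bspline m)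
  rw [integral_integral_swap h1]
  have h2 : ∀ z, ∫ y in Set.Ioo (0 : ℝ) 1, bspline m z * deriv χ (z + y) =
      bspline m z * (χ (z + 1) - χ z) := by
    intro z
    rw [integral_const_mul, ← integral_Ioc_eq_integral_Ioo,
      ← intervalIntegral.integral_of_le zero_le_one,
      intervalIntegral.integral_comp_add_left (fun y => deriv χ y)]
    rw [intervalIntegral.integral_deriv_eq_sub (fun x _ => hχ.differentiable (by simp) x)
      (hd.intervalIntegrable _ _)]
    simp
  simp only [h2]
  have i1 : Integrable fun z => bspline m z * χ (z + 1) :=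
    (integrable_bspline m).mul_bdd (c := C')
      (hχ.continuous.measurable.comp (measurable_id.add_const 1)).aestronglyMeasurable
      (ae_of_all _ fun z => hC' _)
  have i2 : Integrable fun z => bspline m z * χ z :=
    (integrable_bspline m).mul_bdd (c := C')
      hχ.continuous.measurable.aestronglyMeasurable (ae_of_all _ fun z => hC' _)
  have i3 : Integrable fun z => bspline m (z - 1) * χ z := by
    simpa using i1.comp_sub_right 1
  simp only [mul_sub, sub_mul]
  rw [integral_sub i1 i2, integral_sub i2 i3]
  rw [← integral_add_right_eq_self (fun z => bspline m (z - 1) * χ z) 1]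
  simp

/-! ### Weak derivatives of splines times polynomials -/

/-- `w` is a weak derivative of order `a` of `u` on the line. -/
def HasWeakDeriv (a : ℕ) (u w : ℝ → ℝ) : Prop :=
  ∀ φ : ℝ → ℝ, ContDiff ℝ ∞ φ → HasCompactSupport φ →
    ∫ x, u x * iteratedDeriv a φ x = (-1) ^ a * ∫ x, w x * φ x

/-- The weak derivative of order `a ≤ m` of `ψ^{1,m} P`. -/
def splDer : ℕ → ℕ → ℝ[X] → ℝ → ℝ
  | 0, m, P => fun x => bspline m x * P.eval x
  | _ + 1, 0, _ => 0
  | a + 1, m + 1, P => fun x => splDer a m P x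
      - splDer a m (P.comp (Polynomial.X + 1)) (x - 1) + splDer a (m + 1) (Polynomial.derivative P) x

theorem measurable_splDer (a m : ℕ) (P : ℝ[X]) : Measurable (splDer a m P) := by
  induction a generalizing m P with
  | zero => exact (measurable_bspline m).mul P.continuous.measurable
  | succ a ih =>
    cases m with
    | zero => exact measurable_const
    | succ m =>
      exact ((ih m P).sub ((ih m _).comp (measurable_id.sub_const 1))).add (ih (m + 1) _)

theorem splDer_eq_zero (a m : ℕ) (P : ℝ[X]) {x : ℝ} (hx : x ∉ Set.Ioo (0 : ℝ) (m + 1)) :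
    splDer a m P x = 0 := by
  induction a generalizing m P x with
  | zero => simp [splDer, bspline_eq_zero m hx]
  | succ a ih =>
    cases m with
    | zero => rfl
    | succ m =>
      have h1 : splDer a m P x = 0 := ih m P fun h => hx ⟨h.1, by push_cast; linarith [h.2]⟩
      have h2 : splDer a m (P.comp (Polynomial.X + 1)) (x - 1) = 0 :=
        ih m _ fun h => hx ⟨by linarith [h.1], by push_cast; linarith [h.2]⟩
      simp [splDer, h1, h2, ih (m + 1) _ hx]

theorem exists_abs_splDer_le (a m : ℕ) (P : ℝ[X]) : ∃ C, ∀ x, |splDer a m P x| ≤ C := by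
  induction a generalizing m P with
  | zero =>
    obtain ⟨C, hC⟩ := (isCompact_Icc (a := (0 : ℝ)) (b := m + 1)).exists_bound_of_continuousOn
      P.continuous.continuousOn
    refine ⟨C, fun x => ?_⟩
    by_cases hx : x ∈ Set.Ioo (0 : ℝ) (m + 1)
    · have := hC x ⟨hx.1.le, hx.2.le⟩
      calc |splDer 0 m P x| = |bspline m x| * |P.eval x| := abs_mul _ _
        _ ≤ 1 * C := mul_le_mul (abs_bspline_le_one m x) this (abs_nonneg _) zero_le_one
        _ = C := one_mul C
    · rw [splDer_eq_zero 0 m P hx, abs_zero]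
      exact (norm_nonneg _).trans (hC 0 ⟨le_rfl, by positivity⟩)
  | succ a ih =>
    cases m with
    | zero => exact ⟨0, fun x => by simp [splDer]⟩
    | succ m =>
      obtain ⟨C1, h1⟩ := ih m P
      obtain ⟨C2, h2⟩ := ih m (P.comp (Polynomial.X + 1))
      obtain ⟨C3, h3⟩ := ih (m + 1) (Polynomial.derivative P)
      refine ⟨C1 + C2 + C3, fun x => ?_⟩
      exact (abs_add_le _ _).trans (add_le_add ((abs_sub _ _).trans
        (add_le_add (h1 x) (h2 _))) (h3 x))

theorem integrable_splDer (a m : ℕ) (P : ℝ[X]) : Integrable (splDer a m P) := by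
  obtain ⟨C, hC⟩ := exists_abs_splDer_le a m P
  have h : IntegrableOn (splDer a m P) (Set.Ioo (0 : ℝ) (m + 1)) :=
    Measure.integrableOn_of_bounded (M := C) (by simp)
      (measurable_splDer a m P).aestronglyMeasurable (ae_of_all _ hC)
  exact h.integrable_of_forall_notMem_eq_zero fun x hx => splDer_eq_zero a m P hx

theorem contDiff_iteratedDeriv {φ : ℝ → ℝ} (hφ : ContDiff ℝ ∞ φ) (a : ℕ) :
    ContDiff ℝ ∞ (iteratedDeriv a φ) :=
  hφ.iterate_deriv a |> fun h => by rwa [iteratedDeriv_eq_iterate]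

theorem hasCompactSupport_iteratedDeriv {φ : ℝ → ℝ} (hφ : HasCompactSupport φ) (a : ℕ) :
    HasCompactSupport (iteratedDeriv a φ) := by
  induction a with
  | zero => simpa using hφ
  | succ a ih => rw [iteratedDeriv_succ]; exact ih.deriv

theorem integrable_splDer_mul (a m : ℕ) (P : ℝ[X]) {φ : ℝ → ℝ} (hφ : Continuous φ)
    (hc : HasCompactSupport φ) : Integrable fun x => splDer a m P x * φ x := by
  obtain ⟨C, hC⟩ := hc.exists_bound_of_continuous hφ
  exact (integrable_splDer a m P).mul_bdd (c := C) hφ.aestronglyMeasurable (ae_of_all _ hC)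

/-- Leibniz' rule combined with the derivative of a B-spline. The factor `ψ^{1,m}(x - 1) P(x)` is
the translate by one of `ψ^{1,m} P(X + 1)`, whence the composition with `X + 1`. The bound `a ≤ m`
keeps the recursion away from the branch of `splDer` with the default value zero, where the jumps of
`ψ^{1,0}` would produce point masses. -/
theorem hasWeakDeriv_splDer {a m : ℕ} (h : a ≤ m) (P : ℝ[X]) :
    HasWeakDeriv a (splDer 0 m P) (splDer a m P) := by
  induction a generalizing m P with
  | zero => intro φ _ _; simp
  | succ a ih =>
    obtain ⟨m, rfl⟩ : ∃ n, m = n + 1 := ⟨m - 1, by omega⟩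
    intro φ hφ hc
    set χ := iteratedDeriv a φ with hχ
    have c1 : ContDiff ℝ ∞ χ := contDiff_iteratedDeriv hφ a
    have c2 : HasCompactSupport χ := hasCompactSupport_iteratedDeriv hc a
    have e1 : ∫ x, splDer 0 (m + 1) P x * deriv χ x =
        -(∫ x, splDer 0 m P x * χ x)
          + (∫ x, splDer 0 m (P.comp (Polynomial.X + 1)) x * χ (x + 1))
          - ∫ x, splDer 0 (m + 1) (Polynomial.derivative P) x * χ x := by
      have k1 : ContDiff ℝ 1 fun x => P.eval x * χ x :=
        (show ContDiff ℝ 1 fun x => P.eval x by simpa using P.contDiff_aeval (𝕜 := ℝ) (n := 1)).mul (c1.of_le (by exact_mod_cast le_top))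
      have k2 : HasCompactSupport fun x => P.eval x * χ x := c2.mul_left
      have k3 : ∀ x, deriv (fun x => P.eval x * χ x) x =
          (Polynomial.derivative P).eval x * χ x + P.eval x * deriv χ x := fun x =>
        ((P.hasDerivAt x).mul (c1.differentiable (by simp) x).hasDerivAt).deriv
      have key := integral_bspline_succ_mul_deriv m k1 k2
      have i0 : Integrable fun x => splDer 0 (m + 1) P x * deriv χ x :=
        integrable_splDer_mul _ _ _ (c1.continuous_deriv (by simp)) c2.deriv
      have i1 := integrable_splDer_mul 0 (m + 1) (Polynomial.derivative P) c1.continuous c2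
      have i2 := integrable_splDer_mul 0 m P c1.continuous c2
      have i3 : Integrable fun x => bspline m (x - 1) * P.eval x * χ x := by
        have := (integrable_splDer_mul 0 m (P.comp (Polynomial.X + 1))
          (c1.continuous.comp (continuous_id.add continuous_const : Continuous fun x : ℝ => x + 1))
          (c2.comp_homeomorph (Homeomorph.addRight (1 : ℝ)))).comp_sub_right 1
        simpa [splDer] using this
      have e2 : ∫ x, splDer 0 m (P.comp (Polynomial.X + 1)) x * χ (x + 1) =
          ∫ x, bspline m (x - 1) * P.eval x * χ x := by
        rw [← integral_add_right_eq_self (fun x => bspline m (x - 1) * P.eval x * χ x) 1]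
        simp [splDer]
      have e3 : ∫ x, bspline (m + 1) x * deriv (fun x => P.eval x * χ x) x =
          (∫ x, splDer 0 (m + 1) (Polynomial.derivative P) x * χ x) +
            ∫ x, splDer 0 (m + 1) P x * deriv χ x := by
        rw [← integral_add i1 i0]
        congr 1 with x
        rw [k3]; simp only [splDer]; ring
      have e4 : ∫ x, (bspline m x - bspline m (x - 1)) * (P.eval x * χ x) =
          (∫ x, splDer 0 m P x * χ x) - ∫ x, bspline m (x - 1) * P.eval x * χ x := by
        rw [← integral_sub i2 i3]
        congr 1 with x
        simp only [splDer]; ring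
      rw [e3, e4] at key
      rw [e2]; linarith
    rw [iteratedDeriv_succ, ← hχ, e1]
    -- One derivative now sits on the splines; the other `a` are moved by induction, separately for
    -- the three resulting products.
    have s1 := ih (m := m) (by omega) P φ hφ hc
    have s2 := ih (m := m) (by omega) (P.comp (Polynomial.X + 1)) (fun x => φ (x + 1))
      (hφ.comp (contDiff_id.add contDiff_const)) (hc.comp_homeomorph (Homeomorph.addRight (1 : ℝ)))
    have s3 := ih (m := m + 1) (by omega) (Polynomial.derivative P) φ hφ hc
    rw [iteratedDeriv_comp_add_const] at s2
    rw [← hχ] at s1 s2 s3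
    rw [s1, s2, s3]
    have t2 : ∫ x, splDer a m (P.comp (Polynomial.X + 1)) x * φ (x + 1) =
        ∫ x, splDer a m (P.comp (Polynomial.X + 1)) (x - 1) * φ x := by
      rw [← integral_add_right_eq_self
        (fun x => splDer a m (P.comp (Polynomial.X + 1)) (x - 1) * φ x) 1]
      simp
    have j1 := integrable_splDer_mul a m P hφ.continuous hc
    have j2 : Integrable fun x => splDer a m (P.comp (Polynomial.X + 1)) (x - 1) * φ x := by
      have := (integrable_splDer_mul a m (P.comp (Polynomial.X + 1))
          (hφ.continuous.comp (continuous_id.add continuous_const : Continuous fun x : ℝ => x + 1))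
          (hc.comp_homeomorph (Homeomorph.addRight (1 : ℝ)))).comp_sub_right 1
      simpa using this
    have j3 := integrable_splDer_mul a (m + 1) (Polynomial.derivative P) hφ.continuous hc
    have e5 : ∫ x, splDer (a + 1) (m + 1) P x * φ x = (∫ x, splDer a m P x * φ x)
        - (∫ x, splDer a m (P.comp (Polynomial.X + 1)) (x - 1) * φ x)
        + ∫ x, splDer a (m + 1) (Polynomial.derivative P) x * φ x := by
      have j4 : Integrable fun x => splDer a m P x * φ x
          - splDer a m (P.comp (Polynomial.X + 1)) (x - 1) * φ x := j1.sub j2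
      rw [← integral_sub j1 j2, ← integral_add j4 j3]
      congr 1 with x
      simp only [splDer]; ring
    rw [e5, t2]; ring

/-! ### Partition of unity -/

/-- For degree zero exactly one translate, that of index `⌊u⌋`, is nonzero; higher degrees follow by
averaging over `u - y`. Integers are excluded since `ψ^{1,0}` is the indicator of an open interval.
-/
theorem sum_bspline_sub (m : ℕ) (A B : ℤ) {u : ℝ} (hu : u ∈ Set.Ioo ((A : ℝ) + m) (B + 1))
    (hn : ∀ n : ℤ, u ≠ n) : ∑ ν ∈ Finset.Icc A B, bspline m (u - ν) = 1 := by
  induction m generalizing u with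
  | zero =>
    rw [Finset.sum_eq_single ⌊u⌋]
    · refine Set.indicator_of_mem (show u - ⌊u⌋ ∈ Set.Ioo (0 : ℝ) 1 from ⟨?_, ?_⟩) _
      · have := Int.floor_le u
        have h2 := hn ⌊u⌋
        have : (⌊u⌋ : ℝ) < u := lt_of_le_of_ne this (Ne.symm h2)
        linarith
      · have := Int.lt_floor_add_one u
        linarith
    · intro ν _ hν
      refine Set.indicator_of_notMem (fun h => hν ?_) _
      symm
      rw [Int.floor_eq_iff]
      exact ⟨by linarith [h.1], by linarith [h.2]⟩
    · intro h
      refine absurd (Finset.mem_Icc.2 ⟨?_, ?_⟩) h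
      · rw [Int.le_floor]; have := hu.1; simp at this; linarith
      · have : ⌊u⌋ < B + 1 := by rw [Int.floor_lt]; push_cast; exact hu.2
        omega
  | succ m ih =>
    simp only [bspline]
    rw [← integral_finsetSum]
    · have : ∀ᵐ y ∂(volume.restrict (Set.Ioo (0 : ℝ) 1)),
          ∑ ν ∈ Finset.Icc A B, bspline m (u - ν - y) = 1 := by
        -- The shifted point `u - y` is an integer only for countably many `y`, which the integral
        -- does not see.
        have hc : (Set.range fun n : ℤ => u - n).Countable := Set.countable_range _
        filter_upwards [ae_restrict_mem measurableSet_Ioo,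
          ae_restrict_of_ae (hc.ae_notMem volume)] with y hy hy'
        have := ih (u := u - y) (by
          have h1 := hu.1; have h2 := hu.2; push_cast at h1
          exact ⟨by linarith [hy.2], by linarith [hy.1]⟩) (fun n hn' => hy' ⟨n, by
            simp only; linarith⟩)
        rw [← this]
        exact Finset.sum_congr rfl fun ν _ => by congr 1; ring
      rw [integral_congr_ae this]
      simp
    · intro ν _
      refine Integrable.integrableOn ?_
      have := (integrable_bspline m).comp_sub_left (u - ν)
      simpa using this

/-! ### The reproducing kernel of polynomials on a cell -/

/-- The Gram matrix of the monomials of degree less than `l` in `L_2(0,1)`. -/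
def gramMatrix (l : ℕ) : Matrix (Fin l) (Fin l) ℝ :=
  fun a b => ∫ x in Set.Ioo (0 : ℝ) 1, x ^ (a : ℕ) * x ^ (b : ℕ)

theorem integrableOn_Ioo_of_continuous {f : ℝ → ℝ} (hf : Continuous f) (a b : ℝ) :
    IntegrableOn f (Set.Ioo a b) :=
  (hf.integrableOn_Icc (a := a) (b := b)).mono_set Set.Ioo_subset_Icc_self

/-- A null vector of the Gram matrix is the coefficient vector of a polynomial of zero norm in
`L_2(0,1)`. -/
theorem det_gramMatrix_ne_zero (l : ℕ) : (gramMatrix l).det ≠ 0 := by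
  intro h
  obtain ⟨c, hc, hc'⟩ := Matrix.exists_mulVec_eq_zero_iff.2 h
  let P : ℝ[X] := ∑ a : Fin l, Polynomial.monomial (a : ℕ) (c a)
  have hP : ∀ x, P.eval x = ∑ a : Fin l, c a * x ^ (a : ℕ) := fun x => by
    simp [P, Polynomial.eval_finsetSum]
  have hint : ∫ x in Set.Ioo (0 : ℝ) 1, P.eval x * P.eval x = 0 := by
    have e1 : ∀ x, P.eval x * P.eval x =
        ∑ a : Fin l, ∑ b : Fin l, c a * c b * (x ^ (a : ℕ) * x ^ (b : ℕ)) := fun x => by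
      rw [hP, Finset.sum_mul_sum]
      exact Finset.sum_congr rfl fun a _ => Finset.sum_congr rfl fun b _ => by ring
    have e2 : ∀ a : Fin l, ∑ b : Fin l, gramMatrix l a b * c b = 0 := fun a => by
      have := congrFun hc' a
      simpa [Matrix.mulVec, dotProduct] using this
    simp only [e1]
    rw [integral_finsetSum _ fun a _ => integrableOn_Ioo_of_continuous (by fun_prop) 0 1]
    refine Finset.sum_eq_zero fun a _ => ?_
    rw [integral_finsetSum _ fun b _ => integrableOn_Ioo_of_continuous (by fun_prop) 0 1]
    have : ∀ b : Fin l, ∫ x in Set.Ioo (0 : ℝ) 1, c a * c b * (x ^ (a : ℕ) * x ^ (b : ℕ)) =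
        c a * (gramMatrix l a b * c b) := fun b => by
      rw [integral_const_mul, gramMatrix]; ring
    simp only [this, ← Finset.mul_sum, e2, mul_zero]
  have h0 : (fun x => P.eval x * P.eval x) =ᵐ[volume.restrict (Set.Ioo (0 : ℝ) 1)] 0 :=
    (integral_eq_zero_iff_of_nonneg (fun x => mul_self_nonneg _)
      (integrableOn_Ioo_of_continuous (P.continuous.mul P.continuous) 0 1)).1 hint
  have h1 : Set.EqOn (fun x => P.eval x * P.eval x) 0 (Set.Ioo (0 : ℝ) 1) :=
    Measure.eqOn_open_of_ae_eq h0 isOpen_Ioo (by fun_prop) continuous_zero.continuousOn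
  have hP0 : P = 0 := by
    refine Polynomial.eq_zero_of_infinite_isRoot P
      ((Set.Ioo_infinite (zero_lt_one' ℝ)).mono fun x hx => ?_)
    have := h1 hx
    simpa using this
  refine hc (funext fun a => ?_)
  have := congrArg (fun Q => Polynomial.coeff Q (a : ℕ)) hP0
  simpa [P, Polynomial.finsetSum_coeff, Polynomial.coeff_monomial, Fin.val_inj] using this

/-- The reproducing kernel of the polynomials of degree less than `l` in `L_2(0,1)`. -/
def gramKer (l : ℕ) (u v : ℝ) : ℝ :=
  ∑ a : Fin l, ∑ b : Fin l, (gramMatrix l)⁻¹ a b * u ^ (a : ℕ) * v ^ (b : ℕ)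

theorem gramKer_comm (l : ℕ) (u v : ℝ) : gramKer l u v = gramKer l v u := by
  have hs : (gramMatrix l).transpose = gramMatrix l := by
    ext a b
    simp only [gramMatrix, Matrix.transpose_apply, mul_comm]
  have hi : ∀ a b, (gramMatrix l)⁻¹ a b = (gramMatrix l)⁻¹ b a := fun a b => by
    conv_lhs => rw [← hs, ← Matrix.transpose_nonsing_inv]
    rfl
  unfold gramKer
  rw [Finset.sum_comm]
  refine Finset.sum_congr rfl fun a _ => Finset.sum_congr rfl fun b _ => ?_
  rw [hi b a]; ring

theorem integral_gramKer_mul_pow {l c : ℕ} (hc : c < l) (u : ℝ) :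
    ∫ v in Set.Ioo (0 : ℝ) 1, gramKer l u v * v ^ c = u ^ c := by
  have hu : IsUnit (gramMatrix l).det := isUnit_iff_ne_zero.2 (det_gramMatrix_ne_zero l)
  have e : ∀ v, gramKer l u v * v ^ c = ∑ a : Fin l, ∑ b : Fin l,
      ((gramMatrix l)⁻¹ a b * u ^ (a : ℕ)) * (v ^ (b : ℕ) * v ^ c) := fun v => by
    rw [gramKer, Finset.sum_mul]
    refine Finset.sum_congr rfl fun a _ => ?_
    rw [Finset.sum_mul]
    exact Finset.sum_congr rfl fun b _ => by ring
  simp only [e]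
  rw [integral_finsetSum _ fun a _ => integrableOn_Ioo_of_continuous (by fun_prop) 0 1]
  have e2 : ∀ a : Fin l, ∫ v in Set.Ioo (0 : ℝ) 1, ∑ b : Fin l,
      ((gramMatrix l)⁻¹ a b * u ^ (a : ℕ)) * (v ^ (b : ℕ) * v ^ c) =
      u ^ (a : ℕ) * ((gramMatrix l)⁻¹ * gramMatrix l) a ⟨c, hc⟩ := fun a => by
    rw [integral_finsetSum _ fun a _ => integrableOn_Ioo_of_continuous (by fun_prop) 0 1,
      Matrix.mul_apply, Finset.mul_sum]
    refine Finset.sum_congr rfl fun b _ => ?_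
    rw [integral_const_mul]
    simp only [gramMatrix]; ring
  simp only [e2, Matrix.nonsing_inv_mul _ hu, Matrix.one_apply]
  rw [Finset.sum_eq_single ⟨c, hc⟩ (fun a _ h => by simp [h]) (by simp)]
  simp

theorem continuous_gramKer (l : ℕ) : Continuous fun z : ℝ × ℝ => gramKer l z.1 z.2 := by
  unfold gramKer; fun_prop

/-- The reproducing kernel of the polynomials of degree less than `l` on the interval
`(s⁻¹ n, s⁻¹ (n + 1))`. -/
def cellKer (l : ℕ) (s n x y : ℝ) : ℝ := s * gramKer l (s * x - n) (s * y - n)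

theorem cellKer_comm (l : ℕ) (s n x y : ℝ) : cellKer l s n x y = cellKer l s n y x := by
  rw [cellKer, gramKer_comm, cellKer]

theorem continuous_cellKer (l : ℕ) (s n : ℝ) :
    Continuous fun z : ℝ × ℝ => cellKer l s n z.1 z.2 := by
  unfold cellKer
  exact continuous_const.mul ((continuous_gramKer l).comp
    (by fun_prop : Continuous fun z : ℝ × ℝ => (s * z.1 - n, s * z.2 - n)))

/-- The affine image of `integral_gramKer_mul_pow`. The point `x` need not lie in the cell: a
polynomial fitted on one cell is evaluated on neighbouring ones, both in the spline operators and in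
`momentTransfer`. -/
theorem integral_cellKer_mul_eval {l : ℕ} {s : ℝ} (hs : 0 < s) (n x : ℝ) {p : ℝ[X]}
    (hp : p.natDegree < l) :
    ∫ y in Set.Ioo (s⁻¹ * n) (s⁻¹ * n + s⁻¹), cellKer l s n x y * p.eval y = p.eval x := by
  set q : ℝ[X] := p.comp (Polynomial.C s⁻¹ * Polynomial.X + Polynomial.C (s⁻¹ * n)) with hq
  have hqd : q.natDegree < l := by
    refine lt_of_le_of_lt Polynomial.natDegree_comp_le ?_
    refine lt_of_le_of_lt ?_ hp
    calc _ ≤ p.natDegree * 1 := Nat.mul_le_mul_left _ Polynomial.natDegree_linear_le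
      _ = _ := mul_one _
  have hqe : ∀ y, q.eval (s * y - n) = p.eval y := fun y => by
    rw [hq, Polynomial.eval_comp]
    congr 1
    simp only [Polynomial.eval_add, Polynomial.eval_mul, Polynomial.eval_C, Polynomial.eval_X]
    field_simp; ring
  have hle : s⁻¹ * n ≤ s⁻¹ * n + s⁻¹ := by have := inv_pos.2 hs; linarith
  rw [← integral_Ioc_eq_integral_Ioo, ← intervalIntegral.integral_of_le hle]
  have e1 : ∀ y, cellKer l s n x y * p.eval y =
      s * (fun v => gramKer l (s * x - n) v * q.eval v) (s * y - n) := fun y => by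
    simp only [hqe, cellKer]; ring
  simp only [e1]
  rw [intervalIntegral.integral_const_mul,
    intervalIntegral.integral_comp_mul_sub (fun v => gramKer l (s * x - n) v * q.eval v) hs.ne']
  have a1 : s * (s⁻¹ * n) - n = 0 := by field_simp; ring
  have a2 : s * (s⁻¹ * n + s⁻¹) - n = 1 := by field_simp; ring
  rw [a1, a2, smul_eq_mul, ← mul_assoc, mul_inv_cancel₀ hs.ne', one_mul,
    intervalIntegral.integral_of_le zero_le_one, integral_Ioc_eq_integral_Ioo, ← hqe x]
  have hk : Continuous fun v => gramKer l (s * x - n) v :=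
    (continuous_gramKer l).comp (by fun_prop : Continuous fun v : ℝ => (s * x - n, v))
  simp only [Polynomial.eval_eq_sum_range' hqd, Finset.mul_sum]
  rw [integral_finsetSum _ fun a _ => integrableOn_Ioo_of_continuous (by fun_prop) 0 1]
  refine Finset.sum_congr rfl fun i hi => ?_
  rw [← integral_gramKer_mul_pow (Finset.mem_range.1 hi) (s * x - n), ← integral_const_mul]
  congr 1 with v
  ring

/-! ### Primitives and finite differences -/

/-- `W` is an indefinite integral of `w`. -/
def IsPrimitive (W w : ℝ → ℝ) : Prop := ∀ a b, ∫ x in a..b, w x = W b - W a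

theorem integrable_of_bounded_of_support {g : ℝ → ℝ} (hg : Measurable g) {B a b : ℝ}
    (hB : ∀ x, |g x| ≤ B) (h0 : ∀ x, x ∉ Set.Ioo a b → g x = 0) : Integrable g := by
  have h : IntegrableOn g (Set.Ioo a b) :=
    Measure.integrableOn_of_bounded (M := B) (by simp) hg.aestronglyMeasurable (ae_of_all _ hB)
  exact h.integrable_of_forall_notMem_eq_zero h0

theorem intervalIntegrable_of_bounded {g : ℝ → ℝ} (hg : Measurable g) {B : ℝ}
    (hB : ∀ x, |g x| ≤ B) (a b : ℝ) : IntervalIntegrable g volume a b :=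
  (intervalIntegrable_const (c := B)).mono_fun hg.aestronglyMeasurable
    (ae_of_all _ fun x => (hB x).trans (le_abs_self B))

theorem abs_fwdDiff_iter_le {g : ℝ → ℝ} {B : ℝ} (hB : ∀ x, |g x| ≤ B) (h : ℝ) (n : ℕ) (x : ℝ) :
    |(fwdDiff h)^[n] g x| ≤ 2 ^ n * B := by
  induction n generalizing x with
  | zero => simpa using hB x
  | succ n ih =>
    rw [Function.iterate_succ_apply', fwdDiff, pow_succ]
    have := abs_sub ((fwdDiff h)^[n] g (x + h)) ((fwdDiff h)^[n] g x)
    linarith [ih (x + h), ih x]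

theorem measurable_fwdDiff_iter {g : ℝ → ℝ} (hg : Measurable g) (h : ℝ) (n : ℕ) :
    Measurable ((fwdDiff h)^[n] g) := by
  induction n with
  | zero => exact hg
  | succ n ih =>
    rw [Function.iterate_succ_apply']
    exact (ih.comp (measurable_id.add_const h)).sub ih

theorem IsPrimitive.fwdDiff_iter {W w : ℝ → ℝ} (hW : IsPrimitive W w) (hw : Measurable w) {B : ℝ}
    (hB : ∀ x, |w x| ≤ B) (h : ℝ) (n : ℕ) :
    IsPrimitive ((fwdDiff h)^[n] W) ((fwdDiff h)^[n] w) := by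
  induction n with
  | zero => exact hW
  | succ n ih =>
    intro a b
    have hi := intervalIntegrable_of_bounded (measurable_fwdDiff_iter hw h n)
      (abs_fwdDiff_iter_le hB h n)
    simp only [Function.iterate_succ_apply', fwdDiff]
    rw [intervalIntegral.integral_sub ?_ (hi a b), intervalIntegral.integral_comp_add_right, ih, ih]
    · ring
    · exact (hi (a + h) (b + h)).comp_add_right h |> fun t => by simpa using t

/-- Peano's formula for differences: integrating against `ψ^{1,n}` means averaging over `n + 1`
independent uniform shifts, and each such average turns one antiderivative into one first difference
divided by the step. -/
theorem integral_bspline_mul_comp {v : ℕ → ℝ → ℝ} (hm : ∀ n, Measurable (v n)) {B : ℝ}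
    (hB : ∀ n x, |v n x| ≤ B) {n : ℕ} (hv : ∀ i ≤ n, IsPrimitive (v (i + 1)) (v i))
    {h : ℝ} (hh : h ≠ 0) (y : ℝ) :
    ∫ t, bspline n t * v 0 (y - h * t) =
      ((-h)⁻¹) ^ (n + 1) * (fwdDiff (-h))^[n + 1] (v (n + 1)) y := by
  -- A single uniform shift: the fundamental theorem of calculus on an interval of length `|h|`.
  have key : ∀ n, IsPrimitive (v (n + 1)) (v n) → ∀ k y,
      ∫ r in Set.Ioo (0 : ℝ) 1, (fwdDiff (-h))^[k] (v n) (y - h * r) =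
        (-h)⁻¹ * (fwdDiff (-h))^[k + 1] (v (n + 1)) y := by
    intro n hn k y
    rw [← integral_Ioc_eq_integral_Ioo, ← intervalIntegral.integral_of_le zero_le_one,
      intervalIntegral.integral_comp_sub_mul _ hh, (hn.fwdDiff_iter (hm n) (hB n) (-h) k),
      Function.iterate_succ_apply', fwdDiff, smul_eq_mul]
    simp only [mul_zero, sub_zero, mul_one, inv_neg, ← sub_eq_add_neg]
    ring
  induction n generalizing y with
  | zero =>
    have := key 0 (hv 0 le_rfl) 0 y
    simp only [Function.iterate_zero, id, zero_add] at this
    rw [zero_add, pow_one, ← this, ← integral_indicator measurableSet_Ioo]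
    congr 1 with t
    by_cases ht : t ∈ Set.Ioo (0 : ℝ) 1 <;> simp [bspline, ht]
  | succ n ih =>
    rw [integral_bspline_succ_mul n (h := fun t => v 0 (y - h * t))
      ((hm 0).comp (by fun_prop)) (fun x => hB 0 _)]
    have e : ∀ r, ∫ z, bspline n z * v 0 (y - h * (z + r)) =
        ((-h)⁻¹) ^ (n + 1) * (fwdDiff (-h))^[n + 1] (v (n + 1)) (y - h * r) := by
      intro r
      rw [← ih (fun i hi => hv i (by omega)) (y - h * r)]
      congr 1 with z
      congr 2; ring
    simp only [e]
    rw [integral_const_mul, key (n + 1) (hv (n + 1) le_rfl) (n + 1) y, pow_succ ((-h)⁻¹) (n + 1)]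
    ring

/-- The indefinite integral vanishing at zero. -/
def primitive (g : ℝ → ℝ) (y : ℝ) : ℝ := ∫ z in (0 : ℝ)..y, g z

section Primitive

variable {g : ℝ → ℝ} {B b : ℝ}

theorem isPrimitive_primitive (hg : Measurable g) (hB : ∀ x, |g x| ≤ B) :
    IsPrimitive (primitive g) g := fun a c => by
  have hi := intervalIntegrable_of_bounded hg hB
  exact (intervalIntegral.integral_interval_sub_left (hi 0 c) (hi 0 a)).symm

theorem measurable_primitive (hg : Measurable g) (hB : ∀ x, |g x| ≤ B) :
    Measurable (primitive g) :=
  (intervalIntegral.continuous_primitive (intervalIntegrable_of_bounded hg hB) 0).measurable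

/-- The vanishing mean keeps the primitive supported in the same interval; this is how each
vanishing moment is spent. -/
theorem primitive_eq_zero (h0 : ∀ x, x ∉ Set.Ioo 0 b → g x = 0)
    (hI : ∫ x, g x = 0) {x : ℝ} (hx : x ∉ Set.Ioo 0 b) : primitive g x = 0 := by
  rcases le_or_gt x 0 with h | h
  · refine intervalIntegral.integral_zero_ae (ae_of_all _ fun z hz => h0 z fun hz' => ?_)
    rw [Set.uIoc_of_ge h] at hz
    linarith [hz.2, hz'.1]
  · have hbx : b ≤ x := by by_contra hc; exact hx ⟨h, not_le.1 hc⟩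
    rw [primitive, intervalIntegral.integral_of_le h.le, setIntegral_eq_integral_of_forall_compl_eq_zero,
      hI]
    exact fun z hz => h0 z fun hz' => hz ⟨hz'.1, hz'.2.le.trans hbx⟩

theorem abs_primitive_le (hb1 : b ≤ 1) (hB : ∀ x, |g x| ≤ B)
    (h0 : ∀ x, x ∉ Set.Ioo 0 b → g x = 0) (hI : ∫ x, g x = 0) (x : ℝ) : |primitive g x| ≤ B := by
  have hB0 : 0 ≤ B := (abs_nonneg _).trans (hB 0)
  by_cases hx : x ∈ Set.Ioo 0 b
  · have := intervalIntegral.norm_integral_le_of_norm_le_const (a := 0) (b := x) (f := g) (C := B)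
      fun z _ => hB z
    rw [sub_zero, abs_of_pos hx.1] at this
    exact this.trans (by nlinarith [hx.2])
  · rw [primitive_eq_zero h0 hI hx, abs_zero]; exact hB0

/-- Integration by parts, carried out with Fubini's theorem as `g` is merely bounded. The moment of
order `i` of the primitive is a combination of the moments of orders `0` and `i + 1` of `g`, so a
primitive has one vanishing moment fewer. -/
theorem integral_primitive_mul_pow (hg : Measurable g) (hb1 : b ≤ 1)
    (hB : ∀ x, |g x| ≤ B) (h0 : ∀ x, x ∉ Set.Ioo 0 b → g x = 0) (hI : ∫ x, g x = 0) {i : ℕ}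
    (hI' : ∫ x, g x * x ^ (i + 1) = 0) : ∫ x, primitive g x * x ^ i = 0 := by
  have e1 : ∫ x, primitive g x * x ^ i = ∫ x in Set.Ioo 0 b, primitive g x * x ^ i := by
    refine (setIntegral_eq_integral_of_forall_compl_eq_zero fun x hx => ?_).symm
    rw [primitive_eq_zero h0 hI hx, zero_mul]
  have e2 : ∀ x ∈ Set.Ioo 0 b, primitive g x * x ^ i =
      ∫ z in Set.Ioo 0 b, (Set.Iio x).indicator (fun _ => (1 : ℝ)) z * g z * x ^ i := by
    intro x hx
    rw [integral_mul_const, primitive, intervalIntegral.integral_of_le hx.1.le,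
      integral_Ioc_eq_integral_Ioo]
    congr 1
    rw [← integral_indicator measurableSet_Ioo, ← integral_indicator measurableSet_Ioo]
    congr 1 with z
    simp only [Set.indicator, Set.mem_Ioo, Set.mem_Iio]
    have := hx.2
    split_ifs <;> first | (exfalso; grind) | simp
  rw [e1, setIntegral_congr_fun measurableSet_Ioo e2, integral_integral_swap]
  -- For fixed `z` the variable `x` runs over `(z, b)`, giving `g z (b^{i+1} - z^{i+1}) / (i + 1)`;
  -- both terms integrate to zero.
  · have e3 : ∀ z ∈ Set.Ioo 0 b,
        ∫ x in Set.Ioo 0 b, (Set.Iio x).indicator (fun _ => (1 : ℝ)) z * g z * x ^ i =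
          g z * (b ^ (i + 1) / (i + 1)) - (g z * z ^ (i + 1)) * (i + 1 : ℝ)⁻¹ := by
      intro z hz
      have : ∫ x in Set.Ioo 0 b, (Set.Iio x).indicator (fun _ => (1 : ℝ)) z * g z * x ^ i =
          ∫ x in Set.Ioo z b, g z * x ^ i := by
        rw [← integral_indicator measurableSet_Ioo, ← integral_indicator measurableSet_Ioo]
        congr 1 with x
        simp only [Set.indicator, Set.mem_Ioo, Set.mem_Iio]
        have := hz.1
        split_ifs <;> first | (exfalso; grind) | simp
      rw [this, integral_const_mul, ← integral_Ioc_eq_integral_Ioo,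
        ← intervalIntegral.integral_of_le hz.2.le, integral_pow]
      field_simp
    rw [setIntegral_congr_fun measurableSet_Ioo e3]
    have hgi := integrable_of_bounded_of_support hg hB h0
    have hgi' : Integrable fun x => g x * x ^ (i + 1) := by
      refine integrable_of_bounded_of_support (B := B) (a := 0) (b := b)
        (hg.mul (measurable_id.pow_const _)) (fun x => ?_) fun x hx => by simp [h0 x hx]
      by_cases hx : x ∈ Set.Ioo 0 b
      · rw [abs_mul, abs_pow, abs_of_pos hx.1]
        exact (mul_le_of_le_one_right (abs_nonneg _)
          (pow_le_one₀ hx.1.le (hx.2.le.trans hb1))).trans (hB x)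
      · simpa [h0 x hx] using (abs_nonneg _).trans (hB 0)
    rw [integral_sub (hgi.mul_const _).integrableOn (hgi'.mul_const _).integrableOn,
      integral_mul_const, integral_mul_const,
      setIntegral_eq_integral_of_forall_compl_eq_zero fun x hx => h0 x hx,
      setIntegral_eq_integral_of_forall_compl_eq_zero fun x hx => by simp [h0 x hx], hI, hI']
    simp
  · have hm : Measurable (Function.uncurry fun x z =>
        (Set.Iio x).indicator (fun _ => (1 : ℝ)) z * g z * x ^ i) := by
      have : (Function.uncurry fun x z => (Set.Iio x).indicator (fun _ => (1 : ℝ)) z * g z * x ^ i) =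
          fun w : ℝ × ℝ => ({w : ℝ × ℝ | w.2 < w.1}.indicator (fun _ => (1 : ℝ)) w) *
            g w.2 * w.1 ^ i := by
        ext ⟨x, z⟩; simp [Set.indicator]
      rw [this]
      exact ((measurable_const.indicator (measurableSet_lt measurable_snd measurable_fst)).mul
        (hg.comp measurable_snd)).mul (measurable_fst.pow_const _)
    rw [Measure.prod_restrict]
    refine Measure.integrableOn_of_bounded (M := B) ?_ hm.aestronglyMeasurable ?_
    · rw [Measure.prod_prod]; simp [ENNReal.mul_eq_top]
    · filter_upwards [ae_restrict_mem (measurableSet_Ioo.prod measurableSet_Ioo)] with w hw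
      obtain ⟨h1, h2⟩ := hw.1
      rw [Function.uncurry, norm_mul, norm_mul, norm_pow, Real.norm_of_nonneg h1.le]
      have a1 : ‖(Set.Iio w.1).indicator (fun _ => (1 : ℝ)) w.2‖ ≤ 1 := by
        simp only [Set.indicator]; split_ifs <;> simp
      have a2 : w.1 ^ i ≤ 1 := pow_le_one₀ h1.le (h2.le.trans hb1)
      have a3 : ‖g w.2‖ ≤ B := hB w.2
      have a4 : 0 ≤ B := (abs_nonneg _).trans (hB 0)
      calc _ ≤ 1 * B * 1 := by gcongr
        _ = B := by ring

end Primitive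

/-! ### Functions represented by averaged differences -/

/-- Steps are negative because the difference with step `-ξ` is the adjoint of the difference with
step `ξ`, up to no sign: the shift `y - i ξ` of the kernel becomes the shift `y + i ξ` of `f`. -/
theorem fwdDiff_neg_iter (l : ℕ) (ξ : ℝ) (g : ℝ → ℝ) (y : ℝ) :
    (fwdDiff (-ξ))^[l] g y =
      ∑ i ∈ Finset.range (l + 1), ((-1) ^ (l - i) * (l.choose i : ℝ)) * g (y - i * ξ) := by
  rw [fwdDiff_iter_eq_sum_shift]
  refine Finset.sum_congr rfl fun i _ => ?_
  rw [zsmul_eq_mul]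
  push_cast
  congr 2
  simp [sub_eq_add_neg]

/-- The function `k` is the adjoint of the `l`-th difference operator on the interval `(α, β)`
applied to some measurable kernel bounded by `C`. -/
def IsDiffRep (l : ℕ) (α β C : ℝ) (k : ℝ → ℝ) : Prop :=
  ∃ K : ℝ → ℝ → ℝ, Measurable (Function.uncurry K) ∧ (∀ y ξ, |K y ξ| ≤ C) ∧
    (∀ y ξ, K y ξ ≠ 0 → y ∈ Set.Ioo α β ∧ y + l * ξ ∈ Set.Ioo α β) ∧
    ∀ y, ∫ ξ, (fwdDiff (-ξ))^[l] (fun z => K z ξ) y = k y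

section DiffRep

variable {l : ℕ} {α β : ℝ}

theorem abs_lt_of_mem_Ioo_of_mem_Ioo (hl : 1 ≤ l) {y ξ : ℝ} (h1 : y ∈ Set.Ioo α β)
    (h2 : y + l * ξ ∈ Set.Ioo α β) : |ξ| < β - α := by
  have h3 : |(l : ℝ) * ξ| < β - α := by
    rw [abs_lt]; constructor <;> linarith [h1.1, h1.2, h2.1, h2.2]
  have h4 : (1 : ℝ) ≤ l := by exact_mod_cast hl
  rw [abs_mul, abs_of_nonneg (by linarith : (0 : ℝ) ≤ l)] at h3
  nlinarith [abs_nonneg ξ]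

theorem integrable_shift_of_support (hl : 1 ≤ l) {K : ℝ → ℝ → ℝ} {C : ℝ}
    (hm : Measurable (Function.uncurry K)) (hC : ∀ y ξ, |K y ξ| ≤ C)
    (hs : ∀ y ξ, K y ξ ≠ 0 → y ∈ Set.Ioo α β ∧ y + l * ξ ∈ Set.Ioo α β) (y c : ℝ) :
    Integrable fun ξ => K (y - c * ξ) ξ := by
  refine integrable_of_bounded_of_support (B := C) (a := -(β - α)) (b := β - α)
    (hm.comp ((measurable_const.sub (measurable_id.const_mul c)).prodMk measurable_id))
    (fun ξ => hC _ _) fun ξ hξ => ?_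
  by_contra h
  obtain ⟨h1, h2⟩ := hs _ _ h
  exact hξ (abs_lt.1 (abs_lt_of_mem_Ioo_of_mem_Ioo hl h1 h2))

theorem integrable_fwdDiff_of_support (hl : 1 ≤ l) {K : ℝ → ℝ → ℝ} {C : ℝ}
    (hm : Measurable (Function.uncurry K)) (hC : ∀ y ξ, |K y ξ| ≤ C)
    (hs : ∀ y ξ, K y ξ ≠ 0 → y ∈ Set.Ioo α β ∧ y + l * ξ ∈ Set.Ioo α β) (y : ℝ) :
    Integrable fun ξ => (fwdDiff (-ξ))^[l] (fun z => K z ξ) y := by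
  simp only [fwdDiff_neg_iter]
  exact integrable_finsetSum _ fun i _ =>
    (integrable_shift_of_support hl hm hC hs y i).const_mul _

theorem IsDiffRep.add (hl : 1 ≤ l) {C₁ C₂ : ℝ} {k₁ k₂ : ℝ → ℝ} (h₁ : IsDiffRep l α β C₁ k₁)
    (h₂ : IsDiffRep l α β C₂ k₂) : IsDiffRep l α β (C₁ + C₂) (fun y => k₁ y + k₂ y) := by
  obtain ⟨K₁, m₁, b₁, s₁, e₁⟩ := h₁
  obtain ⟨K₂, m₂, b₂, s₂, e₂⟩ := h₂
  refine ⟨fun y ξ => K₁ y ξ + K₂ y ξ, m₁.add m₂,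
    fun y ξ => (abs_add_le _ _).trans (add_le_add (b₁ y ξ) (b₂ y ξ)), fun y ξ h => ?_, fun y => ?_⟩
  · by_cases h1 : K₁ y ξ = 0
    · exact s₂ y ξ fun h2 => h (by simp [h1, h2])
    · exact s₁ y ξ h1
  · show _ = k₁ y + k₂ y
    rw [← e₁, ← e₂, ← integral_add (integrable_fwdDiff_of_support hl m₁ b₁ s₁ y)
      (integrable_fwdDiff_of_support hl m₂ b₂ s₂ y)]
    congr 1 with ξ
    simp only [fwdDiff_neg_iter, ← Finset.sum_add_distrib, mul_add]

theorem IsDiffRep.const_mul {C : ℝ} {k : ℝ → ℝ} (h : IsDiffRep l α β C k) (c : ℝ) :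
    IsDiffRep l α β (|c| * C) (fun y => c * k y) := by
  obtain ⟨K, m, b, s, e⟩ := h
  refine ⟨fun y ξ => c * K y ξ, m.const_mul c, fun y ξ => ?_, fun y ξ h => ?_, fun y => ?_⟩
  · rw [abs_mul]; exact mul_le_mul_of_nonneg_left (b y ξ) (abs_nonneg c)
  · exact s y ξ (right_ne_zero_of_mul h)
  · show _ = c * k y
    rw [← e, ← integral_const_mul]
    congr 1 with ξ
    simp only [fwdDiff_neg_iter, Finset.mul_sum]
    exact Finset.sum_congr rfl fun i _ => by ring

theorem IsDiffRep.sum (hl : 1 ≤ l) {ι : Type*} (s : Finset ι) {C : ι → ℝ} {k : ι → ℝ → ℝ}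
    (h : ∀ i ∈ s, IsDiffRep l α β (C i) (k i)) :
    IsDiffRep l α β (∑ i ∈ s, C i) (fun y => ∑ i ∈ s, k i y) := by
  classical
  induction s using Finset.induction_on with
  | empty =>
    refine ⟨fun _ _ => 0, measurable_const, fun _ _ => by simp, fun _ _ h => absurd rfl h,
      fun y => by simp [fwdDiff_neg_iter]⟩
  | insert a s ha ih =>
    have := (h a (Finset.mem_insert_self a s)).add hl
      (ih fun i hi => h i (Finset.mem_insert_of_mem hi))
    simpa only [Finset.sum_insert ha] using this

theorem IsDiffRep.mono {C C' : ℝ} {k : ℝ → ℝ} (h : IsDiffRep l α β C k) (hC : C ≤ C') :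
    IsDiffRep l α β C' k := by
  obtain ⟨K, m, b, s, e⟩ := h
  exact ⟨K, m, fun y ξ => (b y ξ).trans hC, s, e⟩

/-- Steps scale along with points, and the Jacobian of `ξ ↦ ξ / σ` produces `|σ|⁻¹`. Negative `σ` is
allowed, since a reflection is needed below. -/
theorem IsDiffRep.comp_affine {C : ℝ} {k : ℝ → ℝ} (h : IsDiffRep l α β C k) {τ σ α' β' : ℝ}
    (hσ : σ ≠ 0) (hi : ∀ y, (y - τ) / σ ∈ Set.Ioo α β → y ∈ Set.Ioo α' β') :
    IsDiffRep l α' β' (|σ|⁻¹ * C) (fun y => k ((y - τ) / σ)) := by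
  obtain ⟨K, m, b, s, e⟩ := h
  refine ⟨fun y ξ => |σ|⁻¹ * K ((y - τ) / σ) (ξ / σ), ?_, fun y ξ => ?_, fun y ξ h => ?_,
    fun y => ?_⟩
  · refine Measurable.const_mul (m.comp (Measurable.prodMk ?_ ?_)) _
    · exact (measurable_fst.sub_const τ).div_const σ
    · exact measurable_snd.div_const σ
  · rw [abs_mul, abs_inv, abs_abs]
    exact mul_le_mul_of_nonneg_left (b _ _) (by positivity)
  · obtain ⟨h1, h2⟩ := s _ _ (right_ne_zero_of_mul h)
    refine ⟨hi y h1, hi _ ?_⟩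
    convert h2 using 1
    field_simp; ring
  · have : ∀ ξ, (fwdDiff (-ξ))^[l] (fun z => |σ|⁻¹ * K ((z - τ) / σ) (ξ / σ)) y =
        |σ|⁻¹ * (fun ζ => (fwdDiff (-ζ))^[l] (fun z => K z ζ) ((y - τ) / σ)) (ξ / σ) := fun ξ => by
      simp only [fwdDiff_neg_iter, Finset.mul_sum]
      refine Finset.sum_congr rfl fun i _ => ?_
      have : (y - i * ξ - τ) / σ = (y - τ) / σ - i * (ξ / σ) := by field_simp; ring
      rw [this]; ring
    simp only [this]
    rw [integral_const_mul, Measure.integral_comp_div (fun ζ =>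
      (fwdDiff (-ζ))^[l] (fun z => K z ζ) ((y - τ) / σ)), e, smul_eq_mul, ← mul_assoc,
      inv_mul_cancel₀ (abs_ne_zero.2 hσ), one_mul]

end DiffRep

/-! ### Averaged step weights -/

theorem integral_bspline (n : ℕ) : ∫ x, bspline n x = 1 := by
  induction n with
  | zero => simp [bspline, integral_indicator measurableSet_Ioo]
  | succ n ih =>
    have := integral_bspline_succ_mul n (h := fun _ => 1) measurable_const (C := 1) (by simp)
    simpa [ih] using this

/-- The density of `s (U_0 + … + U_n)`, where the `U_i` are uniform on `(0,1)`, and `s` is uniform on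
`(η / 2, η)`. -/
def stepWeight (n : ℕ) (η ξ : ℝ) : ℝ :=
  ∫ s in Set.Ioo (η / 2) η, 2 / η * (s⁻¹ * bspline n (ξ / s))

section StepWeight

variable {n : ℕ} {η : ℝ}

theorem measurable_stepWeight_integrand :
    Measurable fun z : ℝ × ℝ => 2 / η * (z.2⁻¹ * bspline n (z.1 / z.2)) :=
  ((measurable_snd.inv).mul
    ((measurable_bspline n).comp (measurable_fst.div measurable_snd))).const_mul _

theorem measurable_stepWeight (n : ℕ) (η : ℝ) : Measurable (stepWeight n η) :=
  (measurable_stepWeight_integrand.stronglyMeasurable.integral_prod_right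
    (ν := volume.restrict (Set.Ioo (η / 2) η))).measurable

theorem abs_stepWeight_integrand_le (hη : 0 < η) {s : ℝ} (hs : s ∈ Set.Ioo (η / 2) η) (ξ : ℝ) :
    |2 / η * (s⁻¹ * bspline n (ξ / s))| ≤ 2 / η * (2 / η) := by
  have h0 : 0 < s := by linarith [hs.1]
  rw [abs_mul, abs_mul, abs_of_pos (by positivity), abs_of_pos (inv_pos.2 h0)]
  have h1 : s⁻¹ ≤ 2 / η := by
    rw [inv_le_comm₀ h0 (by positivity), inv_div]; exact hs.1.le
  have h2 := abs_bspline_le_one n (ξ / s)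
  calc _ ≤ 2 / η * (2 / η * 1) := by gcongr
    _ = _ := by ring

theorem abs_stepWeight_le (hη : 0 < η) (ξ : ℝ) : |stepWeight n η ξ| ≤ 2 / η := by
  have := norm_setIntegral_le_of_norm_le_const (μ := volume) (s := Set.Ioo (η / 2) η)
    (f := fun s => 2 / η * (s⁻¹ * bspline n (ξ / s))) (C := 2 / η * (2 / η)) (by simp)
    (fun s hs => abs_stepWeight_integrand_le hη hs ξ)
  refine this.trans (le_of_eq ?_)
  simp only [Measure.real, Real.volume_Ioo]
  rw [ENNReal.toReal_ofReal (by linarith)]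
  field_simp; ring

theorem stepWeight_integrand_eq_zero (hη : 0 < η) {s ξ : ℝ} (hs : s ∈ Set.Ioo (η / 2) η)
    (hξ : ξ ∉ Set.Ioo 0 ((n + 1) * η)) : 2 / η * (s⁻¹ * bspline n (ξ / s)) = 0 := by
  have h0 : 0 < s := by linarith [hs.1]
  rw [bspline_eq_zero, mul_zero, mul_zero]
  rintro ⟨h1, h2⟩
  rw [div_lt_iff₀ h0] at h2
  refine hξ ⟨(div_pos_iff_of_pos_right h0).1 h1, h2.trans ?_⟩
  have := hs.2
  gcongr

theorem stepWeight_eq_zero (hη : 0 < η) {ξ : ℝ} (hξ : ξ ∉ Set.Ioo 0 ((n + 1) * η)) :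
    stepWeight n η ξ = 0 :=
  setIntegral_eq_zero_of_forall_eq_zero fun _ hs => stepWeight_integrand_eq_zero hη hs hξ

/-- Conditioning on the scale `s` and substituting `ξ = s t`. -/
theorem integral_stepWeight_mul (hη : 0 < η) {φ : ℝ → ℝ} (hφ : Measurable φ) {C : ℝ}
    (hC : ∀ x, |φ x| ≤ C) :
    ∫ ξ, stepWeight n η ξ * φ ξ =
      ∫ s in Set.Ioo (η / 2) η, 2 / η * ∫ t, bspline n t * φ (s * t) := by
  have h1 : Integrable (fun z : ℝ × ℝ => 2 / η * (z.2⁻¹ * bspline n (z.1 / z.2)) * φ z.1)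
      (volume.prod (volume.restrict (Set.Ioo (η / 2) η))) := by
    have hm : Measurable fun z : ℝ × ℝ => 2 / η * (z.2⁻¹ * bspline n (z.1 / z.2)) * φ z.1 :=
      measurable_stepWeight_integrand.mul (hφ.comp measurable_fst)
    have h2 : IntegrableOn (fun z : ℝ × ℝ => 2 / η * (z.2⁻¹ * bspline n (z.1 / z.2)) * φ z.1)
        (Set.Ioo 0 ((n + 1) * η) ×ˢ Set.Ioo (η / 2) η) (volume.prod volume) := by
      refine Measure.integrableOn_of_bounded (M := 2 / η * (2 / η) * C) ?_
        hm.aestronglyMeasurable ?_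
      · rw [Measure.prod_prod]; simp [ENNReal.mul_eq_top]
      · filter_upwards [ae_restrict_mem (measurableSet_Ioo.prod measurableSet_Ioo)] with z hz
        rw [norm_mul]
        exact mul_le_mul (abs_stepWeight_integrand_le hη hz.2 _) (hC _) (norm_nonneg _)
          (by positivity)
    have h3 : (volume : Measure ℝ).prod (volume.restrict (Set.Ioo (η / 2) η)) =
        (volume.prod volume).restrict (Set.univ ×ˢ Set.Ioo (η / 2) η) := by
      rw [← Measure.prod_restrict, Measure.restrict_univ]
    rw [h3]
    refine IntegrableOn.of_forall_sdiff_eq_zero h2 (MeasurableSet.univ.prod measurableSet_Ioo)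
      fun z hz => ?_
    rw [stepWeight_integrand_eq_zero hη hz.1.2 fun h => hz.2 ⟨h, hz.1.2⟩, zero_mul]
  calc ∫ ξ, stepWeight n η ξ * φ ξ
      = ∫ ξ, ∫ s in Set.Ioo (η / 2) η, 2 / η * (s⁻¹ * bspline n (ξ / s)) * φ ξ := by
        simp only [stepWeight, integral_mul_const]
    _ = ∫ s in Set.Ioo (η / 2) η, ∫ ξ, 2 / η * (s⁻¹ * bspline n (ξ / s)) * φ ξ :=
        integral_integral_swap h1
    _ = _ := by
        refine setIntegral_congr_fun measurableSet_Ioo fun s hs => ?_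
        have h0 : 0 < s := by linarith [hs.1]
        have e : ∀ ξ, 2 / η * (s⁻¹ * bspline n (ξ / s)) * φ ξ =
            2 / η * (s⁻¹ * (fun t => bspline n t * φ (s * t)) (ξ / s)) := fun ξ => by
          simp only
          rw [mul_div_cancel₀ ξ h0.ne']; ring
        simp only [e]
        rw [integral_const_mul, integral_const_mul,
          Measure.integral_comp_div (fun t => bspline n t * φ (s * t)), abs_of_pos h0, smul_eq_mul,
          ← mul_assoc s⁻¹, inv_mul_cancel₀ h0.ne', one_mul]

end StepWeight

/-! ### Functions orthogonal to polynomials are represented by differences -/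

section Orthogonal

variable {l : ℕ}

theorem integral_mul_eval_eq_zero {k : ℝ → ℝ} {B α β : ℝ} (hm : Measurable k)
    (hB : ∀ x, |k x| ≤ B) (h0 : ∀ x, x ∉ Set.Ioo α β → k x = 0)
    (hk : ∀ i < l, ∫ x, k x * x ^ i = 0) {p : ℝ[X]} (hp : p.natDegree < l) :
    ∫ x, k x * p.eval x = 0 := by
  have hi : ∀ i, Integrable fun x => k x * x ^ i := fun i => by
    have : IntegrableOn (fun x => k x * x ^ i) (Set.Ioo α β) :=
      Integrable.bdd_mul (c := B) (integrableOn_Ioo_of_continuous (by fun_prop) α β)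
        hm.aestronglyMeasurable (ae_of_all _ hB)
    exact this.integrable_of_forall_notMem_eq_zero fun x hx => by simp [h0 x hx]
  have e : ∀ x, k x * p.eval x = ∑ i ∈ Finset.range l, p.coeff i * (k x * x ^ i) := fun x => by
    rw [Polynomial.eval_eq_sum_range' hp, Finset.mul_sum]
    exact Finset.sum_congr rfl fun i _ => by ring
  simp only [e]
  rw [integral_finsetSum _ fun i _ => (hi i).const_mul _]
  refine Finset.sum_eq_zero fun i h => ?_
  rw [integral_const_mul, hk i (Finset.mem_range.1 h), mul_zero]

theorem primitive_iterate_spec {k : ℝ → ℝ} {B b : ℝ} (hm : Measurable k) (hb1 : b ≤ 1)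
    (hB : ∀ x, |k x| ≤ B) (h0 : ∀ x, x ∉ Set.Ioo 0 b → k x = 0)
    (hk : ∀ i < l, ∫ x, k x * x ^ i = 0) (j : ℕ) (hj : j ≤ l) :
    Measurable (primitive^[j] k) ∧ (∀ x, |primitive^[j] k x| ≤ B) ∧
      (∀ x, x ∉ Set.Ioo 0 b → primitive^[j] k x = 0) ∧
      ∀ i, i + j < l → ∫ x, primitive^[j] k x * x ^ i = 0 := by
  induction j with
  | zero => exact ⟨hm, hB, h0, fun i hi => hk i hi⟩
  | succ j ih =>
    obtain ⟨a1, a2, a3, a4⟩ := ih (by omega)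
    have hI : ∫ x, primitive^[j] k x = 0 := by simpa using a4 0 (by omega)
    rw [Function.iterate_succ_apply']
    exact ⟨measurable_primitive a1 a2, abs_primitive_le hb1 a2 a3 hI,
      fun x hx => primitive_eq_zero a3 hI hx,
      fun i hi => integral_primitive_mul_pow a1 hb1 a2 a3 hI (a4 (i + 1) (by omega))⟩

/-- For a fixed scale `s` the average of `k` is a single difference of its `(n + 1)`-fold primitive
with step `i s`, by `integral_bspline_mul_comp`. The substitution `ξ = i s` makes the average over
`s` an integral over steps; this is the purpose of randomizing `s`. -/
theorem integral_stepWeight_mul_comp {n : ℕ} {η : ℝ} (hη : 0 < η) {k : ℝ → ℝ} {B b : ℝ}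
    (hm : Measurable k) (hb1 : b ≤ 1) (hB : ∀ x, |k x| ≤ B)
    (h0 : ∀ x, x ∉ Set.Ioo 0 b → k x = 0) (hk : ∀ i < n + 1, ∫ x, k x * x ^ i = 0)
    {i : ℝ} (hi : 0 < i) (y : ℝ) :
    ∫ ξ, stepWeight n η ξ * k (y - i * ξ) =
      ∫ ξ, i⁻¹ * ((Set.Ioo (η / 2) η).indicator (fun _ => 2 / η) (ξ / i) *
        (((-ξ)⁻¹) ^ (n + 1) * (fwdDiff (-ξ))^[n + 1] (primitive^[n + 1] k) y)) := by
  have spec := primitive_iterate_spec hm hb1 hB h0 hk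
  rw [integral_stepWeight_mul hη (φ := fun ξ => k (y - i * ξ)) (hm.comp (by fun_prop))
    (fun x => hB _)]
  set g : ℝ → ℝ := fun s => (Set.Ioo (η / 2) η).indicator (fun _ => 2 / η) s *
        (((-(i * s))⁻¹) ^ (n + 1) * (fwdDiff (-(i * s)))^[n + 1] (primitive^[n + 1] k) y) with hg
  have e1 : ∀ ξ, i⁻¹ * ((Set.Ioo (η / 2) η).indicator (fun _ => 2 / η) (ξ / i) *
        (((-ξ)⁻¹) ^ (n + 1) * (fwdDiff (-ξ))^[n + 1] (primitive^[n + 1] k) y)) =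
      i⁻¹ * g (ξ / i) := fun ξ => by
    simp only [hg, mul_div_cancel₀ ξ hi.ne']
  simp only [e1]
  have e2 : ∫ ξ, i⁻¹ * g (ξ / i) = ∫ s, g s := by
    rw [integral_const_mul, Measure.integral_comp_div g, abs_of_pos hi, smul_eq_mul, ← mul_assoc,
      inv_mul_cancel₀ hi.ne', one_mul]
  rw [e2, ← integral_indicator measurableSet_Ioo]
  congr 1 with s
  by_cases hs : s ∈ Set.Ioo (η / 2) η
  · have hs0 : 0 < s := by linarith [hs.1]
    simp only [hg, Set.indicator_of_mem hs]
    congr 1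
    -- The index is capped because bounds are required for all indices, while the moments of `k`
    -- control only `n + 1` primitives.
    have hv := integral_bspline_mul_comp (v := fun j => primitive^[min j (n + 1)] k) (B := B)
      (fun j => (spec _ (min_le_right _ _)).1) (fun j => (spec _ (min_le_right _ _)).2.1)
      (n := n) (fun j hj => by
        rw [min_eq_left (by omega), min_eq_left (by omega), Function.iterate_succ_apply']
        exact isPrimitive_primitive (spec j (by omega)).1 (spec j (by omega)).2.1)
      (h := i * s) (by positivity) y
    simp only [Nat.zero_min, Function.iterate_zero, id, min_self] at hv
    rw [← hv]
    simp only [mul_assoc]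
  · simp only [hg, Set.indicator_of_notMem hs, zero_mul]

/-- Let `R i` be the average of `k (y - i ξ)` over random steps `ξ`. The alternating binomial sum of
the `R i` is an averaged difference of `k` by definition, and each `R i` with `i ≥ 1` is an averaged
difference of the iterated primitive of `k`. Since `R 0 = k`, solving for `R 0` represents `k`. All
steps are positive, so free space is needed to the right of the support only. -/
theorem exists_isDiffRep_left (n : ℕ) : ∃ C : ℝ, 0 ≤ C ∧ ∀ (B : ℝ) (k : ℝ → ℝ), Measurable k →
    (∀ x, |k x| ≤ B) → (∀ x, x ∉ Set.Ioo (0 : ℝ) (2 / 3) → k x = 0) →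
    (∀ i < n + 1, ∫ x, k x * x ^ i = 0) → IsDiffRep (n + 1) 0 1 (C * B) k := by
  set L : ℝ := n + 1 with hL
  have hL1 : 1 ≤ L := by rw [hL]; linarith [(Nat.cast_nonneg n : (0 : ℝ) ≤ n)]
  -- Steps reach at most `L η` and there are `L` of them, so a chain of nodes has length at most
  -- `1/4 < 1 - 2/3`.
  set η : ℝ := 1 / (4 * L ^ 2) with hηd
  have hη : 0 < η := by positivity
  have hηL : L * (L * η) = 1 / 4 := by rw [hηd]; field_simp
  refine ⟨2 / η + ∑ i ∈ Finset.range (n + 1), |(-1) ^ (i + 2) * ((n + 1).choose (i + 1) : ℝ)| *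
    ((2 / η) ^ (n + 2)), by positivity, fun B k hm hB h0 hk => ?_⟩
  have hB0 : 0 ≤ B := (abs_nonneg _).trans (hB 0)
  set R : ℕ → ℝ → ℝ := fun i y => ∫ ξ, stepWeight n η ξ * k (y - i * ξ) with hR
  obtain ⟨p1, p2, p3, -⟩ := primitive_iterate_spec hm (by norm_num) hB h0 hk (n + 1) le_rfl
  have room : ∀ y ξ : ℝ, y ∈ Set.Ioo (0 : ℝ) (2 / 3) → ξ ∈ Set.Ioo 0 (L * η) →
      y ∈ Set.Ioo (0 : ℝ) 1 ∧ y + ((n + 1 : ℕ) : ℝ) * ξ ∈ Set.Ioo (0 : ℝ) 1 := by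
    intro y ξ hy hξ
    push_cast
    rw [← hL]
    have : L * ξ ≤ L * (L * η) := mul_le_mul_of_nonneg_left hξ.2.le (by linarith)
    have h2 : 0 ≤ L * ξ := mul_nonneg (by linarith) hξ.1.le
    exact ⟨⟨hy.1, by linarith [hy.2]⟩, ⟨by linarith [hy.1], by linarith [hy.2]⟩⟩
  -- The full alternating sum; the sign `(-1)^(n+1)` in the kernel converts `(-1)^(n+1-i)` into
  -- `(-1)^i`.
  have main : IsDiffRep (n + 1) 0 1 (2 / η * B) (fun y =>
      ∑ i ∈ Finset.range (n + 1 + 1), (-1) ^ i * ((n + 1).choose i : ℝ) * R i y) := by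
    refine ⟨fun y ξ => (-1) ^ (n + 1) * (stepWeight n η ξ * k y), ?_, fun y ξ => ?_, fun y ξ h => ?_,
      fun y => ?_⟩
    · exact (((measurable_stepWeight n η).comp measurable_snd).mul (hm.comp measurable_fst)).const_mul _
    · rw [abs_mul, abs_pow, abs_neg, abs_one, one_pow, one_mul, abs_mul]
      exact mul_le_mul (abs_stepWeight_le hη ξ) (hB y) (abs_nonneg _) (by positivity)
    · have h1 := right_ne_zero_of_mul h
      refine room y ξ ?_ ?_
      · by_contra hy; exact h1 (by rw [h0 y hy, mul_zero])
      · by_contra hξ; exact h1 (by rw [stepWeight_eq_zero hη hξ, zero_mul])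
    · simp only [fwdDiff_neg_iter]
      rw [integral_finsetSum]
      · refine Finset.sum_congr rfl fun i hi => ?_
        have hi' : i ≤ n + 1 := by have := Finset.mem_range.1 hi; omega
        rw [integral_const_mul, integral_const_mul, ← mul_assoc, hR]
        congr 1
        have : ((-1 : ℝ) ^ (n + 1 - i)) * (-1) ^ (n + 1) = (-1) ^ i := by
          rw [← pow_add, show n + 1 - i + (n + 1) = i + 2 * (n + 1 - i) by omega, pow_add, pow_mul]
          simp
        rw [← this]; ring
      · intro i _
        refine Integrable.const_mul (Integrable.const_mul (Integrable.mul_bdd (c := B) ?_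
          (hm.comp (by fun_prop)).aestronglyMeasurable (ae_of_all _ fun ξ => hB _)) _) _
        exact integrable_of_bounded_of_support (measurable_stepWeight n η) (abs_stepWeight_le hη)
          fun ξ hξ => stepWeight_eq_zero hη hξ
  -- The terms to be subtracted, with sign `(-1)^(i+2) = -(-1)^(i+1)`. The scale stays above `η /
  -- 2`, so the factor `ξ^{-(n+1)}` is bounded.
  have side : ∀ i ∈ Finset.range (n + 1), IsDiffRep (n + 1) 0 1
      (|(-1) ^ (i + 2) * ((n + 1).choose (i + 1) : ℝ)| * ((2 / η) ^ (n + 2) * B))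
      (fun y => (-1) ^ (i + 2) * ((n + 1).choose (i + 1) : ℝ) * R (i + 1) y) := by
    intro i hi
    refine IsDiffRep.const_mul ?_ _
    have hi1 : (1 : ℝ) ≤ (i + 1 : ℕ) := by push_cast; linarith [(Nat.cast_nonneg i : (0 : ℝ) ≤ i)]
    have hiL : ((i + 1 : ℕ) : ℝ) ≤ L := by
      have : i + 1 ≤ n + 1 := by have := Finset.mem_range.1 hi; omega
      rw [hL]; exact_mod_cast this
    set t : ℝ := ((i + 1 : ℕ) : ℝ) with ht
    have ht0 : 0 < t := by linarith
    refine ⟨fun y ξ => t⁻¹ * ((Set.Ioo (η / 2) η).indicator (fun _ => 2 / η) (ξ / t) *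
        (((-ξ)⁻¹) ^ (n + 1) * primitive^[n + 1] k y)), ?_, fun y ξ => ?_, fun y ξ h => ?_,
        fun y => ?_⟩
    · refine Measurable.const_mul (Measurable.mul ?_ (Measurable.mul ?_ (p1.comp measurable_fst))) _
      · exact (measurable_const.indicator measurableSet_Ioo).comp (measurable_snd.div_const t)
      · exact (measurable_snd.neg.inv).pow_const _
    · beta_reduce
      by_cases hs : ξ / t ∈ Set.Ioo (η / 2) η
      · rw [Set.indicator_of_mem hs, abs_mul, abs_mul, abs_mul, abs_of_pos (inv_pos.2 ht0),
          abs_of_pos (by positivity : 0 < 2 / η), abs_pow, abs_inv, abs_neg]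
        have h1 : η / 2 ≤ |ξ| := by
          have h2 := hs.1
          rw [lt_div_iff₀ ht0] at h2
          refine le_trans ?_ (h2.le.trans (le_abs_self ξ))
          nlinarith
        have h3 : |ξ|⁻¹ ≤ 2 / η := by
          rw [← inv_div]; exact inv_anti₀ (by positivity) h1
        have h4 : t⁻¹ ≤ 1 := inv_le_one_of_one_le₀ hi1
        calc _ ≤ 1 * (2 / η * ((2 / η) ^ (n + 1) * B)) := by
              gcongr
              exact p2 y
          _ = _ := by ring
      · rw [Set.indicator_of_notMem hs, zero_mul, mul_zero, abs_zero]
        positivity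
    · have h1 := right_ne_zero_of_mul h
      have hs : ξ / t ∈ Set.Ioo (η / 2) η := by
        by_contra hs; exact h1 (by rw [Set.indicator_of_notMem hs, zero_mul])
      refine room y ξ ?_ ?_
      · by_contra hy; exact h1 (by rw [p3 y hy, mul_zero, mul_zero])
      · have h2 := hs.1; have h3 := hs.2
        rw [lt_div_iff₀ ht0] at h2
        rw [div_lt_iff₀ ht0] at h3
        exact ⟨lt_trans (by positivity) h2, h3.trans_le (by nlinarith)⟩
    · rw [hR]
      simp only
      rw [integral_stepWeight_mul_comp hη hm (by norm_num) hB h0 hk ht0 y]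
      congr 1 with ξ
      simp only [fwdDiff_neg_iter, Finset.mul_sum]
      exact Finset.sum_congr rfl fun j _ => by ring
  have hfin := main.add (by omega) (IsDiffRep.sum (by omega) _ side)
  have hCB : 2 / η * B + ∑ i ∈ Finset.range (n + 1),
      |(-1) ^ (i + 2) * ((n + 1).choose (i + 1) : ℝ)| * ((2 / η) ^ (n + 2) * B) =
      (2 / η + ∑ i ∈ Finset.range (n + 1), |(-1) ^ (i + 2) * ((n + 1).choose (i + 1) : ℝ)| *
        ((2 / η) ^ (n + 2))) * B := by
    rw [add_mul, Finset.sum_mul]; simp only [mul_assoc]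
  rw [hCB] at hfin
  convert hfin using 1
  funext y
  -- The weight has total mass one, hence the term with `i = 0` is `k` itself.
  have hw : ∫ ξ, stepWeight n η ξ = 1 := by
    have := integral_stepWeight_mul (n := n) hη (φ := fun _ => 1) measurable_const (C := 1)
      (by simp)
    simp only [mul_one, integral_bspline, integral_const, smul_eq_mul] at this
    rw [this]
    simp only [Measure.real, Measure.restrict_apply MeasurableSet.univ, Set.univ_inter,
      Real.volume_Ioo]
    rw [ENNReal.toReal_ofReal (by linarith)]
    field_simp; ring
  have hR0 : R 0 y = k y := by
    simp only [hR, Nat.cast_zero, zero_mul, sub_zero, integral_mul_const, hw, one_mul]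
  rw [Finset.sum_range_succ' _ (n + 1), hR0, add_right_comm, ← Finset.sum_add_distrib]
  rw [Finset.sum_eq_zero, zero_add]
  · simp
  · intro i _
    rw [pow_succ (-1 : ℝ) (i + 1)]; ring

end Orthogonal

/-! ### Reduction of an arbitrary interval to functions with room on the right. -/

section Orthogonal

variable {l : ℕ}

theorem exists_abs_cellKer_le (l : ℕ) : ∃ M : ℝ, 0 ≤ M ∧ ∀ z ∈ Set.Icc (0 : ℝ) 1,
    ∀ y ∈ Set.Icc (0 : ℝ) 1, |cellKer l 3 1 z y| ≤ M := by
  obtain ⟨M, hM⟩ := (isCompact_Icc (a := (0 : ℝ)) (b := 1)).prod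
    (isCompact_Icc (a := (0 : ℝ)) (b := 1)) |>.exists_bound_of_continuousOn
    (continuous_cellKer l 3 1).continuousOn
  exact ⟨M, (norm_nonneg _).trans (hM (0, 0) (by simp)), fun z hz y hy => hM (z, y) ⟨hz, hy⟩⟩

/-- A function on the middle third of `(0,1)` with the same moments of order less than `l` as the
restriction of `k` to `(0, 1/3)`. -/
def momentTransfer (l : ℕ) (k : ℝ → ℝ) (y : ℝ) : ℝ :=
  (Set.Ioo (1 / 3 : ℝ) (2 / 3)).indicator
    (fun y => ∫ z in Set.Ioo (0 : ℝ) (1 / 3), k z * cellKer l 3 1 z y) y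

variable {k : ℝ → ℝ} {B : ℝ}

theorem measurable_momentTransfer (hm : Measurable k) : Measurable (momentTransfer l k) := by
  have h : Measurable fun w : ℝ × ℝ => k w.2 * cellKer l 3 1 w.2 w.1 :=
    
    (hm.comp measurable_snd).mul ((continuous_cellKer l 3 1).comp continuous_swap).measurable
  exact ((h.stronglyMeasurable.integral_prod_right
    (ν := volume.restrict (Set.Ioo (0 : ℝ) (1 / 3)))).measurable).indicator measurableSet_Ioo

theorem abs_momentTransfer_le (hB : ∀ x, |k x| ≤ B) {M : ℝ} (hM0 : 0 ≤ M)
    (hM : ∀ z ∈ Set.Icc (0 : ℝ) 1, ∀ y ∈ Set.Icc (0 : ℝ) 1, |cellKer l 3 1 z y| ≤ M) (y : ℝ) :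
    |momentTransfer l k y| ≤ B * M := by
  have hB0 : 0 ≤ B := (abs_nonneg _).trans (hB 0)
  by_cases hy : y ∈ Set.Ioo (1 / 3 : ℝ) (2 / 3)
  · rw [momentTransfer, Set.indicator_of_mem hy]
    have := norm_setIntegral_le_of_norm_le_const (μ := volume) (s := Set.Ioo (0 : ℝ) (1 / 3))
      (f := fun z => k z * cellKer l 3 1 z y) (C := B * M) (by simp) (fun z hz => by
        rw [norm_mul]
        exact mul_le_mul (hB z) (hM z ⟨hz.1.le, by linarith [hz.2]⟩ y
          ⟨by linarith [hy.1], by linarith [hy.2]⟩) (norm_nonneg _) hB0)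
    refine this.trans ?_
    have h3 : volume.real (Set.Ioo (0 : ℝ) (1 / 3)) ≤ 1 := by
      simp only [Measure.real, Real.volume_Ioo]
      rw [ENNReal.toReal_ofReal (by norm_num)]; norm_num
    exact mul_le_of_le_one_right (by positivity) h3
  · rw [momentTransfer, Set.indicator_of_notMem hy, abs_zero]; positivity

/-- After Fubini's theorem the inner integral is the reproducing formula of the middle third,
evaluated at points `z` of the left third. -/
theorem integral_momentTransfer_mul_eval (hm : Measurable k) (hB : ∀ x, |k x| ≤ B) {p : ℝ[X]}
    (hp : p.natDegree < l) :
    ∫ y, momentTransfer l k y * p.eval y = ∫ z in Set.Ioo (0 : ℝ) (1 / 3), k z * p.eval z := by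
  have e1 : ∀ y, momentTransfer l k y * p.eval y = (Set.Ioo (1 / 3 : ℝ) (2 / 3)).indicator
      (fun y => ∫ z in Set.Ioo (0 : ℝ) (1 / 3), k z * (cellKer l 3 1 z y * p.eval y)) y := by
    intro y
    simp only [momentTransfer, Set.indicator, ite_mul, zero_mul, ← integral_mul_const, mul_assoc]
  simp only [e1]
  rw [integral_indicator measurableSet_Ioo, integral_integral_swap]
  · refine setIntegral_congr_fun measurableSet_Ioo fun z _ => ?_
    rw [integral_const_mul]
    -- Scale `3` and index `1` describe the interval `(1/3, 2/3)`.
    have := integral_cellKer_mul_eval (l := l) (s := 3) (by norm_num) 1 z hp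
    norm_num at this ⊢
    exact Or.inl this
  · have hc : IntegrableOn (fun w : ℝ × ℝ => cellKer l 3 1 w.2 w.1 * p.eval w.1)
        (Set.Ioo (1 / 3 : ℝ) (2 / 3) ×ˢ Set.Ioo (0 : ℝ) (1 / 3)) (volume.prod volume) := by
      refine IntegrableOn.mono_set (t := Set.Icc (1 / 3 : ℝ) (2 / 3) ×ˢ Set.Icc (0 : ℝ) (1 / 3))
        (ContinuousOn.integrableOn_compact (isCompact_Icc.prod isCompact_Icc) ?_)
        (Set.prod_mono Set.Ioo_subset_Icc_self Set.Ioo_subset_Icc_self)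
      exact (((continuous_cellKer l 3 1).comp continuous_swap).mul
        (p.continuous.comp continuous_fst)).continuousOn
    rw [Measure.prod_restrict]
    exact Integrable.bdd_mul (c := B) hc (hm.comp measurable_snd).aestronglyMeasurable
      (ae_of_all _ fun w => hB _)

/-- Cutting `k` at `1/3` would destroy its vanishing moments. Subtracting `momentTransfer` from the
left piece and adding it to the right piece restores them, and leaves one part on `(0, 2/3)` and one
on `(1/3, 1)`. The former is treated by `exists_isDiffRep_left`, the latter by the same lemma after
reflection. -/
theorem exists_isDiffRep_unit (hl : 1 ≤ l) : ∃ C : ℝ, 0 ≤ C ∧ ∀ (B : ℝ) (k : ℝ → ℝ),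
    Measurable k → (∀ x, |k x| ≤ B) → (∀ x, x ∉ Set.Ioo (0 : ℝ) 1 → k x = 0) →
    (∀ i < l, ∫ x, k x * x ^ i = 0) → IsDiffRep l 0 1 (C * B) k := by
  obtain ⟨n, rfl⟩ : ∃ n, l = n + 1 := ⟨l - 1, by omega⟩
  obtain ⟨C, hC0, hC⟩ := exists_isDiffRep_left n
  obtain ⟨M, hM0, hM⟩ := exists_abs_cellKer_le (n + 1)
  refine ⟨2 * (C * (1 + M)), by positivity, fun B k hm hB h0 hk => ?_⟩
  have hB0 : 0 ≤ B := (abs_nonneg _).trans (hB 0)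
  set kt := momentTransfer (n + 1) k with hkt
  have tm : Measurable kt := measurable_momentTransfer hm
  have tB : ∀ y, |kt y| ≤ B * M := abs_momentTransfer_le hB hM0 hM
  have t0 : ∀ y, y ∉ Set.Ioo (1 / 3 : ℝ) (2 / 3) → kt y = 0 := fun y hy =>
    Set.indicator_of_notMem hy _
  -- The endpoint `1/3` is included so that `k - k₁` vanishes there too: supports are pointwise
  -- conditions.
  set k₁ : ℝ → ℝ := fun y => (Set.Ioc (0 : ℝ) (1 / 3)).indicator k y - kt y with hk₁
  have m₁ : Measurable k₁ := (hm.indicator measurableSet_Ioc).sub tm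
  have i1 : ∀ y, |(Set.Ioc (0 : ℝ) (1 / 3)).indicator k y| ≤ B := fun y => by
    by_cases hy : y ∈ Set.Ioc (0 : ℝ) (1 / 3)
    · rw [Set.indicator_of_mem hy]; exact hB y
    · rw [Set.indicator_of_notMem hy, abs_zero]; exact hB0
  have i2 : ∀ y, |k y - (Set.Ioc (0 : ℝ) (1 / 3)).indicator k y| ≤ B := fun y => by
    by_cases hy : y ∈ Set.Ioc (0 : ℝ) (1 / 3)
    · rw [Set.indicator_of_mem hy, sub_self, abs_zero]; exact hB0
    · rw [Set.indicator_of_notMem hy, sub_zero]; exact hB y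
  have b₁ : ∀ y, |k₁ y| ≤ B * (1 + M) := fun y => by
    have := (abs_sub ((Set.Ioc (0 : ℝ) (1 / 3)).indicator k y) (kt y)).trans
      (add_le_add (i1 y) (tB y))
    rw [mul_add, mul_one]; exact this
  have s₁ : ∀ y, y ∉ Set.Ioo (0 : ℝ) (2 / 3) → k₁ y = 0 := fun y hy => by
    simp only [hk₁]
    rw [t0 y fun h => hy ⟨by linarith [h.1], h.2⟩,
      Set.indicator_of_notMem fun h => hy ⟨h.1, by linarith [h.2]⟩, sub_zero]
  have z₁ : ∀ p : ℝ[X], p.natDegree < n + 1 → ∫ x, k₁ x * p.eval x = 0 := by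
    intro p hp
    have j1 : Integrable fun x => (Set.Ioc (0 : ℝ) (1 / 3)).indicator k x * p.eval x := by
      have : IntegrableOn (fun x => (Set.Ioc (0 : ℝ) (1 / 3)).indicator k x * p.eval x)
          (Set.Ioc 0 (1 / 3)) :=
        Integrable.bdd_mul (c := B) p.continuous.integrableOn_Ioc
          (hm.indicator measurableSet_Ioc).aestronglyMeasurable (ae_of_all _ i1)
      exact this.integrable_of_forall_notMem_eq_zero fun x hx => by
        rw [Set.indicator_of_notMem hx, zero_mul]
    have j2 : Integrable fun x => kt x * p.eval x := by
      have : IntegrableOn (fun x => kt x * p.eval x) (Set.Ioo (1 / 3) (2 / 3)) :=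
        Integrable.bdd_mul (c := B * M) (integrableOn_Ioo_of_continuous p.continuous _ _)
          tm.aestronglyMeasurable (ae_of_all _ tB)
      exact this.integrable_of_forall_notMem_eq_zero fun x hx => by simp [t0 x hx]
    simp only [hk₁, sub_mul]
    rw [integral_sub j1 j2, integral_momentTransfer_mul_eval hm hB hp,
      ← integral_Ioc_eq_integral_Ioo, ← integral_indicator measurableSet_Ioc, sub_eq_zero]
    congr 1 with x
    simp only [Set.indicator, ite_mul, zero_mul]
  have r₁ : IsDiffRep (n + 1) 0 1 (C * (B * (1 + M))) k₁ :=
    hC _ k₁ m₁ b₁ s₁ fun i hi => by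
      have := z₁ (Polynomial.X ^ i) (by rw [Polynomial.natDegree_X_pow]; exact hi)
      simpa using this
  -- Reflecting the right part gives it room on the right.
  set k₂ : ℝ → ℝ := fun y => k (1 - y) - k₁ (1 - y) with hk₂
  have e₂ : ∀ y, k y - k₁ y = (k y - (Set.Ioc (0 : ℝ) (1 / 3)).indicator k y) + kt y := fun y => by
    simp only [hk₁]; ring
  have m₂ : Measurable fun y => k y - k₁ y := hm.sub m₁
  have b₂ : ∀ y, |k y - k₁ y| ≤ B * (1 + M) := fun y => by
    rw [e₂, mul_add, mul_one]
    exact (abs_add_le _ _).trans (add_le_add (i2 y) (tB y))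
  have r₂ : IsDiffRep (n + 1) 0 1 (C * (B * (1 + M))) k₂ := by
    refine hC _ k₂ (m₂.comp (measurable_const.sub measurable_id)) (fun y => b₂ _)
      (fun y hy => ?_) fun i hi => ?_
    · by_cases h2 : (1 - y) ∈ Set.Ioo (0 : ℝ) 1
      · have h3 : 1 - y ≤ 1 / 3 := by
          by_contra h3; exact hy ⟨by linarith [h2.2], by linarith⟩
        simp only [hk₂, e₂]
        rw [Set.indicator_of_mem (show 1 - y ∈ Set.Ioc (0 : ℝ) (1 / 3) from ⟨h2.1, h3⟩),
          t0 _ fun h => by linarith [h.1]]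
        ring
      · simp only [hk₂]
        rw [h0 _ h2, s₁ _ fun h => h2 ⟨h.1, by linarith [h.2]⟩, sub_zero]
    · have hdeg : ((1 - Polynomial.X : ℝ[X]) ^ i).natDegree < n + 1 := by
        refine lt_of_le_of_lt (Polynomial.natDegree_pow_le) (lt_of_le_of_lt ?_ hi)
        have : (1 - Polynomial.X : ℝ[X]).natDegree ≤ 1 := by
          refine (Polynomial.natDegree_sub_le _ _).trans ?_
          simp
        nlinarith
      have q1 := z₁ _ hdeg
      have q2 := integral_mul_eval_eq_zero hm hB h0 hk hdeg
      have e3 : ∀ y, k₂ y * y ^ i =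
          (fun x => (k x - k₁ x) * ((1 - Polynomial.X : ℝ[X]) ^ i).eval x) (1 - y) := fun y => by
        simp [hk₂]
      simp only [e3]
      rw [integral_sub_left_eq_self (fun x => (k x - k₁ x) * ((1 - Polynomial.X : ℝ[X]) ^ i).eval x)
        volume 1]
      simp only [sub_mul]
      have c0 : ∀ (g : ℝ → ℝ) (D : ℝ), Measurable g → (∀ x, |g x| ≤ D) →
          (∀ x, x ∉ Set.Ioo (0 : ℝ) 1 → g x = 0) →
          Integrable fun x => g x * ((1 - Polynomial.X : ℝ[X]) ^ i).eval x := by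
        intro g D hg hD hg0
        have : IntegrableOn (fun x => g x * ((1 - Polynomial.X : ℝ[X]) ^ i).eval x)
            (Set.Ioo 0 1) :=
          Integrable.bdd_mul (c := D)
            (integrableOn_Ioo_of_continuous (Polynomial.continuous _) _ _)
            hg.aestronglyMeasurable (ae_of_all _ hD)
        exact this.integrable_of_forall_notMem_eq_zero fun x hx => by rw [hg0 x hx, zero_mul]
      rw [integral_sub (c0 k B hm hB h0) (c0 k₁ _ m₁ b₁ fun x hx => s₁ x fun h => hx
        ⟨h.1, by linarith [h.2]⟩), q1, q2, sub_zero]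
  have r₃ := r₂.comp_affine (τ := 1) (σ := -1) (α' := 0) (β' := 1) (by norm_num) fun y hy => by
    have e : (y - 1) / (-1) = 1 - y := by ring
    rw [e] at hy
    exact ⟨by linarith [hy.2], by linarith [hy.1]⟩
  have r := r₁.add hl r₃
  have eC : C * (B * (1 + M)) + |(-1 : ℝ)|⁻¹ * (C * (B * (1 + M))) = 2 * (C * (1 + M)) * B := by
    rw [abs_neg, abs_one]; ring
  rw [eC] at r
  convert r using 1
  funext y
  simp only [hk₂]
  rw [show 1 - (y - 1) / (-1) = y by ring]; ring

/-- Transport from the unit interval; vanishing moments survive because affine substitutions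
preserve degrees. The factor `(β - α)⁻¹` compensates integration over steps of size up to `β - α`.
-/
theorem exists_isDiffRep (hl : 1 ≤ l) : ∃ C : ℝ, 0 ≤ C ∧ ∀ (α β : ℝ), α < β →
    ∀ (B : ℝ) (k : ℝ → ℝ), Measurable k → (∀ x, |k x| ≤ B) →
    (∀ x, x ∉ Set.Ioo α β → k x = 0) → (∀ i < l, ∫ x, k x * x ^ i = 0) →
    IsDiffRep l α β ((β - α)⁻¹ * (C * B)) k := by
  obtain ⟨C, hC0, hC⟩ := exists_isDiffRep_unit hl
  refine ⟨C, hC0, fun α β hαβ B k hm hB h0 hk => ?_⟩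
  have hs : 0 < β - α := sub_pos.2 hαβ
  have r := hC B (fun x => k ((β - α) * x + α)) (hm.comp (by fun_prop)) (fun x => hB _)
    (fun x hx => h0 _ fun h => hx ⟨?_, ?_⟩) (fun i hi => ?_)
  · have r2 := r.comp_affine (τ := α) (σ := β - α) (α' := α) (β' := β) hs.ne' fun y hy => by
      obtain ⟨h1, h2⟩ := hy
      rw [lt_div_iff₀ hs] at h1; rw [div_lt_iff₀ hs] at h2
      exact ⟨by linarith, by linarith⟩
    rw [abs_of_pos hs] at r2
    convert r2 using 2 with y
    rw [mul_div_cancel₀ _ hs.ne']; ring_nf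
  · have := h.1; by_contra hc; nlinarith
  · have := h.2; by_contra hc; nlinarith
  · have e : ∀ x, k ((β - α) * x + α) * x ^ i = (fun z => k (z + α) * (((β - α)⁻¹ * z) ^ i))
        ((β - α) * x) := fun x => by
      simp only
      rw [← mul_assoc, inv_mul_cancel₀ hs.ne', one_mul]
    simp only [e]
    rw [Measure.integral_comp_mul_left (fun z => k (z + α) * (((β - α)⁻¹ * z) ^ i))]
    obtain ⟨q, hq⟩ : ∃ q : ℝ[X], q = (Polynomial.C (β - α)⁻¹ *
      (Polynomial.X - Polynomial.C α)) ^ i := ⟨_, rfl⟩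
    have e2 : ∀ z, k (z + α) * (((β - α)⁻¹ * z) ^ i) = (fun w => k w * q.eval w) (z + α) :=
      fun z => by simp [hq]
    rw [integral_congr_ae (ae_of_all _ e2), integral_add_right_eq_self (fun w => k w * q.eval w) α,
      integral_mul_eval_eq_zero hm hB h0 hk, smul_zero]
    rw [hq]
    refine lt_of_le_of_lt Polynomial.natDegree_pow_le (lt_of_le_of_lt ?_ hi)
    have : (Polynomial.C (β - α)⁻¹ * (Polynomial.X - Polynomial.C α)).natDegree ≤ 1 := by
      refine (Polynomial.natDegree_C_mul_le _ _).trans ?_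
      simp
    nlinarith

end Orthogonal

/-! ### The univariate kernels -/

theorem integrable_mul_of_bounded {g φ : ℝ → ℝ} (hg : Measurable g) {B : ℝ} (hB : ∀ x, |g x| ≤ B)
    (hφ : Continuous φ) (hc : HasCompactSupport φ) : Integrable fun x => g x * φ x :=
  (hφ.integrable_of_hasCompactSupport hc).bdd_mul (c := B) hg.aestronglyMeasurable (ae_of_all _ hB)

theorem HasWeakDeriv.sum {ι : Type*} (s : Finset ι) {a : ℕ} {u w : ι → ℝ → ℝ}
    (hu : ∀ i ∈ s, Measurable (u i) ∧ ∃ B, ∀ x, |u i x| ≤ B)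
    (hw : ∀ i ∈ s, Measurable (w i) ∧ ∃ B, ∀ x, |w i x| ≤ B)
    (h : ∀ i ∈ s, HasWeakDeriv a (u i) (w i)) :
    HasWeakDeriv a (fun x => ∑ i ∈ s, u i x) (fun x => ∑ i ∈ s, w i x) := by
  intro φ hφ hc
  simp only [Finset.sum_mul]
  rw [integral_finsetSum, integral_finsetSum, Finset.mul_sum]
  · exact Finset.sum_congr rfl fun i hi => h i hi φ hφ hc
  · intro i hi
    obtain ⟨h1, B, hB⟩ := hw i hi
    exact integrable_mul_of_bounded h1 hB hφ.continuous hc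
  · intro i hi
    obtain ⟨h1, B, hB⟩ := hu i hi
    exact integrable_mul_of_bounded h1 hB (contDiff_iteratedDeriv hφ a).continuous
      (hasCompactSupport_iteratedDeriv hc a)

theorem HasWeakDeriv.const_mul {a : ℕ} {u w : ℝ → ℝ} (h : HasWeakDeriv a u w) (c : ℝ) :
    HasWeakDeriv a (fun x => c * u x) (fun x => c * w x) := by
  intro φ hφ hc
  simp only [mul_assoc]
  rw [integral_const_mul, integral_const_mul, h φ hφ hc]; ring

theorem HasWeakDeriv.comp_affine {a : ℕ} {u w : ℝ → ℝ} (h : HasWeakDeriv a u w) {s : ℝ}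
    (hs : 0 < s) (n : ℝ) :
    HasWeakDeriv a (fun x => u (s * x - n)) (fun x => s ^ a * w (s * x - n)) := by
  intro φ hφ hc
  have hs0 := hs.ne'
  have hcov : ∀ g : ℝ → ℝ, ∫ x, g (s * x - n) = s⁻¹ * ∫ x, g x := fun g => by
    rw [Measure.integral_comp_mul_left (fun x => g (x - n)) s,
      integral_sub_right_eq_self g n, abs_of_pos (inv_pos.2 hs), smul_eq_mul]
  set ψ : ℝ → ℝ := fun x => φ (s⁻¹ * (x + n)) with hψ
  have c1 : ContDiff ℝ ∞ ψ := hφ.comp (contDiff_const.mul (contDiff_id.add contDiff_const))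
  have c2 : HasCompactSupport ψ := by
    have := (hc.comp_homeomorph (Homeomorph.mulLeft₀ s⁻¹ (inv_ne_zero hs0))).comp_homeomorph
      (Homeomorph.addRight n)
    exact this
  have e1 : ∀ x, ψ (s * x - n) = φ x := fun x => by
    simp only [hψ]; congr 1; field_simp; ring
  have e2 : iteratedDeriv a ψ = fun x => (s⁻¹) ^ a * iteratedDeriv a φ (s⁻¹ * (x + n)) := by
    have h1 := iteratedDeriv_comp_add_const a (fun x => φ (s⁻¹ * x)) n
    rw [hψ]
    rw [h1, iteratedDeriv_comp_const_mul (hφ.of_le (by exact_mod_cast le_top))]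
  have e3 : ∀ x, iteratedDeriv a φ x = s ^ a * iteratedDeriv a ψ (s * x - n) := fun x => by
    rw [e2]
    simp only
    rw [show s⁻¹ * (s * x - n + n) = x by field_simp; ring, ← mul_assoc, ← mul_pow,
      mul_inv_cancel₀ hs0, one_pow, one_mul]
  have key := h ψ c1 c2
  have l1 : ∫ x, u (s * x - n) * iteratedDeriv a φ x =
      ∫ x, (fun z => s ^ a * (u z * iteratedDeriv a ψ z)) (s * x - n) := by
    congr 1 with x; rw [e3]; ring
  have l2 : ∫ x, s ^ a * w (s * x - n) * φ x =
      ∫ x, (fun z => s ^ a * (w z * ψ z)) (s * x - n) := by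
    congr 1 with x; simp only [e1]; ring
  rw [l1, l2, hcov (fun z => s ^ a * (u z * iteratedDeriv a ψ z)),
    hcov (fun z => s ^ a * (w z * ψ z)), integral_const_mul, integral_const_mul, key]
  ring

/-- The univariate form of `cellIndex`. -/
def cellIdx (m κ : ℕ) (ν : ℤ) : ℤ :=
  max ((2 : ℤ) ^ κ - m - 1) 0 - max ((2 : ℤ) ^ κ - m - 1 - max ν 0) 0

/-- The index equals `min ν_+ (2^κ - m - 1)` if `2^κ > m`, and zero on coarser levels. In both cases
the polynomial attached to the B-spline of index `ν` comes from a dyadic cell inside `(0,1)` at most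
`m` cells away. -/
theorem cellIdx_spec {m κ : ℕ} {ν : ℤ} (hν : ν ∈ Finset.Icc (-(m : ℤ)) ((2 : ℤ) ^ κ - 1)) :
    0 ≤ cellIdx m κ ν ∧ cellIdx m κ ν + 1 ≤ 2 ^ κ ∧ -(m : ℤ) ≤ ν - cellIdx m κ ν ∧
      ν - cellIdx m κ ν ≤ m := by
  obtain ⟨h1, h2⟩ := Finset.mem_Icc.1 hν
  have h3 : (1 : ℤ) ≤ 2 ^ κ := one_le_pow₀ (by norm_num)
  unfold cellIdx
  generalize (2 : ℤ) ^ κ = N at *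
  omega

/-- The interval `2^{-κ} (n, n + 1)`. -/
def dyadicIoo (κ : ℕ) (n : ℤ) : Set ℝ :=
  Set.Ioo (((2 : ℝ) ^ κ)⁻¹ * n) (((2 : ℝ) ^ κ)⁻¹ * n + ((2 : ℝ) ^ κ)⁻¹)

theorem mem_dyadicIoo {κ : ℕ} {n : ℤ} {y : ℝ} :
    y ∈ dyadicIoo κ n ↔ 0 < (2 : ℝ) ^ κ * y - n ∧ (2 : ℝ) ^ κ * y - n < 1 := by
  have h : (0 : ℝ) < 2 ^ κ := by positivity
  rw [dyadicIoo, Set.mem_Ioo, ← mul_add_one, inv_mul_lt_iff₀ h, lt_inv_mul_iff₀ h]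
  constructor <;> rintro ⟨h1, h2⟩ <;> constructor <;> linarith

theorem measurableSet_dyadicIoo (κ : ℕ) (n : ℤ) : MeasurableSet (dyadicIoo κ n) := measurableSet_Ioo

theorem integrableOn_dyadicIoo {f : ℝ → ℝ} (hf : Continuous f) (κ : ℕ) (n : ℤ) :
    IntegrableOn f (dyadicIoo κ n) := by
  unfold dyadicIoo
  exact integrableOn_Ioo_of_continuous hf _ _

/-- One summand of the weak derivative of order `a` of the kernel of the univariate approximation
operator. -/
def splineKerTerm (l m a κ : ℕ) (ν : ℤ) (i j : Fin l) (x y : ℝ) : ℝ :=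
  (dyadicIoo κ (cellIdx m κ ν)).indicator
    (fun y => (2 : ℝ) ^ κ * (gramMatrix l)⁻¹ i j *
      ((2 : ℝ) ^ κ * y - cellIdx m κ ν) ^ (j : ℕ)) y *
    (((2 : ℝ) ^ κ) ^ a * splDer a m ((Polynomial.X + Polynomial.C ((ν - cellIdx m κ ν : ℤ) : ℝ)) ^
      (i : ℕ)) ((2 : ℝ) ^ κ * x - ν))

/-- The weak derivative of order `a` in `x` of the kernel of the univariate approximation operator
with splines of degree `m` and polynomials of degree less than `l`. -/
def splineKer (l m a κ : ℕ) (x y : ℝ) : ℝ :=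
  ∑ ν ∈ Finset.Icc (-(m : ℤ)) ((2 : ℤ) ^ κ - 1), ∑ i : Fin l, ∑ j : Fin l,
    splineKerTerm l m a κ ν i j x y

section SplineKer

variable {l m a κ : ℕ}

theorem measurable_splineKerTerm (ν : ℤ) (i j : Fin l) :
    Measurable fun z : ℝ × ℝ => splineKerTerm l m a κ ν i j z.1 z.2 := by
  unfold splineKerTerm
  refine Measurable.mul ?_ (Measurable.const_mul ((measurable_splDer _ _ _).comp (by fun_prop)) _)
  exact (Measurable.indicator (by fun_prop) (measurableSet_dyadicIoo _ _)).comp measurable_snd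

theorem measurable_splineKer : Measurable fun z : ℝ × ℝ => splineKer l m a κ z.1 z.2 := by
  unfold splineKer
  exact Finset.measurable_fun_sum _ fun ν _ => Finset.measurable_fun_sum _ fun i _ =>
    Finset.measurable_fun_sum _ fun j _ => measurable_splineKerTerm ν i j

theorem splineKerTerm_eq_zero_left (ν : ℤ) (i j : Fin l) {x : ℝ} (y : ℝ)
    (hx : (2 : ℝ) ^ κ * x - ν ∉ Set.Ioo (0 : ℝ) (m + 1)) : splineKerTerm l m a κ ν i j x y = 0 := by
  rw [splineKerTerm, splDer_eq_zero _ _ _ hx, mul_zero, mul_zero]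

theorem splineKerTerm_eq_zero_right (ν : ℤ) (i j : Fin l) (x : ℝ) {y : ℝ}
    (hy : y ∉ dyadicIoo κ (cellIdx m κ ν)) : splineKerTerm l m a κ ν i j x y = 0 := by
  rw [splineKerTerm, Set.indicator_of_notMem hy, zero_mul]

/-- A B-spline covers `m + 1` cells and `y` lies in a cell whose index differs from `ν` by at most
`m`; the radius `2m + 2` is a convenient upper bound. -/
theorem splineKer_ne_zero {x y : ℝ} (h : splineKer l m a κ x y ≠ 0) :
    y ∈ Set.Ioo (0 : ℝ) 1 ∧ |(2 : ℝ) ^ κ * (y - x)| < 2 * m + 2 := by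
  obtain ⟨ν, hν, h1⟩ := Finset.exists_ne_zero_of_sum_ne_zero h
  obtain ⟨i, -, h2⟩ := Finset.exists_ne_zero_of_sum_ne_zero h1
  obtain ⟨j, -, h3⟩ := Finset.exists_ne_zero_of_sum_ne_zero h2
  have hx : (2 : ℝ) ^ κ * x - ν ∈ Set.Ioo (0 : ℝ) (m + 1) := by
    by_contra hx; exact h3 (splineKerTerm_eq_zero_left ν i j y hx)
  have hy : y ∈ dyadicIoo κ (cellIdx m κ ν) := by
    by_contra hy; exact h3 (splineKerTerm_eq_zero_right ν i j x hy)
  rw [mem_dyadicIoo] at hy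
  obtain ⟨c1, c2, c3, c4⟩ := cellIdx_spec hν
  generalize cellIdx m κ ν = n at *
  have d1 : (0 : ℝ) ≤ n := by exact_mod_cast c1
  have d2 : (n : ℝ) + 1 ≤ 2 ^ κ := by exact_mod_cast c2
  have d3 : -(m : ℝ) ≤ ν - n := by exact_mod_cast c3
  have d4 : (ν : ℝ) - n ≤ m := by exact_mod_cast c4
  have hp : (0 : ℝ) < 2 ^ κ := by positivity
  have hm : (0 : ℝ) ≤ m := Nat.cast_nonneg m
  obtain ⟨x1, x2⟩ := hx
  obtain ⟨y1, y2⟩ := hy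
  refine ⟨⟨?_, ?_⟩, ?_⟩
  · by_contra hc; nlinarith
  · by_contra hc; nlinarith
  · rw [mul_sub, abs_lt]; constructor <;> linarith

/-- Uniformity in `κ` and `ν` holds because the polynomials involved depend only on `ν - cellIdx m κ
ν`, which takes at most `2m + 1` values. -/
theorem exists_abs_splineKerTerm_le (l m a : ℕ) : ∃ C : ℝ, 0 ≤ C ∧ ∀ κ : ℕ,
    ∀ ν ∈ Finset.Icc (-(m : ℤ)) ((2 : ℤ) ^ κ - 1), ∀ (i j : Fin l) (x y : ℝ),
      |splineKerTerm l m a κ ν i j x y| ≤ C * ((2 : ℝ) ^ κ) ^ (a + 1) := by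
  have hb : ∀ (s : ℤ) (i : Fin l), ∃ C, ∀ x,
      |splDer a m ((Polynomial.X + Polynomial.C (s : ℝ)) ^ (i : ℕ)) x| ≤ C :=
    fun s i => exists_abs_splDer_le a m _
  choose c hc using hb
  have hc0 : ∀ s i, 0 ≤ c s i := fun s i => (abs_nonneg _).trans (hc s i 0)
  set C : ℝ := ∑ s ∈ Finset.Icc (-(m : ℤ)) m, ∑ i : Fin l, ∑ j : Fin l,
    |(gramMatrix l)⁻¹ i j| * c s i with hC
  have hC0 : 0 ≤ C := Finset.sum_nonneg fun s _ => Finset.sum_nonneg fun i _ =>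
    Finset.sum_nonneg fun j _ => mul_nonneg (abs_nonneg _) (hc0 s i)
  refine ⟨C, hC0, fun κ ν hν i j x y => ?_⟩
  obtain ⟨-, -, c3, c4⟩ := cellIdx_spec hν
  have hCle : |(gramMatrix l)⁻¹ i j| * c (ν - cellIdx m κ ν) i ≤ C := by
    refine le_trans ?_ (Finset.single_le_sum (f := fun s => ∑ i : Fin l, ∑ j : Fin l,
      |(gramMatrix l)⁻¹ i j| * c s i) (fun s _ => Finset.sum_nonneg fun i _ =>
        Finset.sum_nonneg fun j _ => mul_nonneg (abs_nonneg _) (hc0 _ _))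
      (Finset.mem_Icc.2 ⟨c3, c4⟩))
    refine le_trans ?_ (Finset.single_le_sum (f := fun i => ∑ j : Fin l,
      |(gramMatrix l)⁻¹ i j| * c (ν - cellIdx m κ ν) i) (fun i _ =>
        Finset.sum_nonneg fun j _ => mul_nonneg (abs_nonneg _) (hc0 _ _)) (Finset.mem_univ i))
    exact Finset.single_le_sum (f := fun j => |(gramMatrix l)⁻¹ i j| * c (ν - cellIdx m κ ν) i)
      (fun j _ => mul_nonneg (abs_nonneg _) (hc0 _ _)) (Finset.mem_univ j)
  have hp : (0 : ℝ) < 2 ^ κ := by positivity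
  by_cases hy : y ∈ dyadicIoo κ (cellIdx m κ ν)
  · rw [splineKerTerm, Set.indicator_of_mem hy]
    rw [mem_dyadicIoo] at hy
    rw [abs_mul, abs_mul, abs_mul, abs_mul, abs_of_pos hp, abs_of_pos (pow_pos hp a),
      abs_of_pos (pow_pos hy.1 _)]
    have h1 : ((2 : ℝ) ^ κ * y - cellIdx m κ ν) ^ (j : ℕ) ≤ 1 := pow_le_one₀ hy.1.le hy.2.le
    calc _ ≤ (2 : ℝ) ^ κ * |(gramMatrix l)⁻¹ i j| * 1 *
          (((2 : ℝ) ^ κ) ^ a * c (ν - cellIdx m κ ν) i) := by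
          gcongr
          exact hc _ _ _
      _ = (|(gramMatrix l)⁻¹ i j| * c (ν - cellIdx m κ ν) i) * ((2 : ℝ) ^ κ) ^ (a + 1) := by ring
      _ ≤ _ := by gcongr
  · rw [splineKerTerm_eq_zero_right ν i j x hy, abs_zero]; positivity

/-- Finite overlap: a given `y` fixes the cell index as `⌊2^κ y⌋`, and at most `2m + 1` indices `ν`
share it. -/
theorem exists_abs_splineKer_le (l m a : ℕ) : ∃ C : ℝ, 0 ≤ C ∧ ∀ (κ : ℕ) (x y : ℝ),
    |splineKer l m a κ x y| ≤ C * ((2 : ℝ) ^ κ) ^ (a + 1) := by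
  obtain ⟨C, hC0, hC⟩ := exists_abs_splineKerTerm_le l m a
  refine ⟨(2 * m + 1) * (l * (l * C)), by positivity, fun κ x y => ?_⟩
  set S := Finset.Icc (-(m : ℤ)) ((2 : ℤ) ^ κ - 1) with hS
  set T := Finset.Icc (⌊(2 : ℝ) ^ κ * y⌋ - m) (⌊(2 : ℝ) ^ κ * y⌋ + m) with hT
  have h1 : ∀ ν ∈ S, |∑ i : Fin l, ∑ j : Fin l, splineKerTerm l m a κ ν i j x y| ≤
      l * (l * C) * ((2 : ℝ) ^ κ) ^ (a + 1) := fun ν hν => by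
    refine (Finset.abs_sum_le_sum_abs _ _).trans ((Finset.sum_le_sum fun i _ =>
      (Finset.abs_sum_le_sum_abs _ _).trans (Finset.sum_le_sum fun j _ => hC κ ν hν i j x y)).trans
      (le_of_eq ?_))
    simp only [Finset.sum_const, Finset.card_univ, Fintype.card_fin, nsmul_eq_mul]
    ring
  have h2 : ∀ ν ∈ S, ν ∉ S ∩ T → ∑ i : Fin l, ∑ j : Fin l, splineKerTerm l m a κ ν i j x y = 0 := by
    intro ν hν hν'
    refine Finset.sum_eq_zero fun i _ => Finset.sum_eq_zero fun j _ =>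
      splineKerTerm_eq_zero_right ν i j x fun hy => hν' (Finset.mem_inter.2 ⟨hν, ?_⟩)
    rw [mem_dyadicIoo] at hy
    have hfl : ⌊(2 : ℝ) ^ κ * y⌋ = cellIdx m κ ν := by
      rw [Int.floor_eq_iff]; exact ⟨by linarith [hy.1], by linarith [hy.2]⟩
    obtain ⟨-, -, c3, c4⟩ := cellIdx_spec hν
    rw [hT, Finset.mem_Icc, hfl]
    omega
  rw [splineKer, ← Finset.sum_subset Finset.inter_subset_left h2]
  refine (Finset.abs_sum_le_sum_abs _ _).trans ((Finset.sum_le_card_nsmul _ _ _ fun ν hν =>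
    h1 ν (Finset.mem_inter.1 hν).1).trans ?_)
  rw [nsmul_eq_mul]
  have hcard : ((S ∩ T).card : ℝ) ≤ 2 * m + 1 := by
    have : (S ∩ T).card ≤ 2 * m + 1 := by
      refine (Finset.card_le_card Finset.inter_subset_right).trans ?_
      rw [hT, Int.card_Icc]; omega
    exact_mod_cast this
  calc _ ≤ (2 * (m : ℝ) + 1) * (l * (l * C) * ((2 : ℝ) ^ κ) ^ (a + 1)) := by gcongr
    _ = _ := by ring

/-- The shift in the polynomials of `splineKerTerm` recentres them: `2^κ x - n = (2^κ x - ν) + (ν -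
n)` with `n` the cell index. -/
theorem splineKer_zero_apply (x y : ℝ) : splineKer l m 0 κ x y =
    ∑ ν ∈ Finset.Icc (-(m : ℤ)) ((2 : ℤ) ^ κ - 1), bspline m ((2 : ℝ) ^ κ * x - ν) *
      (dyadicIoo κ (cellIdx m κ ν)).indicator
        (fun y => cellKer l ((2 : ℝ) ^ κ) (cellIdx m κ ν) x y) y := by
  refine Finset.sum_congr rfl fun ν _ => ?_
  by_cases hy : y ∈ dyadicIoo κ (cellIdx m κ ν)
  · simp only [splineKerTerm, Set.indicator_of_mem hy, splDer, cellKer, gramKer, pow_zero, one_mul,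
      Finset.mul_sum]
    refine Finset.sum_congr rfl fun i _ => Finset.sum_congr rfl fun j _ => ?_
    simp only [Polynomial.eval_pow, Polynomial.eval_add, Polynomial.eval_X, Polynomial.eval_C]
    push_cast
    rw [show (2 : ℝ) ^ κ * x - ν + (ν - cellIdx m κ ν) = 2 ^ κ * x - cellIdx m κ ν by ring]
    ring
  · simp [splineKerTerm, Set.indicator_of_notMem hy]

theorem hasWeakDeriv_splineKer (h : a ≤ m) (y : ℝ) :
    HasWeakDeriv a (fun x => splineKer l m 0 κ x y) (fun x => splineKer l m a κ x y) := by
  have hm : ∀ (b : ℕ) (ν : ℤ) (i j : Fin l), Measurable fun x => splineKerTerm l m b κ ν i j x y :=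
    fun b ν i j => (measurable_splineKerTerm ν i j).comp (measurable_id.prodMk measurable_const)
  have hb : ∀ b, ∀ ν ∈ Finset.Icc (-(m : ℤ)) ((2 : ℤ) ^ κ - 1), ∀ (i j : Fin l),
      ∃ B, ∀ x, |splineKerTerm l m b κ ν i j x y| ≤ B := fun b ν hν i j => by
    obtain ⟨C, -, hC⟩ := exists_abs_splineKerTerm_le l m b
    exact ⟨_, fun x => hC κ ν hν i j x y⟩
  have key : HasWeakDeriv a
      (fun x => ∑ t ∈ (Finset.Icc (-(m : ℤ)) ((2 : ℤ) ^ κ - 1)) ×ˢ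
        (Finset.univ : Finset (Fin l × Fin l)), splineKerTerm l m 0 κ t.1 t.2.1 t.2.2 x y)
      (fun x => ∑ t ∈ (Finset.Icc (-(m : ℤ)) ((2 : ℤ) ^ κ - 1)) ×ˢ
        (Finset.univ : Finset (Fin l × Fin l)), splineKerTerm l m a κ t.1 t.2.1 t.2.2 x y) := by
    refine HasWeakDeriv.sum _ (fun t ht => ⟨hm _ _ _ _, hb _ _ (Finset.mem_product.1 ht).1 _ _⟩)
      (fun t ht => ⟨hm _ _ _ _, hb _ _ (Finset.mem_product.1 ht).1 _ _⟩) fun t _ => ?_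
    refine HasWeakDeriv.const_mul ?_ _
    simpa only [pow_zero, one_mul] using
      (hasWeakDeriv_splDer h _).comp_affine (s := (2 : ℝ) ^ κ) (by positivity) t.1
  simpa only [Finset.sum_product, Fintype.sum_prod_type, splineKer] using key

theorem continuous_cellKer_right (l : ℕ) (s n x : ℝ) : Continuous fun y => cellKer l s n x y := by
  unfold cellKer gramKer
  fun_prop

/-- Each local projection returns `x ^ b` exactly, whatever its cell, and the B-splines sum to one.
-/
theorem integral_splineKer_mul_pow {x : ℝ} (hx : x ∈ Set.Ioo (0 : ℝ) 1)
    (hn : ∀ n : ℤ, (2 : ℝ) ^ κ * x ≠ n) {b : ℕ} (hb : b < l) :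
    ∫ y, splineKer l m 0 κ x y * y ^ b = x ^ b := by
  have hp : (0 : ℝ) < 2 ^ κ := by positivity
  simp only [splineKer_zero_apply, Finset.sum_mul]
  have hg : ∀ (n : ℤ) y, (dyadicIoo κ n).indicator
        (fun y => cellKer l ((2 : ℝ) ^ κ) n x y) y * y ^ b =
      (dyadicIoo κ n).indicator (fun y => cellKer l ((2 : ℝ) ^ κ) n x y * y ^ b) y := fun n y => by
    by_cases hy : y ∈ dyadicIoo κ n
    · rw [Set.indicator_of_mem hy, Set.indicator_of_mem hy]
    · rw [Set.indicator_of_notMem hy, Set.indicator_of_notMem hy, zero_mul]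
  have hi : ∀ n : ℤ, Integrable fun y => (dyadicIoo κ n).indicator
        (fun y => cellKer l ((2 : ℝ) ^ κ) n x y) y * y ^ b := fun n => by
    have := (integrableOn_dyadicIoo ((continuous_cellKer_right l ((2 : ℝ) ^ κ) n x).mul
      (continuous_pow b)) κ n).integrable_indicator (measurableSet_dyadicIoo κ n)
    simp only [hg]
    exact this
  have he : ∀ n : ℤ, ∫ y, (dyadicIoo κ n).indicator
        (fun y => cellKer l ((2 : ℝ) ^ κ) n x y) y * y ^ b = x ^ b := fun n => by
    have := integral_cellKer_mul_eval (l := l) hp (n : ℝ) x (p := Polynomial.X ^ b)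
      (by rw [Polynomial.natDegree_X_pow]; exact hb)
    simp only [Polynomial.eval_pow, Polynomial.eval_X] at this
    simp only [hg]
    rw [← this, integral_indicator (measurableSet_dyadicIoo κ n), dyadicIoo]
  rw [integral_finsetSum]
  · simp only [mul_assoc, integral_const_mul, he]
    rw [← Finset.sum_mul, sum_bspline_sub m _ _ ?_ hn, one_mul]
    push_cast
    constructor
    · have := mul_pos hp hx.1; linarith
    · have := mul_lt_mul_of_pos_left hx.2 hp; linarith
  · intro ν _
    simp only [mul_assoc]
    exact (hi _).const_mul _

end SplineKer

/-- The weak derivative of order `a` in `x` of the kernel of the difference of consecutive univariate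
approximation operators. -/
def diffKer (l m a κ : ℕ) (x y : ℝ) : ℝ :=
  splineKer l m a κ x y - if κ = 0 then 0 else splineKer l m a (κ - 1) x y

/-! ### Differences of consecutive levels: size, support and vanishing moments. -/

section DiffKer

variable {l m a κ : ℕ}

theorem measurable_splineKer_left (y : ℝ) : Measurable fun x => splineKer l m a κ x y := by
  have h : Measurable fun x : ℝ => (x, y) := by fun_prop
  have h2 := (measurable_splineKer (l := l) (m := m) (a := a) (κ := κ)).comp h
  exact h2

theorem measurable_splineKer_right (x : ℝ) : Measurable fun y => splineKer l m a κ x y := by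
  have h : Measurable fun y : ℝ => (x, y) := by fun_prop
  have h2 := (measurable_splineKer (l := l) (m := m) (a := a) (κ := κ)).comp h
  exact h2

theorem measurable_diffKer : Measurable fun z : ℝ × ℝ => diffKer l m a κ z.1 z.2 := by
  unfold diffKer
  by_cases h : κ = 0
  · simp only [h, if_true]; exact measurable_splineKer.sub_const 0
  · simp only [h, if_false]; exact measurable_splineKer.sub measurable_splineKer

theorem measurable_diffKer_right (x : ℝ) : Measurable fun y => diffKer l m a κ x y := by
  have h : Measurable fun y : ℝ => (x, y) := by fun_prop
  have h2 := (measurable_diffKer (l := l) (m := m) (a := a) (κ := κ)).comp h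
  exact h2

theorem measurable_diffKer_left (y : ℝ) : Measurable fun x => diffKer l m a κ x y := by
  have h : Measurable fun x : ℝ => (x, y) := by fun_prop
  have h2 := (measurable_diffKer (l := l) (m := m) (a := a) (κ := κ)).comp h
  exact h2

theorem exists_abs_diffKer_le (l m a : ℕ) : ∃ C : ℝ, 0 ≤ C ∧ ∀ (κ : ℕ) (x y : ℝ),
    |diffKer l m a κ x y| ≤ C * ((2 : ℝ) ^ κ) ^ (a + 1) := by
  obtain ⟨C, hC0, hC⟩ := exists_abs_splineKer_le l m a
  refine ⟨2 * C, by positivity, fun κ x y => ?_⟩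
  have h2 : |if κ = 0 then 0 else splineKer l m a (κ - 1) x y| ≤ C * ((2 : ℝ) ^ κ) ^ (a + 1) := by
    split_ifs
    · rw [abs_zero]; positivity
    · refine (hC _ _ _).trans ?_
      gcongr
      · norm_num
      · omega
  have := abs_sub (splineKer l m a κ x y) (if κ = 0 then 0 else splineKer l m a (κ - 1) x y)
  rw [diffKer]; linarith [hC κ x y]

theorem diffKer_ne_zero {x y : ℝ} (h : diffKer l m a κ x y ≠ 0) :
    y ∈ Set.Ioo (0 : ℝ) 1 ∧ |(2 : ℝ) ^ κ * (y - x)| < 4 * m + 4 := by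
  by_cases h1 : splineKer l m a κ x y = 0
  · rw [diffKer, h1, zero_sub, neg_ne_zero] at h
    by_cases hκ : κ = 0
    · simp [hκ] at h
    · rw [if_neg hκ] at h
      obtain ⟨h2, h3⟩ := splineKer_ne_zero h
      refine ⟨h2, ?_⟩
      obtain ⟨k, rfl⟩ : ∃ k, κ = k + 1 := ⟨κ - 1, by omega⟩
      rw [Nat.add_sub_cancel] at h3
      -- Cells of the previous level are twice as long, which doubles the radius to `4m + 4`.
      rw [pow_succ', mul_assoc, abs_mul, abs_of_pos (by norm_num : (0 : ℝ) < 2)]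
      linarith
  · obtain ⟨h2, h3⟩ := splineKer_ne_zero h1
    exact ⟨h2, h3.trans (by linarith [(Nat.cast_nonneg m : (0 : ℝ) ≤ m)])⟩

theorem hasWeakDeriv_diffKer (h : a ≤ m) (y : ℝ) :
    HasWeakDeriv a (fun x => diffKer l m 0 κ x y) (fun x => diffKer l m a κ x y) := by
  by_cases hκ : κ = 0
  · simpa only [diffKer, hκ, if_true, sub_zero] using hasWeakDeriv_splineKer (κ := 0) h y
  · have hb : ∀ b κ', Measurable (fun x => splineKer l m b κ' x y) ∧
        ∃ B, ∀ x, |splineKer l m b κ' x y| ≤ B := fun b κ' => by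
      obtain ⟨C, -, hC⟩ := exists_abs_splineKer_le l m b
      exact ⟨measurable_splineKer_left y, _,
        fun x => hC κ' x y⟩
    intro φ hφ hc
    simp only [diffKer, hκ, if_false, sub_mul]
    have i0 := fun κ' => integrable_mul_of_bounded (hb a κ').1 (hb a κ').2.choose_spec
      hφ.continuous hc
    have i1 := fun κ' => integrable_mul_of_bounded (hb 0 κ').1 (hb 0 κ').2.choose_spec
      (contDiff_iteratedDeriv hφ a).continuous (hasCompactSupport_iteratedDeriv hc a)
    rw [integral_sub (i0 _) (i0 _), integral_sub (i1 _) (i1 _),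
      hasWeakDeriv_splineKer h y φ hφ hc, hasWeakDeriv_splineKer h y φ hφ hc, mul_sub]

theorem sum_diffKer (k : ℕ) (x y : ℝ) :
    ∑ κ ∈ Finset.Iic k, diffKer l m a κ x y = splineKer l m a k x y := by
  have : Finset.Iic k = Finset.range (k + 1) := by ext; simp
  rw [this]
  induction k with
  | zero => simp [diffKer]
  | succ k ih =>
    rw [Finset.sum_range_succ, ih (by ext; simp)]
    simp [diffKer]

theorem integral_mul_integral_swap {K : ℝ → ℝ → ℝ} (hm : Measurable fun z : ℝ × ℝ => K z.1 z.2)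
    {B : ℝ} (hB : ∀ x y, |K x y| ≤ B) {χ : ℝ → ℝ} (hχ : Continuous χ) (hc : HasCompactSupport χ)
    (b : ℕ) : ∫ x, χ x * ∫ y in Set.Ioo (0 : ℝ) 1, K x y * y ^ b =
      ∫ y in Set.Ioo (0 : ℝ) 1, (∫ x, K x y * χ x) * y ^ b := by
  simp only [← integral_const_mul, ← integral_mul_const]
  rw [integral_integral_swap]
  · congr 1 with y; congr 1 with x; ring
  · have h1 : Integrable (fun z : ℝ × ℝ => χ z.1 * z.2 ^ b)
        (volume.prod (volume.restrict (Set.Ioo (0 : ℝ) 1))) :=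
      (hχ.integrable_of_hasCompactSupport hc).mul_prod
        (integrableOn_Ioo_of_continuous (continuous_pow b) 0 1)
    have h2 := h1.bdd_mul (c := B) hm.aestronglyMeasurable (ae_of_all _ fun z => hB z.1 z.2)
    refine h2.congr (ae_of_all _ fun z => ?_)
    simp only [Function.uncurry]; ring

theorem integral_eq_setIntegral_unit {g : ℝ → ℝ} (hg : ∀ y, g y ≠ 0 → y ∈ Set.Ioo (0 : ℝ) 1) :
    ∫ y, g y = ∫ y in Set.Ioo (0 : ℝ) 1, g y :=
  (setIntegral_eq_integral_of_forall_compl_eq_zero fun y hy => by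
    by_contra h; exact hy (hg y h)).symm

theorem ae_two_pow_mul_ne_int (κ : ℕ) : ∀ᵐ x : ℝ, ∀ n : ℤ, (2 : ℝ) ^ κ * x ≠ n := by
  have hc : (Set.range fun n : ℤ => ((2 : ℝ) ^ κ)⁻¹ * n).Countable := Set.countable_range _
  filter_upwards [hc.ae_notMem volume] with x hx n hn
  exact hx ⟨n, by simp only [← hn]; field_simp⟩

theorem ae_integral_diffKer_zero_mul_pow (hκ : 1 ≤ κ) {b : ℕ} (hb : b < l) :
    ∀ᵐ x : ℝ, x ∈ Set.Ioo (0 : ℝ) 1 → ∫ y, diffKer l m 0 κ x y * y ^ b = 0 := by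
  filter_upwards [ae_two_pow_mul_ne_int κ, ae_two_pow_mul_ne_int (κ - 1)] with x h1 h2 hx
  have hi : ∀ κ', Integrable fun y => splineKer l m 0 κ' x y * y ^ b := fun κ' => by
    obtain ⟨C, -, hC⟩ := exists_abs_splineKer_le l m 0
    have : IntegrableOn (fun y => splineKer l m 0 κ' x y * y ^ b) (Set.Ioo (0 : ℝ) 1) :=
      Integrable.bdd_mul (integrableOn_Ioo_of_continuous (continuous_pow b) 0 1)
        (measurable_splineKer_right x).aestronglyMeasurable
        (ae_of_all _ fun y => hC κ' x y)
    refine this.integrable_of_forall_notMem_eq_zero fun y hy => ?_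
    by_contra h
    exact hy (splineKer_ne_zero (left_ne_zero_of_mul h)).1
  have hκ' : κ ≠ 0 := by omega
  simp only [diffKer, if_neg hκ', sub_mul]
  rw [integral_sub (hi _) (hi _), integral_splineKer_mul_pow hx h1 hb,
    integral_splineKer_mul_pow hx h2 hb, sub_self]

theorem tsupport_iteratedDeriv_subset (φ : ℝ → ℝ) (a : ℕ) :
    tsupport (iteratedDeriv a φ) ⊆ tsupport φ := by
  induction a with
  | zero => simp
  | succ n ih => rw [iteratedDeriv_succ]; exact (tsupport_deriv_subset).trans ih

/-- As a function of `x`, the moment of the kernel of order `a` is the `a`-th weak derivative of the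
moment of the kernel of order zero. The latter vanishes almost everywhere on `(0,1)` because both
levels reproduce `y ^ b`, so the former is zero as a distribution there. -/
theorem ae_integral_diffKer_mul_pow (ha : a ≤ m) (hκ : 1 ≤ κ) :
    ∀ᵐ x : ℝ, x ∈ Set.Ioo (0 : ℝ) 1 → ∀ b < l, ∫ y, diffKer l m a κ x y * y ^ b = 0 := by
  have key : ∀ b < l, ∀ᵐ x : ℝ, x ∈ Set.Ioo (0 : ℝ) 1 → ∫ y, diffKer l m a κ x y * y ^ b = 0 := by
    intro b hb
    obtain ⟨C, hC0, hC⟩ := exists_abs_diffKer_le l m a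
    obtain ⟨C', hC0', hC'⟩ := exists_abs_diffKer_le l m 0
    have hset : ∀ c x, ∫ y, diffKer l m c κ x y * y ^ b =
        ∫ y in Set.Ioo (0 : ℝ) 1, diffKer l m c κ x y * y ^ b := fun c x =>
      integral_eq_setIntegral_unit fun y hy => (diffKer_ne_zero (left_ne_zero_of_mul hy)).1
    refine isOpen_Ioo.ae_eq_zero_of_integral_contDiff_smul_eq_zero ?_ fun φ hφ hc hs => ?_
    · refine LocallyIntegrable.locallyIntegrableOn ?_ _
      simp only [hset]
      have hmeas : Measurable fun x => ∫ y in Set.Ioo (0 : ℝ) 1, diffKer l m a κ x y * y ^ b := by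
        have : Measurable fun z : ℝ × ℝ => diffKer l m a κ z.1 z.2 * z.2 ^ b :=
          measurable_diffKer.mul (measurable_snd.pow_const b)
        exact (this.stronglyMeasurable.integral_prod_right
          (ν := volume.restrict (Set.Ioo (0 : ℝ) 1))).measurable
      refine LocallyIntegrable.mono (locallyIntegrable_const (C * ((2 : ℝ) ^ κ) ^ (a + 1)))
        hmeas.aestronglyMeasurable (ae_of_all _ fun x => ?_)
      have := norm_setIntegral_le_of_norm_le_const (μ := volume) (s := Set.Ioo (0 : ℝ) 1)
        (f := fun y => diffKer l m a κ x y * y ^ b) (C := C * ((2 : ℝ) ^ κ) ^ (a + 1)) (by simp)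
        (fun y hy => by
          rw [norm_mul, norm_pow, Real.norm_of_nonneg hy.1.le]
          exact (mul_le_of_le_one_right (norm_nonneg _) (pow_le_one₀ hy.1.le hy.2.le)).trans
            (hC κ x y))
      simpa using this.trans (le_abs_self _)
    · simp only [hset, smul_eq_mul]
      have c1 := (contDiff_iteratedDeriv hφ a).continuous
      have c2 := hasCompactSupport_iteratedDeriv hc a
      have e : ∀ y, ∫ x, diffKer l m a κ x y * φ x =
          (-1) ^ a * ∫ x, diffKer l m 0 κ x y * iteratedDeriv a φ x := fun y => by
        rw [hasWeakDeriv_diffKer ha y φ hφ hc, ← mul_assoc, ← mul_pow]; simp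
      rw [integral_mul_integral_swap measurable_diffKer (hC κ) hφ.continuous hc b]
      simp only [e, mul_assoc, integral_const_mul]
      rw [← integral_mul_integral_swap measurable_diffKer (hC' κ) c1 c2 b]
      refine mul_eq_zero_of_right _ (integral_eq_zero_of_ae ?_)
      filter_upwards [ae_integral_diffKer_zero_mul_pow (m := m) hκ hb] with x hx
      by_cases hx' : x ∈ Set.Ioo (0 : ℝ) 1
      · rw [← hset, hx hx', mul_zero]; rfl
      · rw [image_eq_zero_of_notMem_tsupport fun h => hx' (hs (tsupport_iteratedDeriv_subset φ a h)),
          zero_mul]; rfl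
  have := (ae_all_iff (ι := Fin l)).2 fun b => key b b.2
  filter_upwards [this] with x hx hx' b hb using hx ⟨b, hb⟩ hx'

/-- The kernel has size `2^{κ(a+1)}`, and normalizing by the length of its interval costs one more
factor `2^κ`. Truncating the interval to `(0,1)` forces all nodes to stay where `f` is given. -/
theorem exists_isDiffRep_diffKer (hl : 1 ≤ l) (ha : a ≤ m) : ∃ C : ℝ, 0 ≤ C ∧ ∀ κ : ℕ, 1 ≤ κ →
    ∀ᵐ x : ℝ, x ∈ Set.Ioo (0 : ℝ) 1 →
      IsDiffRep l (max 0 (x - (4 * m + 4) / 2 ^ κ)) (min 1 (x + (4 * m + 4) / 2 ^ κ))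
        (C * ((2 : ℝ) ^ κ) ^ (a + 2)) (diffKer l m a κ x) := by
  obtain ⟨C, hC0, hC⟩ := exists_isDiffRep hl
  obtain ⟨D, hD0, hD⟩ := exists_abs_diffKer_le l m a
  refine ⟨C * D, by positivity, fun κ hκ => ?_⟩
  filter_upwards [ae_integral_diffKer_mul_pow (l := l) ha hκ] with x hx hx'
  have hp : (0 : ℝ) < 2 ^ κ := by positivity
  have hp1 : (1 : ℝ) ≤ 2 ^ κ := one_le_pow₀ (by norm_num)
  have hm : (0 : ℝ) ≤ m := Nat.cast_nonneg m
  set ρ : ℝ := (4 * m + 4) / 2 ^ κ with hρ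
  have hρ1 : ((2 : ℝ) ^ κ)⁻¹ ≤ ρ := by rw [hρ, inv_eq_one_div]; gcongr; linarith
  have hδ1 : ((2 : ℝ) ^ κ)⁻¹ ≤ 1 := inv_le_one_of_one_le₀ hp1
  have hδ0 : 0 < ((2 : ℝ) ^ κ)⁻¹ := inv_pos.2 hp
  -- Near an endpoint at least one half of the interval survives the truncation, unless it becomes
  -- all of `(0,1)`.
  have hlen : ((2 : ℝ) ^ κ)⁻¹ ≤ min 1 (x + ρ) - max 0 (x - ρ) := by
    rcases min_choice 1 (x + ρ) with h1 | h1 <;> rcases max_choice 0 (x - ρ) with h2 | h2 <;>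
      rw [h1, h2] <;> linarith [hx'.1, hx'.2]
  refine (hC (max 0 (x - ρ)) (min 1 (x + ρ)) (by linarith) _
    (diffKer l m a κ x) (measurable_diffKer_right x) (hD κ x) (fun y hy => ?_)
    (hx hx')).mono ?_
  · by_contra h
    obtain ⟨h1, h2⟩ := diffKer_ne_zero h
    rw [abs_mul, abs_of_pos hp, ← lt_div_iff₀' hp, ← hρ, abs_lt] at h2
    exact hy ⟨max_lt h1.1 (by linarith [h2.1]), lt_min h1.2 (by linarith [h2.2])⟩
  · have : (min 1 (x + ρ) - max 0 (x - ρ))⁻¹ ≤ 2 ^ κ := by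
      rw [inv_le_comm₀ (by linarith) hp]; exact hlen
    calc _ ≤ (2 : ℝ) ^ κ * (C * (D * ((2 : ℝ) ^ κ) ^ (a + 1))) := by gcongr
      _ = _ := by ring

end DiffKer

/-! ### Integral representations of the approximation operators -/

/-- Separating the variables shows that integrals of the kernel against functions of `y` are
polynomials in `x` of degree less than `l`. -/
theorem exists_cellKer_eq_sum (l : ℕ) (s n : ℝ) : ∃ c : Fin l → ℝ → ℝ, (∀ i, Continuous (c i)) ∧
    ∀ x y, cellKer l s n x y = ∑ i : Fin l, x ^ (i : ℕ) * c i y := by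
  let q : Fin l → ℝ[X] := fun a => (Polynomial.C s * Polynomial.X + Polynomial.C (-n)) ^ (a : ℕ)
  have hq : ∀ a, (q a).natDegree < l := fun a => by
    refine lt_of_le_of_lt Polynomial.natDegree_pow_le (lt_of_le_of_lt ?_ a.2)
    calc _ ≤ (a : ℕ) * 1 := Nat.mul_le_mul_left _ Polynomial.natDegree_linear_le
      _ = _ := mul_one _
  refine ⟨fun i y => ∑ a : Fin l, ∑ b : Fin l,
    s * (gramMatrix l)⁻¹ a b * (s * y - n) ^ (b : ℕ) * (q a).coeff i, fun i => by fun_prop,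
    fun x y => ?_⟩
  have he : ∀ a : Fin l, (s * x - n) ^ (a : ℕ) = ∑ i : Fin l, (q a).coeff i * x ^ (i : ℕ) := fun a => by
    have h1 := Polynomial.eval_eq_sum_range' (hq a) x
    have h2 : (q a).eval x = (s * x - n) ^ (a : ℕ) := by
      simp only [q, Polynomial.eval_pow, Polynomial.eval_add, Polynomial.eval_mul,
        Polynomial.eval_C, Polynomial.eval_X]
      rw [sub_eq_add_neg]
    rw [← h2, h1, Finset.sum_range]
  simp only [cellKer, gramKer, Finset.mul_sum]
  conv_rhs => rw [Finset.sum_comm]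
  refine Finset.sum_congr rfl fun a _ => ?_
  conv_rhs => rw [Finset.sum_comm]
  refine Finset.sum_congr rfl fun b _ => ?_
  rw [he a]
  simp only [Finset.mul_sum, Finset.sum_mul]
  exact Finset.sum_congr rfl fun i _ => by ring

section Representation

variable {d : ℕ} {l : Fin d → ℕ} {s : Fin d → ℝ} {n : Fin d → ℝ}

theorem integral_cell_prod (x₀ δ : Fin d → ℝ) (g : Fin d → ℝ → ℝ) :
    ∫ x in cell x₀ δ, ∏ j, g j (x j) = ∏ j, ∫ t in Set.Ioo (x₀ j) (x₀ j + δ j), g j t := by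
  rw [cell_eq_pi, volume_pi, Measure.restrict_pi_pi, integral_fintype_prod_eq_prod]

theorem continuous_prod_cellKer (l : Fin d → ℕ) (s n : Fin d → ℝ) :
    Continuous fun z : (Fin d → ℝ) × (Fin d → ℝ) =>
      ∏ j, cellKer (l j) (s j) (n j) (z.1 j) (z.2 j) := by
  refine continuous_finsetProd _ fun j _ => ?_
  unfold cellKer gramKer
  fun_prop

theorem integral_prod_cellKer_mul (hl : ∀ j, 1 ≤ l j) (hs : ∀ j, 0 < s j) (y : Fin d → ℝ)
    {h : (Fin d → ℝ) → ℝ} (hh : h ∈ polySpace fun j => l j - 1) :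
    ∫ x in cell (fun j => (s j)⁻¹ * n j) (fun j => (s j)⁻¹),
      (∏ j, cellKer (l j) (s j) (n j) (x j) (y j)) * h x = h y := by
  have hc : Continuous fun x : Fin d → ℝ => ∏ j, cellKer (l j) (s j) (n j) (x j) (y j) := by
    refine continuous_finsetProd _ fun j _ => ?_
    unfold cellKer gramKer
    fun_prop
  have hi : ∀ g : (Fin d → ℝ) → ℝ, Continuous g →
      IntegrableOn g (cell (fun j => (s j)⁻¹ * n j) (fun j => (s j)⁻¹)) := fun g hg => by
    refine (hg.continuousOn.integrableOn_compact (isCompact_Icc (a := fun j => (s j)⁻¹ * n j)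
      (b := (fun j => (s j)⁻¹ * n j) + fun j => (s j)⁻¹))).mono_set ?_
    exact fun x hx => ⟨fun j => (hx j).1.le, fun j => (hx j).2.le⟩
  refine Submodule.span_induction (p := fun h _ =>
    ∫ x in cell (fun j => (s j)⁻¹ * n j) (fun j => (s j)⁻¹),
      (∏ j, cellKer (l j) (s j) (n j) (x j) (y j)) * h x = h y) ?_ ?_ ?_ ?_ hh
  · rintro _ ⟨a, ha, rfl⟩
    simp only [← Finset.prod_mul_distrib]
    rw [integral_cell_prod _ _ fun j t => cellKer (l j) (s j) (n j) t (y j) * t ^ a j]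
    refine Finset.prod_congr rfl fun j _ => ?_
    have haj : a j ≤ l j - 1 := ha j
    have := integral_cellKer_mul_eval (hs j) (n j) (y j) (p := Polynomial.X ^ a j) (l := l j)
      (by rw [Polynomial.natDegree_X_pow]; have := hl j; omega)
    simp only [Polynomial.eval_pow, Polynomial.eval_X] at this
    rw [← this]
    congr 1 with t
    rw [cellKer_comm]
  · simp
  · intro g₁ g₂ hg₁ hg₂ h₁ h₂
    simp only [Pi.add_apply, mul_add]
    have i₁ := hi _ (hc.mul (continuous_of_mem_polySpace hg₁))
    have i₂ := hi _ (hc.mul (continuous_of_mem_polySpace hg₂))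
    rw [← h₁, ← h₂]
    exact integral_add i₁ i₂
  · intro c g _ h₁
    simp only [Pi.smul_apply, smul_eq_mul, mul_left_comm _ c]
    rw [integral_const_mul, h₁]

theorem integrable_prod_cellKer_mul {f : (Fin d → ℝ) → ℝ} {x₀ δ : Fin d → ℝ}
    (hf : IntegrableOn f (cell x₀ δ)) (l : Fin d → ℕ) (s n : Fin d → ℝ) {h : (Fin d → ℝ) → ℝ}
    (hh : Continuous h) :
    Integrable (fun z : (Fin d → ℝ) × (Fin d → ℝ) =>
      (∏ j, cellKer (l j) (s j) (n j) (z.1 j) (z.2 j)) * h z.1 * f z.2)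
      ((volume.restrict (cell x₀ δ)).prod (volume.restrict (cell x₀ δ))) := by
  have hsub : cell x₀ δ ⊆ Set.Icc x₀ (x₀ + δ) :=
    fun x hx => ⟨fun j => (hx j).1.le, fun j => (hx j).2.le⟩
  have hco : Continuous fun z : (Fin d → ℝ) × (Fin d → ℝ) =>
      (∏ j, cellKer (l j) (s j) (n j) (z.1 j) (z.2 j)) * h z.1 :=
    (continuous_prod_cellKer l s n).mul (hh.comp continuous_fst)
  obtain ⟨M, hM⟩ := ((isCompact_Icc (a := x₀) (b := x₀ + δ)).prod
    (isCompact_Icc (a := x₀) (b := x₀ + δ))).exists_bound_of_continuousOn hco.continuousOn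
  have : IsFiniteMeasure (volume.restrict (cell x₀ δ)) :=
    ⟨by rw [Measure.restrict_apply_univ]
        exact (measure_mono hsub).trans_lt isCompact_Icc.measure_lt_top⟩
  have h1 : Integrable (fun z : (Fin d → ℝ) × (Fin d → ℝ) => (1 : ℝ) * f z.2)
      ((volume.restrict (cell x₀ δ)).prod (volume.restrict (cell x₀ δ))) :=
    (integrable_const (1 : ℝ)).mul_prod hf
  simp only [one_mul] at h1
  refine h1.bdd_mul (c := M) hco.aestronglyMeasurable ?_
  rw [Measure.prod_restrict]
  filter_upwards [ae_restrict_mem ((isOpen_cell x₀ δ).measurableSet.prod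
    (isOpen_cell x₀ δ).measurableSet)] with z hz
  exact hM z ⟨hsub hz.1, hsub hz.2⟩

/-- The integral is a polynomial of the right degrees and, by Fubini's theorem and the reproducing
property in the other variable, has the orthogonality that characterizes the projection; uniqueness
concludes. -/
theorem polyProj_eq_integral (hl : ∀ j, 1 ≤ l j) (hs : ∀ j, 0 < s j) {f : (Fin d → ℝ) → ℝ}
    (hf : IntegrableOn f (cell (fun j => (s j)⁻¹ * n j) (fun j => (s j)⁻¹))) (x : Fin d → ℝ) :
    polyProj (fun j => l j - 1) (fun j => (s j)⁻¹) (fun j => (s j)⁻¹ * n j) f x =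
      ∫ y in cell (fun j => (s j)⁻¹ * n j) (fun j => (s j)⁻¹),
        (∏ j, cellKer (l j) (s j) (n j) (x j) (y j)) * f y := by
  set Q := cell (fun j => (s j)⁻¹ * n j) (fun j => (s j)⁻¹) with hQ
  have hδ : ∀ j, 0 < (s j)⁻¹ := fun j => inv_pos.2 (hs j)
  have hu := existsUnique_isPolyProj (fun j => l j - 1) hδ (fun j => (s j)⁻¹ * n j) hf
  have h1 := isPolyProj_polyProj (fun j => l j - 1) hδ (fun j => (s j)⁻¹ * n j) hf
  refine congrFun (hu.unique h1 (y₂ := fun x =>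
    ∫ y in Q, (∏ j, cellKer (l j) (s j) (n j) (x j) (y j)) * f y) ?_) x
  have hmem : (fun x : Fin d → ℝ => ∫ y in Q, (∏ j, cellKer (l j) (s j) (n j) (x j) (y j)) * f y) ∈
      polySpace fun j => l j - 1 := by
    choose c hc hce using fun j => exists_cellKer_eq_sum (l j) (s j) (n j)
    have e : (fun x : Fin d → ℝ => ∫ y in Q, (∏ j, cellKer (l j) (s j) (n j) (x j) (y j)) * f y) =
        ∑ i ∈ Fintype.piFinset fun j => (Finset.univ : Finset (Fin (l j))),
          (∫ y in Q, (∏ j, c j (i j) (y j)) * f y) • fun x : Fin d → ℝ => ∏ j, x j ^ (i j : ℕ) := by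
      funext x
      simp only [hce, Finset.prod_univ_sum, Finset.sum_mul, Finset.sum_apply, Pi.smul_apply,
        smul_eq_mul, Finset.prod_mul_distrib, mul_assoc]
      rw [integral_finsetSum]
      · exact Finset.sum_congr rfl fun i _ => by rw [integral_const_mul, mul_comm]
      · intro i _
        refine Integrable.const_mul ?_ _
        refine hf.continuousOn_mul_of_subset (K := Set.Icc (fun j => (s j)⁻¹ * n j)
          ((fun j => (s j)⁻¹ * n j) + fun j => (s j)⁻¹)) ?_
          isCompact_Icc (isOpen_cell _ _).measurableSet (fun x hx => ⟨fun j => (hx j).1.le, fun j => (hx j).2.le⟩)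
        exact (continuous_finsetProd _ fun j _ => (hc j (i j)).comp (continuous_apply j)).continuousOn
    rw [e]
    refine Submodule.sum_mem _ fun i _ => Submodule.smul_mem _ _ (Submodule.subset_span ?_)
    exact ⟨fun j => (i j : ℕ), fun j => by have := (i j).2; simp only; omega, rfl⟩
  refine ⟨hmem, fun h hh => ?_⟩
  have hint := integrable_prod_cellKer_mul hf l s n (continuous_of_mem_polySpace hh)
  have e1 : ∀ x, (∫ y in Q, (∏ j, cellKer (l j) (s j) (n j) (x j) (y j)) * f y) * h x =
      ∫ y in Q, (∏ j, cellKer (l j) (s j) (n j) (x j) (y j)) * h x * f y := fun x => by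
    rw [← integral_mul_const]; congr 1 with y; ring
  simp only [sub_mul]
  rw [integral_sub (integrableOn_cell_mul hf hh) (integrableOn_cell_mul (integrableOn_cell hmem) hh)]
  simp only [e1]
  rw [integral_integral_swap hint]
  simp only [integral_mul_const]
  rw [sub_eq_zero]
  congr 1 with y
  rw [integral_prod_cellKer_mul hl hs y hh, mul_comm]

end Representation

section Operators

variable {d : ℕ} {l m : Fin d → ℕ} {f : (Fin d → ℝ) → ℝ}

theorem cell_subset_unitCube {κ : Fin d → ℕ} {ν : Fin d → ℤ}
    (hν : ν ∈ Finset.Icc (fun j => -(m j : ℤ)) (fun j => (2 : ℤ) ^ κ j - 1)) :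
    cell (fun j => ((2 : ℝ) ^ κ j)⁻¹ * cellIndex m κ ν j) (fun j => ((2 : ℝ) ^ κ j)⁻¹) ⊆
      unitCube d := by
  intro x hx j
  obtain ⟨h1, h2⟩ := hx j
  obtain ⟨g1, g2⟩ := Finset.mem_Icc.1 hν
  obtain ⟨c1, c2, -, -⟩ := cellIdx_spec (Finset.mem_Icc.2 ⟨g1 j, g2 j⟩)
  have hp : (0 : ℝ) < 2 ^ κ j := by positivity
  change ((2 : ℝ) ^ κ j)⁻¹ * (cellIdx (m j) (κ j) (ν j) : ℤ) < x j at h1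
  change x j < ((2 : ℝ) ^ κ j)⁻¹ * (cellIdx (m j) (κ j) (ν j) : ℤ) + ((2 : ℝ) ^ κ j)⁻¹ at h2
  have d1 : (0 : ℝ) ≤ cellIdx (m j) (κ j) (ν j) := by exact_mod_cast c1
  have d2 : (cellIdx (m j) (κ j) (ν j) : ℝ) + 1 ≤ 2 ^ κ j := by exact_mod_cast c2
  constructor
  · exact lt_of_le_of_lt (by positivity) h1
  · refine lt_of_lt_of_le h2 ?_
    rw [← mul_add_one, inv_mul_le_iff₀ hp, mul_one]; exact d2

theorem Icc_eq_piFinset (a b : Fin d → ℤ) :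
    Finset.Icc a b = Fintype.piFinset fun j => Finset.Icc (a j) (b j) := by
  ext ν
  simp only [Finset.mem_Icc, Fintype.mem_piFinset, Pi.le_def, forall_and]

theorem approxOp_eq_integral (hl : ∀ j, 1 ≤ l j) (κ : Fin d → ℕ)
    (hf : IntegrableOn f (unitCube d)) (x : Fin d → ℝ) :
    approxOp (fun j => l j - 1) m κ f x =
      ∫ y in unitCube d, (∏ j, splineKer (l j) (m j) 0 (κ j) (x j) (y j)) * f y := by
  set S := Finset.Icc (fun j => -(m j : ℤ)) (fun j => (2 : ℤ) ^ κ j - 1) with hS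
  let Q : (Fin d → ℤ) → Set (Fin d → ℝ) := fun ν =>
    cell (fun j => ((2 : ℝ) ^ κ j)⁻¹ * cellIndex m κ ν j) (fun j => ((2 : ℝ) ^ κ j)⁻¹)
  have e1 : ∀ y, (∏ j, splineKer (l j) (m j) 0 (κ j) (x j) (y j)) * f y =
      ∑ ν ∈ S, (Q ν).indicator (fun y => (∏ j, cellKer (l j) ((2 : ℝ) ^ κ j) (cellIndex m κ ν j)
        (x j) (y j)) * f y) y * dyadicBspline m κ ν x := fun y => by
    simp only [splineKer_zero_apply, Finset.prod_univ_sum, hS, Icc_eq_piFinset, Finset.sum_mul]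
    refine Finset.sum_congr rfl fun ν _ => ?_
    rw [Finset.prod_mul_distrib]
    by_cases hy : y ∈ Q ν
    · rw [Set.indicator_of_mem hy]
      have : ∀ j, (dyadicIoo (κ j) (cellIdx (m j) (κ j) (ν j))).indicator
          (fun t => cellKer (l j) ((2 : ℝ) ^ κ j) (cellIdx (m j) (κ j) (ν j)) (x j) t) (y j) =
          cellKer (l j) ((2 : ℝ) ^ κ j) (cellIndex m κ ν j) (x j) (y j) := fun j =>
        Set.indicator_of_mem (show y j ∈ dyadicIoo _ _ from hy j) _
      simp only [this, dyadicBspline]; ring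
    · rw [Set.indicator_of_notMem hy, zero_mul, ← Finset.prod_mul_distrib]
      have : ∃ j, y j ∉ dyadicIoo (κ j) (cellIdx (m j) (κ j) (ν j)) := by
        by_contra hc
        push Not at hc
        exact hy fun j => hc j
      obtain ⟨j, hj⟩ := this
      rw [Finset.prod_eq_zero (Finset.mem_univ j) (by
        rw [Set.indicator_of_notMem hj, mul_zero])]
      simp
  have hQm : ∀ ν, MeasurableSet (Q ν) := fun ν => (isOpen_cell _ _).measurableSet
  have hp : ∀ j, (0 : ℝ) < 2 ^ κ j := fun j => by positivity
  have hfQ : ∀ ν ∈ S, IntegrableOn f (Q ν) := fun ν hν => hf.mono_set (cell_subset_unitCube hν)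
  have hi : ∀ ν ∈ S, IntegrableOn (fun y => (∏ j, cellKer (l j) ((2 : ℝ) ^ κ j)
      (cellIndex m κ ν j) (x j) (y j)) * f y) (Q ν) := fun ν hν => by
    refine (hfQ ν hν).continuousOn_mul_of_subset (K := Set.Icc
      (fun j => ((2 : ℝ) ^ κ j)⁻¹ * cellIndex m κ ν j)
      ((fun j => ((2 : ℝ) ^ κ j)⁻¹ * cellIndex m κ ν j) + fun j => ((2 : ℝ) ^ κ j)⁻¹)) ?_
      isCompact_Icc (hQm ν) (fun x hx => ⟨fun j => (hx j).1.le, fun j => (hx j).2.le⟩)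
    exact (continuous_finsetProd _ fun j _ =>
      (continuous_cellKer_right _ _ _ _).comp (continuous_apply j)).continuousOn
  simp only [e1]
  rw [integral_finsetSum]
  · refine Finset.sum_congr rfl fun ν hν => ?_
    rw [integral_mul_const, integral_indicator (hQm ν), Measure.restrict_restrict (hQm ν),
      Set.inter_eq_left.2 (cell_subset_unitCube hν)]
    congr 1
    exact polyProj_eq_integral (s := fun j => (2 : ℝ) ^ κ j)
      (n := fun j => ((cellIndex m κ ν j : ℤ) : ℝ)) hl hp (hfQ ν hν) x
  · intro ν hν
    refine Integrable.mul_const ?_ _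
    exact ((integrable_indicator_iff (hQm ν)).2 (hi ν hν)).integrableOn

/-- The kernel of the weak derivative of order `a` of the mixed operator. -/
def tensorKer (l m a κ : Fin d → ℕ) (x y : Fin d → ℝ) : ℝ :=
  ∏ j, diffKer (l j) (m j) (a j) (κ j) (x j) (y j)

theorem exists_abs_prod_splineKer_le (l m κ : Fin d → ℕ) :
    ∃ B, ∀ x y : Fin d → ℝ, |∏ j, splineKer (l j) (m j) 0 (κ j) (x j) (y j)| ≤ B := by
  choose C hC0 hC using fun j => exists_abs_splineKer_le (l j) (m j) 0
  refine ⟨∏ j, (C j * ((2 : ℝ) ^ κ j) ^ (0 + 1)), fun x y => ?_⟩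
  rw [Finset.abs_prod]
  exact Finset.prod_le_prod (fun j _ => abs_nonneg _) fun j _ => hC j _ _ _

theorem measurable_prod_splineKer (l m κ : Fin d → ℕ) :
    Measurable fun z : (Fin d → ℝ) × (Fin d → ℝ) =>
      ∏ j, splineKer (l j) (m j) 0 (κ j) (z.1 j) (z.2 j) := by
  refine Finset.measurable_fun_prod _ fun j _ => ?_
  have h : Measurable fun z : (Fin d → ℝ) × (Fin d → ℝ) => (z.1 j, z.2 j) := by fun_prop
  have h2 := (measurable_splineKer (l := l j) (m := m j) (a := 0) (κ := κ j)).comp h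
  exact h2

theorem diffKer_eq_sum (l m a κ : ℕ) (x y : ℝ) : diffKer l m a κ x y =
    ∑ ε ∈ (Finset.Iic 1).filter (fun ε => ε ≠ 0 → κ ≠ 0),
      (-1 : ℝ) ^ ε * splineKer l m a (κ - ε) x y := by
  have h1 : (Finset.Iic 1 : Finset ℕ) = {0, 1} := by decide
  by_cases hκ : κ = 0
  · have : (Finset.Iic 1).filter (fun ε => ε ≠ 0 → κ ≠ 0) = {0} := by
      rw [h1]; ext ε; simp [hκ]; omega
    rw [this]; simp [diffKer, hκ]
  · have : (Finset.Iic 1).filter (fun ε => ε ≠ 0 → κ ≠ 0) = {0, 1} := by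
      rw [h1]; ext ε; simp [hκ]
    rw [this]; simp [diffKer, hκ]; ring

/-- The restriction on `ε` acts in each coordinate separately, so the alternating sum of product
kernels factors into univariate differences, with nothing subtracted where `κ_j = 0`. -/
theorem mixedApproxOp_eq_integral (hl : ∀ j, 1 ≤ l j) (κ : Fin d → ℕ)
    (hf : IntegrableOn f (unitCube d)) (x : Fin d → ℝ) :
    mixedApproxOp (fun j => l j - 1) m κ f x =
      ∫ y in unitCube d, tensorKer l m 0 κ x y * f y := by
  have hs : (Finset.Iic (1 : Fin d → ℕ)).filter (fun ε => ∀ j, ε j ≠ 0 → κ j ≠ 0) =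
      Fintype.piFinset fun j => (Finset.Iic 1).filter (fun ε => ε ≠ 0 → κ j ≠ 0) := by
    ext ε
    simp only [Finset.mem_filter, Finset.mem_Iic, Fintype.mem_piFinset, Pi.le_def, Pi.one_apply,
      forall_and]
  have e1 : ∀ y, tensorKer l m 0 κ x y * f y =
      ∑ ε ∈ (Finset.Iic (1 : Fin d → ℕ)).filter (fun ε => ∀ j, ε j ≠ 0 → κ j ≠ 0),
        (-1 : ℝ) ^ (∑ j, ε j) *
          ((∏ j, splineKer (l j) (m j) 0 (κ j - ε j) (x j) (y j)) * f y) := fun y => by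
    simp only [tensorKer, diffKer_eq_sum, Finset.prod_univ_sum, hs, Finset.sum_mul]
    refine Finset.sum_congr rfl fun ε _ => ?_
    rw [Finset.prod_mul_distrib, Finset.prod_pow_eq_pow_sum, mul_assoc]
    rfl
  simp only [e1]
  rw [integral_finsetSum]
  · refine Finset.sum_congr rfl fun ε _ => ?_
    rw [integral_const_mul, approxOp_eq_integral hl _ hf]
  · intro ε _
    obtain ⟨B, hB⟩ := exists_abs_prod_splineKer_le l m fun j => κ j - ε j
    refine Integrable.const_mul (Integrable.bdd_mul (c := B) hf ?_ (ae_of_all _ fun y => hB x y)) _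
    have h : Measurable fun y : Fin d → ℝ => (x, y) := by fun_prop
    have h2 := (measurable_prod_splineKer l m fun j => κ j - ε j).comp h
    exact h2.aestronglyMeasurable

end Operators

/-! ### Classical derivatives of test functions -/

section TestFunctions

variable {d : ℕ}

theorem contDiff_partialDeriv {φ : (Fin d → ℝ) → ℝ} (hφ : ContDiff ℝ ∞ φ) (j : Fin d) :
    ContDiff ℝ ∞ (partialDeriv j φ) :=
  (hφ.fderiv_right (m := ∞) (by simp)).clm_apply contDiff_const

theorem tsupport_partialDeriv_subset (φ : (Fin d → ℝ) → ℝ) (j : Fin d) :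
    tsupport (partialDeriv j φ) ⊆ tsupport φ :=
  tsupport_fderiv_apply_subset ℝ _

theorem contDiff_partialDeriv_iterate {φ : (Fin d → ℝ) → ℝ} (hφ : ContDiff ℝ ∞ φ) (j : Fin d)
    (a : ℕ) : ContDiff ℝ ∞ ((partialDeriv j)^[a] φ) := by
  induction a with
  | zero => exact hφ
  | succ a ih => rw [Function.iterate_succ_apply']; exact contDiff_partialDeriv ih j

theorem tsupport_partialDeriv_iterate_subset (φ : (Fin d → ℝ) → ℝ) (j : Fin d) (a : ℕ) :
    tsupport ((partialDeriv j)^[a] φ) ⊆ tsupport φ := by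
  induction a with
  | zero => exact subset_rfl
  | succ a ih =>
    rw [Function.iterate_succ_apply']; exact (tsupport_partialDeriv_subset _ j).trans ih

/-- The derivatives of the orders prescribed by `a` in the coordinates listed in `L`. -/
def listDeriv (a : Fin d → ℕ) (L : List (Fin d)) (φ : (Fin d → ℝ) → ℝ) : (Fin d → ℝ) → ℝ :=
  L.foldr (fun j ψ => (partialDeriv j)^[a j] ψ) φ

theorem multiDeriv_eq_listDeriv (a : Fin d → ℕ) (φ : (Fin d → ℝ) → ℝ) :
    multiDeriv a φ = listDeriv a (List.finRange d) φ := rfl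

theorem contDiff_listDeriv {φ : (Fin d → ℝ) → ℝ} (hφ : ContDiff ℝ ∞ φ) (a : Fin d → ℕ)
    (L : List (Fin d)) : ContDiff ℝ ∞ (listDeriv a L φ) := by
  induction L with
  | nil => exact hφ
  | cons j L ih => exact contDiff_partialDeriv_iterate ih j (a j)

theorem tsupport_listDeriv_subset (φ : (Fin d → ℝ) → ℝ) (a : Fin d → ℕ) (L : List (Fin d)) :
    tsupport (listDeriv a L φ) ⊆ tsupport φ := by
  induction L with
  | nil => exact subset_rfl
  | cons j L ih => exact (tsupport_partialDeriv_iterate_subset _ j (a j)).trans ih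

theorem hasCompactSupport_listDeriv {φ : (Fin d → ℝ) → ℝ} (hc : HasCompactSupport φ)
    (a : Fin d → ℕ) (L : List (Fin d)) : HasCompactSupport (listDeriv a L φ) :=
  hc.of_isClosed_subset (isClosed_tsupport _) (tsupport_listDeriv_subset φ a L)

theorem hasDerivAt_slice {φ : (Fin d → ℝ) → ℝ} (hφ : ContDiff ℝ ∞ φ) (x : Fin d → ℝ) (j : Fin d)
    (t : ℝ) : HasDerivAt (fun t => φ (Function.update x j t))
      (partialDeriv j φ (Function.update x j t)) t :=
  ((hφ.differentiable (by simp)) _).hasFDerivAt.comp_hasDerivAt t (hasDerivAt_update x j t)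

theorem iteratedDeriv_slice {φ : (Fin d → ℝ) → ℝ} (hφ : ContDiff ℝ ∞ φ) (x : Fin d → ℝ)
    (j : Fin d) (a : ℕ) : iteratedDeriv a (fun t => φ (Function.update x j t)) =
      fun t => (partialDeriv j)^[a] φ (Function.update x j t) := by
  induction a with
  | zero => simp
  | succ a ih =>
    rw [iteratedDeriv_succ, ih]
    funext t
    rw [Function.iterate_succ_apply']
    exact (hasDerivAt_slice (contDiff_partialDeriv_iterate hφ j a) x j t).deriv

theorem hasCompactSupport_slice {φ : (Fin d → ℝ) → ℝ} (hc : HasCompactSupport φ) (x : Fin d → ℝ)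
    (j : Fin d) : HasCompactSupport fun t => φ (Function.update x j t) := by
  refine HasCompactSupport.intro (K := (fun z : Fin d → ℝ => z j) '' tsupport φ)
    (IsCompact.image hc (continuous_apply j)) fun t ht => ?_
  by_contra h
  exact ht ⟨Function.update x j t, subset_tsupport _ h, by simp⟩

theorem contDiff_slice {φ : (Fin d → ℝ) → ℝ} (hφ : ContDiff ℝ ∞ φ) (x : Fin d → ℝ) (j : Fin d) :
    ContDiff ℝ ∞ fun t => φ (Function.update x j t) :=
  hφ.comp (contDiff_update _ x j)

theorem integral_mul_partialDeriv_iterate {a : ℕ} {u w : ℝ → ℝ} (h : HasWeakDeriv a u w)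
    (hu : Measurable u) (hw : Measurable w) {B : ℝ} (huB : ∀ t, |u t| ≤ B) (hwB : ∀ t, |w t| ≤ B)
    (j : Fin d) {R : (Fin d → ℝ) → ℝ} (hR : Measurable R) {C : ℝ} (hRC : ∀ x, |R x| ≤ C)
    (hRj : ∀ x t, R (Function.update x j t) = R x) {φ : (Fin d → ℝ) → ℝ} (hφ : ContDiff ℝ ∞ φ)
    (hc : HasCompactSupport φ) :
    ∫ x, (u (x j) * R x) * (partialDeriv j)^[a] φ x =
      (-1) ^ a * ∫ x, (w (x j) * R x) * φ x := by
  obtain ⟨n, rfl⟩ : ∃ n, d = n + 1 := ⟨d - 1, by have := j.pos; omega⟩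
  have hint : ∀ (v : ℝ → ℝ), Measurable v → (∀ t, |v t| ≤ B) → ∀ χ : (Fin (n + 1) → ℝ) → ℝ,
      Continuous χ → HasCompactSupport χ → Integrable fun x => (v (x j) * R x) * χ x := by
    intro v hv hvB χ hχ hχc
    refine (hχ.integrable_of_hasCompactSupport hχc).bdd_mul (c := B * C)
      ((hv.comp (measurable_pi_apply j)).mul hR).aestronglyMeasurable (ae_of_all _ fun x => ?_)
    rw [norm_mul]
    exact mul_le_mul (hvB _) (hRC x) (norm_nonneg _) ((abs_nonneg _).trans (hvB 0))
  have hsplit : ∀ F : (Fin (n + 1) → ℝ) → ℝ, Integrable F →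
      ∫ x, F x = ∫ z : Fin n → ℝ, ∫ t : ℝ, F (Function.update (j.insertNth 0 z : Fin (n + 1) → ℝ) j t) := by
    intro F hF
    have mp := (volume_preserving_piFinSuccAbove (fun _ : Fin (n + 1) => ℝ) j).symm
    rw [← mp.integral_comp' F]
    have hF' : Integrable (fun p => F ((MeasurableEquiv.piFinSuccAbove (fun _ => ℝ) j).symm p))
        ((volume : Measure ℝ).prod (volume : Measure (Fin n → ℝ))) :=
      (mp.integrable_comp_emb (MeasurableEquiv.measurableEmbedding _)).2 hF
    rw [show (volume : Measure (ℝ × (Fin n → ℝ))) = (volume : Measure ℝ).prod volume from rfl,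
      integral_prod_symm _ hF']
    congr 1 with z; congr 1 with t; congr 1
    simp [MeasurableEquiv.piFinSuccAbove, Fin.insertNthEquiv]
  have c1 := contDiff_partialDeriv_iterate hφ j a
  have c2 : HasCompactSupport ((partialDeriv j)^[a] φ) :=
    hc.of_isClosed_subset (isClosed_tsupport _) (tsupport_partialDeriv_iterate_subset φ j a)
  rw [hsplit _ (hint u hu huB _ c1.continuous c2), hsplit _ (hint w hw hwB _ hφ.continuous hc),
    ← integral_const_mul]
  congr 1 with z
  simp only [hRj, Function.update_self]
  have key := h _ (contDiff_slice hφ (j.insertNth 0 z) j) (hasCompactSupport_slice hc _ j)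
  rw [iteratedDeriv_slice hφ] at key
  have e1 : ∀ (v : ℝ → ℝ) (g : ℝ → ℝ), ∫ t, v t * R (j.insertNth 0 z) * g t =
      R (j.insertNth 0 z) * ∫ t, v t * g t := fun v g => by
    rw [← integral_const_mul]; congr 1 with t; ring
  rw [e1, e1, key]; ring

theorem integral_prod_mul_multiDeriv {a : Fin d → ℕ} {u w : Fin d → ℝ → ℝ}
    (h : ∀ j, HasWeakDeriv (a j) (u j) (w j)) (hu : ∀ j, Measurable (u j))
    (hw : ∀ j, Measurable (w j)) {B : ℝ} (huB : ∀ j t, |u j t| ≤ B) (hwB : ∀ j t, |w j t| ≤ B)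
    {φ : (Fin d → ℝ) → ℝ} (hφ : ContDiff ℝ ∞ φ) (hc : HasCompactSupport φ) :
    ∫ x, (∏ j, u j (x j)) * multiDeriv a φ x =
      (-1) ^ (∑ j, a j) * ∫ x, (∏ j, w j (x j)) * φ x := by
  classical
  -- Coordinates are processed one at a time: those in `L` still carry `u`, the others already carry
  -- their weak derivative `w`.
  have main : ∀ L : List (Fin d), L.Nodup →
      ∫ x, (∏ j, (if j ∈ L then u j else w j) (x j)) * listDeriv a L φ x =
        (-1) ^ (L.map a).sum * ∫ x, (∏ j, w j (x j)) * φ x := by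
    intro L
    induction L with
    | nil => intro _; simp [listDeriv]
    | cons j L ih =>
      intro hL
      obtain ⟨hj, hL'⟩ := List.nodup_cons.1 hL
      set v : Fin d → ℝ → ℝ := fun i => if i ∈ L then u i else w i with hv
      have hvm : ∀ i, Measurable (v i) := fun i => by
        simp only [hv]; split_ifs; exacts [hu i, hw i]
      have hvB : ∀ i t, |v i t| ≤ B := fun i t => by
        simp only [hv]; split_ifs; exacts [huB i t, hwB i t]
      set R : (Fin d → ℝ) → ℝ := fun x => ∏ i ∈ Finset.univ.erase j, v i (x i) with hR
      have e1 : ∀ x, ∏ i, (if i ∈ j :: L then u i else w i) (x i) = u j (x j) * R x := fun x => by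
        rw [← Finset.mul_prod_erase _ _ (Finset.mem_univ j)]
        congr 1
        · simp
        · refine Finset.prod_congr rfl fun i hi => ?_
          have : i ≠ j := Finset.ne_of_mem_erase hi
          simp [hv, this]
      have e2 : ∀ x, ∏ i, v i (x i) = w j (x j) * R x := fun x => by
        rw [← Finset.mul_prod_erase _ _ (Finset.mem_univ j)]
        simp [hv, hj, hR]
      have hRm : Measurable R :=
        Finset.measurable_fun_prod _ fun i _ => (hvm i).comp (measurable_pi_apply i)
      have hRC : ∀ x, |R x| ≤ ∏ i ∈ Finset.univ.erase j, B := fun x => by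
        rw [hR, Finset.abs_prod]
        exact Finset.prod_le_prod (fun i _ => abs_nonneg _) fun i _ => hvB i _
      have hRj : ∀ x t, R (Function.update x j t) = R x := fun x t => by
        refine Finset.prod_congr rfl fun i hi => ?_
        rw [Function.update_of_ne (Finset.ne_of_mem_erase hi)]
      have step := integral_mul_partialDeriv_iterate (h j) (hu j) (hw j) (huB j) (hwB j) j hRm hRC
        hRj (contDiff_listDeriv hφ a L) (hasCompactSupport_listDeriv hc a L)
      have ih' : ∫ x, (w j (x j) * R x) * listDeriv a L φ x =
          (-1) ^ (L.map a).sum * ∫ x, (∏ j, w j (x j)) * φ x := by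
        rw [← ih hL']
        refine integral_congr_ae (ae_of_all _ fun x => ?_)
        have e3 := e2 x
        simp only [← e3, hv]
      rw [ih'] at step
      rw [List.map_cons, List.sum_cons, pow_add, mul_assoc, ← step]
      refine integral_congr_ae (ae_of_all _ fun x => ?_)
      have e3 := e1 x
      simp only [e3]
      rfl
  have := main (List.finRange d) (List.nodup_finRange d)
  simp only [List.mem_finRange, if_true] at this
  rw [show (∑ j, a j) = ((List.finRange d).map a).sum by rw [← List.ofFn_eq_map, List.sum_ofFn]]
  exact this

end TestFunctions

/-! ### Generalized derivatives of the operators -/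

section WeakDeriv

variable {d : ℕ} {l m a κ : Fin d → ℕ} {f : (Fin d → ℝ) → ℝ}

theorem measurable_tensorKer : Measurable fun z : (Fin d → ℝ) × (Fin d → ℝ) =>
    tensorKer l m a κ z.1 z.2 := by
  refine Finset.measurable_fun_prod _ fun j _ => ?_
  have h : Measurable fun z : (Fin d → ℝ) × (Fin d → ℝ) => (z.1 j, z.2 j) := by fun_prop
  have h2 := (measurable_diffKer (l := l j) (m := m j) (a := a j) (κ := κ j)).comp h
  exact h2

theorem exists_abs_tensorKer_le (l m a κ : Fin d → ℕ) :
    ∃ B, ∀ x y : Fin d → ℝ, |tensorKer l m a κ x y| ≤ B := by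
  choose C hC0 hC using fun j => exists_abs_diffKer_le (l j) (m j) (a j)
  refine ⟨∏ j, (C j * ((2 : ℝ) ^ κ j) ^ (a j + 1)), fun x y => ?_⟩
  rw [tensorKer, Finset.abs_prod]
  exact Finset.prod_le_prod (fun j _ => abs_nonneg _) fun j _ => hC j _ _ _

/-- The weak derivative of order `a` of the mixed operator applied to `f`. -/
def tensorOp (l m a κ : Fin d → ℕ) (f : (Fin d → ℝ) → ℝ) (x : Fin d → ℝ) : ℝ :=
  ∫ y in unitCube d, tensorKer l m a κ x y * f y

theorem measurableSet_unitCube (d : ℕ) : MeasurableSet (unitCube d) := by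
  have : unitCube d = cell 0 1 := by ext x; simp [unitCube, cell]
  rw [this]; exact (isOpen_cell _ _).measurableSet

theorem aestronglyMeasurable_kernel_mul {T : (Fin d → ℝ) → (Fin d → ℝ) → ℝ}
    (hT : Measurable fun z : (Fin d → ℝ) × (Fin d → ℝ) => T z.1 z.2)
    (hf : IntegrableOn f (unitCube d)) :
    AEStronglyMeasurable (fun z : (Fin d → ℝ) × (Fin d → ℝ) => T z.1 z.2 * f z.2)
      ((volume : Measure (Fin d → ℝ)).prod (volume.restrict (unitCube d))) :=
  hT.aestronglyMeasurable.mul hf.aestronglyMeasurable.comp_snd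

theorem aestronglyMeasurable_tensorOp (hf : IntegrableOn f (unitCube d)) :
    AEStronglyMeasurable (tensorOp l m a κ f) volume :=
  (aestronglyMeasurable_kernel_mul measurable_tensorKer hf).integral_prod_right'

theorem exists_abs_tensorOp_le (hf : IntegrableOn f (unitCube d)) (l m a κ : Fin d → ℕ) :
    ∃ B, ∀ x, |tensorOp l m a κ f x| ≤ B := by
  obtain ⟨B, hB⟩ := exists_abs_tensorKer_le l m a κ
  refine ⟨∫ y in unitCube d, B * ‖f y‖, fun x => ?_⟩
  have h : ∀ y, ‖tensorKer l m a κ x y * f y‖ ≤ B * ‖f y‖ := fun y => by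
    rw [norm_mul]
    exact mul_le_mul_of_nonneg_right (hB x y) (norm_nonneg _)
  exact norm_integral_le_of_norm_le (Integrable.const_mul (IntegrableOn.integrable hf).norm B)
    (ae_of_all _ h)

theorem locallyIntegrable_tensorOp (hf : IntegrableOn f (unitCube d)) (l m a κ : Fin d → ℕ) :
    LocallyIntegrable (tensorOp l m a κ f) := by
  obtain ⟨B, hB⟩ := exists_abs_tensorOp_le hf l m a κ
  exact (locallyIntegrable_const B).mono (aestronglyMeasurable_tensorOp hf)
    (ae_of_all _ fun x => (hB x).trans (le_abs_self B))

theorem integral_tensorOp_mul (hf : IntegrableOn f (unitCube d)) {χ : (Fin d → ℝ) → ℝ}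
    (hχ : Continuous χ) (hc : HasCompactSupport χ) :
    ∫ x, tensorOp l m a κ f x * χ x =
      ∫ y in unitCube d, f y * ∫ x, tensorKer l m a κ x y * χ x := by
  obtain ⟨B, hB⟩ := exists_abs_tensorKer_le l m a κ
  simp only [tensorOp, ← integral_mul_const, ← integral_const_mul]
  rw [integral_integral_swap]
  · congr 1 with y; congr 1 with x; ring
  · have h1 : Integrable (fun z : (Fin d → ℝ) × (Fin d → ℝ) => χ z.1 * f z.2)
        (volume.prod (volume.restrict (unitCube d))) :=
      (hχ.integrable_of_hasCompactSupport hc).mul_prod hf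
    have h2 := h1.bdd_mul (c := B)
      (measurable_tensorKer (l := l) (m := m) (a := a) (κ := κ)).aestronglyMeasurable
      (ae_of_all _ fun z => hB z.1 z.2)
    refine h2.congr (ae_of_all _ fun z => ?_)
    simp only [Function.uncurry]; ring

/-- Fubini's theorem brings the test function inside; for each fixed `y` the claim is about a
product of univariate kernels in `x`. -/
theorem integral_tensorOp_mul_multiDeriv (ha : a ≤ m) (hf : IntegrableOn f (unitCube d))
    {φ : (Fin d → ℝ) → ℝ} (hφ : ContDiff ℝ ∞ φ) (hc : HasCompactSupport φ) :
    ∫ x, tensorOp l m 0 κ f x * multiDeriv a φ x =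
      (-1) ^ (∑ j, a j) * ∫ x, tensorOp l m a κ f x * φ x := by
  choose C hC0 hC using fun j => exists_abs_diffKer_le (l j) (m j) (a j)
  choose C' hC0' hC' using fun j => exists_abs_diffKer_le (l j) (m j) 0
  set B : ℝ := ∑ j, (C j * ((2 : ℝ) ^ κ j) ^ (a j + 1) + C' j * ((2 : ℝ) ^ κ j) ^ (0 + 1)) with hB
  have hterm : ∀ j, C j * ((2 : ℝ) ^ κ j) ^ (a j + 1) + C' j * ((2 : ℝ) ^ κ j) ^ (0 + 1) ≤ B :=
    fun j => Finset.single_le_sum (f := fun j => C j * ((2 : ℝ) ^ κ j) ^ (a j + 1) +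
      C' j * ((2 : ℝ) ^ κ j) ^ (0 + 1)) (fun i _ => add_nonneg
        (mul_nonneg (hC0 i) (by positivity)) (mul_nonneg (hC0' i) (by positivity)))
      (Finset.mem_univ j)
  rw [multiDeriv_eq_listDeriv, integral_tensorOp_mul hf (contDiff_listDeriv hφ a (List.finRange d)).continuous
    (hasCompactSupport_listDeriv hc a (List.finRange d)), integral_tensorOp_mul hf hφ.continuous hc,
    ← integral_const_mul]
  congr 1 with y
  have key := integral_prod_mul_multiDeriv (a := a)
    (u := fun j t => diffKer (l j) (m j) 0 (κ j) t (y j))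
    (w := fun j t => diffKer (l j) (m j) (a j) (κ j) t (y j))
    (fun j => hasWeakDeriv_diffKer (ha j) (y j)) (fun j => measurable_diffKer_left _)
    (fun j => measurable_diffKer_left _) (B := B)
    (fun j t => (hC' j (κ j) t (y j)).trans (le_trans (le_add_of_nonneg_left
      (mul_nonneg (hC0 j) (by positivity))) (hterm j)))
    (fun j t => (hC j (κ j) t (y j)).trans (le_trans (le_add_of_nonneg_right
      (mul_nonneg (hC0' j) (by positivity))) (hterm j))) hφ hc
  change f y * ∫ x, (∏ j, diffKer (l j) (m j) 0 (κ j) (x j) (y j)) * multiDeriv a φ x = _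
  rw [key]
  simp only [tensorKer]
  ring

theorem isGeneralizedDeriv_mixedApproxOp (hl : ∀ j, 1 ≤ l j) (ha : a ≤ m)
    (hf : IntegrableOn f (unitCube d)) :
    IsGeneralizedDeriv (unitCube d) a (mixedApproxOp (fun j => l j - 1) m κ f)
      (tensorOp l m a κ f) := by
  have e : mixedApproxOp (fun j => l j - 1) m κ f = tensorOp l m 0 κ f :=
    funext fun x => mixedApproxOp_eq_integral hl κ hf x
  rw [e]
  refine ⟨(locallyIntegrable_tensorOp hf l m 0 κ).locallyIntegrableOn _,
    (locallyIntegrable_tensorOp hf l m a κ).locallyIntegrableOn _, fun φ hφ hc hs => ?_⟩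
  have hset : ∀ (g χ : (Fin d → ℝ) → ℝ), tsupport χ ⊆ tsupport φ →
      ∫ x in unitCube d, g x * χ x = ∫ x, g x * χ x := fun g χ hχ =>
    setIntegral_eq_integral_of_forall_compl_eq_zero fun x hx => by
      rw [image_eq_zero_of_notMem_tsupport fun h => hx (hs (hχ h)), mul_zero]
  rw [multiDeriv_eq_listDeriv, hset _ _ (tsupport_listDeriv_subset φ a (List.finRange d)), hset _ _ subset_rfl]
  exact integral_tensorOp_mul_multiDeriv ha hf hφ hc

end WeakDeriv

/-! ### Product kernels as averages of mixed differences -/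

/-- `K` represents the kernel `k` as an average of differences of order `l` with steps at most
`ρ`, with all nodes in `(α, β)`. -/
structure IsDiffKernel (l : ℕ) (α β C ρ : ℝ) (k : ℝ → ℝ) (K : ℝ → ℝ → ℝ) : Prop where
  measurable : Measurable (Function.uncurry K)
  abs_le : ∀ y ξ, |K y ξ| ≤ C
  support : ∀ y ξ, K y ξ ≠ 0 → y ∈ Set.Ioo α β ∧ y + l * ξ ∈ Set.Ioo α β ∧ |ξ| ≤ ρ
  integral_eq : ∀ y, ∫ ξ, (fwdDiff (-ξ))^[l] (fun z => K z ξ) y = k y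

theorem IsDiffRep.exists_isDiffKernel {l : ℕ} (hl : 1 ≤ l) {α β C ρ : ℝ} {k : ℝ → ℝ}
    (h : IsDiffRep l α β C k) (hρ : β - α ≤ ρ) : ∃ K, IsDiffKernel l α β C ρ k K := by
  obtain ⟨K, h1, h2, h3, h4⟩ := h
  exact ⟨K, h1, h2, fun y ξ hy => ⟨(h3 y ξ hy).1, (h3 y ξ hy).2,
    (abs_lt_of_mem_Ioo_of_mem_Ioo hl (h3 y ξ hy).1 (h3 y ξ hy).2).le.trans hρ⟩, h4⟩

theorem exists_isDiffKernel_zero {α β C ρ : ℝ} (hC0 : 0 ≤ C) {k : ℝ → ℝ} (hm : Measurable k)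
    (hC : ∀ y, |k y| ≤ C) (hs : ∀ y, k y ≠ 0 → y ∈ Set.Ioo α β) (hρ : 1 ≤ ρ) :
    ∃ K, IsDiffKernel 0 α β C ρ k K := by
  have hz : ∀ y ξ, k y * (Set.Ioo (0 : ℝ) 1).indicator (fun _ => (1 : ℝ)) ξ ≠ 0 →
      k y ≠ 0 ∧ ξ ∈ Set.Ioo (0 : ℝ) 1 := fun y ξ h =>
    ⟨left_ne_zero_of_mul h, by
      by_contra h'
      exact right_ne_zero_of_mul h (Set.indicator_of_notMem h' _)⟩
  refine ⟨fun y ξ => k y * (Set.Ioo (0 : ℝ) 1).indicator (fun _ => (1 : ℝ)) ξ, ?_, ?_, ?_, ?_⟩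
  · exact (hm.comp measurable_fst).mul
      ((measurable_const.indicator measurableSet_Ioo).comp measurable_snd)
  · intro y ξ
    by_cases h : ξ ∈ Set.Ioo (0 : ℝ) 1
    · rw [Set.indicator_of_mem h, mul_one]; exact hC y
    · rw [Set.indicator_of_notMem h, mul_zero, abs_zero]; exact hC0
  · intro y ξ h
    obtain ⟨h1, h2⟩ := hz y ξ h
    refine ⟨hs y h1, by simpa using hs y h1, ?_⟩
    rw [abs_of_pos h2.1]; exact h2.2.le.trans hρ
  · intro y
    simp only [Function.iterate_zero, id_eq]
    rw [integral_const_mul, integral_indicator measurableSet_Ioo]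
    simp

section Product

variable {d : ℕ} {l : Fin d → ℕ} {α β C ρ : Fin d → ℝ} {k : Fin d → ℝ → ℝ}
  {K : Fin d → ℝ → ℝ → ℝ}

theorem Iic_eq_piFinset (l : Fin d → ℕ) :
    Finset.Iic l = Fintype.piFinset fun j => Finset.range (l j + 1) := by
  ext i
  simp [Pi.le_def]

theorem measurable_prod_kernel (hK : ∀ j, Measurable (Function.uncurry (K j)))
    (i : Fin d → ℕ) : Measurable fun z : (Fin d → ℝ) × (Fin d → ℝ) =>
      ∏ j, K j (z.2 j - i j * z.1 j) (z.1 j) := by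
  refine Finset.measurable_fun_prod _ fun j _ => ?_
  have h : Measurable fun z : (Fin d → ℝ) × (Fin d → ℝ) => (z.2 j - i j * z.1 j, z.1 j) := by
    fun_prop
  have h2 := (hK j).comp h
  exact h2

theorem measurable_mixedDiff {f : (Fin d → ℝ) → ℝ} (hf : Measurable f) (l : Fin d → ℕ) :
    Measurable fun z : (Fin d → ℝ) × (Fin d → ℝ) => mixedDiff z.1 l f z.2 := by
  refine Finset.measurable_fun_sum _ fun i _ => Measurable.const_mul ?_ _
  have h : Measurable fun z : (Fin d → ℝ) × (Fin d → ℝ) => fun j => z.2 j + i j * z.1 j := by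
    fun_prop
  exact hf.comp h

/-- Summation by parts in all coordinates: each node is translated separately, over the whole space,
so there are no boundary terms. -/
theorem integral_prod_kernel_mul_mixedDiff
    (hK : ∀ j, IsDiffKernel (l j) (α j) (β j) (C j) (ρ j) (k j) (K j))
    {f : (Fin d → ℝ) → ℝ} (hfi : Integrable f) (ξ : Fin d → ℝ) :
    ∫ y, (∏ j, K j (y j) (ξ j)) * mixedDiff ξ l f y =
      ∫ y, (∏ j, (fwdDiff (-(ξ j)))^[l j] (fun z => K j z (ξ j)) (y j)) * f y := by
  have hC : ∀ y : Fin d → ℝ, |∏ j, K j (y j) (ξ j)| ≤ ∏ j, C j := fun y => by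
    rw [Finset.abs_prod]
    exact Finset.prod_le_prod (fun j _ => abs_nonneg _) fun j _ => (hK j).abs_le _ _
  have hKm : ∀ i : Fin d → ℕ, Measurable fun y : Fin d → ℝ => ∏ j, K j (y j - i j * ξ j) (ξ j) :=
    fun i => (measurable_prod_kernel (fun j => (hK j).measurable) i).comp measurable_prodMk_left
  set c : (Fin d → ℕ) → ℝ := fun i => ∏ j, (-1 : ℝ) ^ (l j - i j) * ((l j).choose (i j) : ℝ)
    with hc
  have hi0 : ∀ i : Fin d → ℕ, Integrable fun y : Fin d → ℝ =>
      (∏ j, K j (y j - i j * ξ j) (ξ j)) * f y := fun i =>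
    hfi.bdd_mul (c := ∏ j, C j) (hKm i).aestronglyMeasurable (ae_of_all _ fun y => hC _)
  have hsh : ∀ i : Fin d → ℕ, (fun y : Fin d → ℝ => (∏ j, K j (y j) (ξ j)) *
      f (fun j => y j + i j * ξ j)) = fun y => (fun y : Fin d → ℝ =>
      (∏ j, K j (y j - i j * ξ j) (ξ j)) * f y) (y + fun j => i j * ξ j) := fun i => by
    funext y
    simp only [Pi.add_apply, add_sub_cancel_right]
    rfl
  have e1 : ∀ y, (∏ j, K j (y j) (ξ j)) * mixedDiff ξ l f y = ∑ i ∈ Finset.Iic l,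
      c i * ((∏ j, K j (y j) (ξ j)) * f (fun j => y j + i j * ξ j)) := fun y => by
    rw [mixedDiff, Finset.mul_sum]
    exact Finset.sum_congr rfl fun i _ => by ring
  have e2 : ∀ y : Fin d → ℝ, (∏ j, (fwdDiff (-(ξ j)))^[l j] (fun z => K j z (ξ j)) (y j)) * f y =
      ∑ i ∈ Finset.Iic l, c i * ((∏ j, K j (y j - i j * ξ j) (ξ j)) * f y) := fun y => by
    simp only [fwdDiff_neg_iter]
    rw [Finset.prod_univ_sum, ← Iic_eq_piFinset, Finset.sum_mul]
    refine Finset.sum_congr rfl fun i _ => ?_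
    rw [Finset.prod_mul_distrib, hc]; ring
  simp only [e1, e2]
  rw [integral_finsetSum, integral_finsetSum]
  · refine Finset.sum_congr rfl fun i _ => ?_
    rw [integral_const_mul, integral_const_mul, hsh i]
    congr 1
    exact integral_add_right_eq_self (fun y => (∏ j, K j (y j - i j * ξ j) (ξ j)) * f y) _
  · exact fun i _ => (hi0 i).const_mul _
  · intro i _
    have h := (hi0 i).comp_add_right (fun j => i j * ξ j)
    have h' : Integrable fun y : Fin d → ℝ => (∏ j, K j (y j) (ξ j)) *
        f (fun j => y j + i j * ξ j) := by rw [hsh i]; exact h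
    exact h'.const_mul _

theorem integral_prod_mul_eq_integral_mixedDiff
    (hK : ∀ j, IsDiffKernel (l j) (α j) (β j) (C j) (ρ j) (k j) (K j))
    {f : (Fin d → ℝ) → ℝ} (hfi : Integrable f) :
    ∫ y, (∏ j, k j (y j)) * f y =
      ∫ ξ : Fin d → ℝ, ∫ y, (∏ j, K j (y j) (ξ j)) * mixedDiff ξ l f y := by
  simp only [integral_prod_kernel_mul_mixedDiff hK hfi]
  have hC0 : ∀ j, 0 ≤ C j := fun j => (abs_nonneg _).trans ((hK j).abs_le 0 0)
  have hb : ∀ j (y ξ : ℝ), |(fwdDiff (-ξ))^[l j] (fun z => K j z ξ) y| ≤ 2 ^ l j * C j :=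
    fun j y ξ => abs_fwdDiff_iter_le (fun x => (hK j).abs_le _ _) _ _ _
  have hs : ∀ j (y ξ : ℝ), ξ ∉ Set.Icc (-ρ j) (ρ j) →
      (fwdDiff (-ξ))^[l j] (fun z => K j z ξ) y = 0 := fun j y ξ hξ => by
    have : ∀ z, K j z ξ = 0 := fun z => by
      by_contra h
      exact hξ (abs_le.1 ((hK j).support _ _ h).2.2)
    rw [fwdDiff_neg_iter]; simp [this]
  have hm : Measurable fun z : (Fin d → ℝ) × (Fin d → ℝ) =>
      ∏ j, (fwdDiff (-(z.1 j)))^[l j] (fun y => K j y (z.1 j)) (z.2 j) := by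
    refine Finset.measurable_fun_prod _ fun j _ => ?_
    simp only [fwdDiff_neg_iter]
    refine Finset.measurable_fun_sum _ fun i _ => Measurable.const_mul ?_ _
    have h : Measurable fun z : (Fin d → ℝ) × (Fin d → ℝ) => (z.2 j - i * z.1 j, z.1 j) := by
      fun_prop
    have h2 := (hK j).measurable.comp h
    exact h2
  rw [integral_integral_swap]
  · congr 1 with y
    rw [integral_mul_const]
    congr 1
    rw [integral_fintype_prod_volume_eq_prod
      (fun j ξ => (fwdDiff (-ξ))^[l j] (fun z => K j z ξ) (y j))]
    exact Finset.prod_congr rfl fun j _ => ((hK j).integral_eq _).symm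
  -- Integrability in `ξ` rests on the bounded range of steps.
  · set S : Set (Fin d → ℝ) := Set.univ.pi fun j => Set.Icc (-ρ j) (ρ j) with hS
    have hSm : MeasurableSet S := MeasurableSet.univ_pi fun j => measurableSet_Icc
    have hS1 : Integrable (S.indicator fun _ => (1 : ℝ)) := by
      rw [integrable_indicator_iff hSm]
      refine integrableOn_const ?_
      rw [hS, volume_pi_pi]
      exact (ENNReal.prod_lt_top fun j _ => by simp).ne
    have h1 := hS1.mul_prod hfi
    have h2 := h1.bdd_mul (c := ∏ j, (2 ^ l j * C j)) hm.aestronglyMeasurable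
      (ae_of_all _ fun z => by
        rw [Real.norm_eq_abs, Finset.abs_prod]
        exact Finset.prod_le_prod (fun j _ => abs_nonneg _) fun j _ => hb _ _ _)
    refine h2.congr (ae_of_all _ fun z => ?_)
    simp only [Function.uncurry]
    by_cases hz : z.1 ∈ S
    · rw [Set.indicator_of_mem hz, one_mul]
    · have : ∃ j, z.1 j ∉ Set.Icc (-ρ j) (ρ j) := by
        by_contra h
        exact hz fun j _ => by_contra fun hj => h ⟨j, hj⟩
      obtain ⟨j, hj⟩ := this
      rw [Finset.prod_eq_zero (Finset.mem_univ j) (hs j _ _ hj), zero_mul, zero_mul]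

end Product

/-! ### Pointwise bounds by local integrals of mixed differences. -/

section Pointwise

variable {d : ℕ} {l m a : Fin d → ℕ}

/-- The coordinates in which the level `κ` is positive. -/
def activeSet (κ : Fin d → ℕ) : Finset (Fin d) := Finset.univ.filter fun j => κ j ≠ 0

/-- The box with centre `x` and half-widths `c_j 2^{-κ_j}`. -/
def dyadicBox (κ : Fin d → ℕ) (c : Fin d → ℝ) (x : Fin d → ℝ) : Set (Fin d → ℝ) :=
  {y | ∀ j, |y j - x j| ≤ c j / 2 ^ κ j}

theorem mem_diffDomain_unitCube_of {ξ y : Fin d → ℝ} {l : Fin d → ℕ}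
    (h : ∀ j, y j ∈ Set.Ioo (0 : ℝ) 1 ∧ y j + l j * ξ j ∈ Set.Ioo (0 : ℝ) 1) :
    y ∈ diffDomain (unitCube d) ξ l := by
  refine ⟨fun j => (h j).1, fun t ht j => ?_⟩
  have := (convex_Ioo (0 : ℝ) 1) (h j).1 (h j).2 (sub_nonneg.2 (ht j).2) (ht j).1 (by ring)
  have e : (1 - t j) • y j + t j • (y j + l j * ξ j) = y j + t j * l j * ξ j := by
    simp only [smul_eq_mul]; ring
  rw [e] at this
  exact this

theorem mem_diffDomain_unitCube_iff {ξ y : Fin d → ℝ} {l : Fin d → ℕ} :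
    y ∈ diffDomain (unitCube d) ξ l ↔
      y ∈ unitCube d ∧ (fun j => y j + l j * ξ j) ∈ unitCube d := by
  refine ⟨fun h => ⟨h.1, ?_⟩, fun h => mem_diffDomain_unitCube_of fun j => ⟨h.1 j, h.2 j⟩⟩
  have := h.2 (fun _ => 1) (fun _ => ⟨zero_le_one, le_rfl⟩)
  simpa using this

theorem measurableSet_dyadicBox_prod {κ : Fin d → ℕ} {c : Fin d → ℝ} :
    MeasurableSet {z : (Fin d → ℝ) × (Fin d → ℝ) | z.2 ∈ dyadicBox κ c z.1} := by
  have : {z : (Fin d → ℝ) × (Fin d → ℝ) | z.2 ∈ dyadicBox κ c z.1} =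
      ⋂ j, {z | |z.2 j - z.1 j| ≤ c j / 2 ^ κ j} := by
    ext z; simp [dyadicBox]
  rw [this]
  exact MeasurableSet.iInter fun j => measurableSet_le (by fun_prop) measurable_const

theorem measurableSet_dyadicBox (κ : Fin d → ℕ) (c x : Fin d → ℝ) :
    MeasurableSet (dyadicBox κ c x) :=
  measurable_prodMk_left measurableSet_dyadicBox_prod

theorem measurableSet_diffDomain_prod (l : Fin d → ℕ) :
    MeasurableSet {z : (Fin d → ℝ) × (Fin d → ℝ) | z.2 ∈ diffDomain (unitCube d) z.1 l} := by
  have : {z : (Fin d → ℝ) × (Fin d → ℝ) | z.2 ∈ diffDomain (unitCube d) z.1 l} =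
      Prod.snd ⁻¹' unitCube d ∩
        (fun z : (Fin d → ℝ) × (Fin d → ℝ) => fun j => z.2 j + l j * z.1 j) ⁻¹' unitCube d := by
    ext z; exact mem_diffDomain_unitCube_iff
  rw [this]
  exact (measurableSet_preimage measurable_snd (measurableSet_unitCube d)).inter
    (measurableSet_preimage (by fun_prop) (measurableSet_unitCube d))

theorem measurableSet_diffDomain (ξ : Fin d → ℝ) (l : Fin d → ℕ) :
    MeasurableSet (diffDomain (unitCube d) ξ l) :=
  measurable_prodMk_left (measurableSet_diffDomain_prod l)

theorem tensorOp_eq_integral (κ x : Fin d → _) (f : (Fin d → ℝ) → ℝ) :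
    tensorOp l m a κ f x = ∫ y, (∏ j, diffKer (l j) (m j) (a j) (κ j) (x j) (y j)) * f y := by
  refine setIntegral_eq_integral_of_forall_compl_eq_zero fun y hy => ?_
  have : ∃ j, diffKer (l j) (m j) (a j) (κ j) (x j) (y j) = 0 := by
    by_contra! h
    exact hy fun j => (diffKer_ne_zero (h j)).1
  obtain ⟨j, hj⟩ := this
  rw [tensorKer, Finset.prod_eq_zero (Finset.mem_univ j) hj, zero_mul]

/-- A step is at most the length `2 (4m + 4) 2^{-κ}` of the interval of nodes; hence `8m + 8`, the
source of the constant in the theorem. -/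
theorem exists_isDiffKernel_diffKer {l m a : ℕ} (hl : 1 ≤ l) (ha : a ≤ m) {c : ℝ}
    (hc : 8 * m + 8 ≤ c) : ∃ C : ℝ, 0 ≤ C ∧ ∀ κ : ℕ, ∀ᵐ x : ℝ, x ∈ Set.Ioo (0 : ℝ) 1 →
      ∃ K, IsDiffKernel (if κ ≠ 0 then l else 0) (max 0 (x - (4 * m + 4) / 2 ^ κ))
        (min 1 (x + (4 * m + 4) / 2 ^ κ)) (C * ((2 : ℝ) ^ κ) ^ (a + 2)) (c / 2 ^ κ)
        (diffKer l m a κ x) K := by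
  obtain ⟨C, hC0, hC⟩ := exists_isDiffRep_diffKer hl ha
  obtain ⟨D, hD0, hD⟩ := exists_abs_diffKer_le l m a
  refine ⟨C + D, by positivity, fun κ => ?_⟩
  have hm : (0 : ℝ) ≤ m := Nat.cast_nonneg m
  by_cases hκ : κ = 0
  · subst hκ
    refine ae_of_all _ fun x hx => ?_
    simp only [ne_eq, not_true_eq_false, if_false]
    refine exists_isDiffKernel_zero (by positivity) (measurable_diffKer_right x)
      (fun y => ?_) (fun y hy => ?_) (by simp; linarith)
    · have := hD 0 x y
      simp only [pow_zero, one_pow, mul_one] at this ⊢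
      linarith
    · obtain ⟨h1, h2⟩ := diffKer_ne_zero hy
      simp only [pow_zero, one_mul, div_one] at h2 ⊢
      rw [abs_lt] at h2
      exact ⟨max_lt h1.1 (by linarith), lt_min h1.2 (by linarith)⟩
  · filter_upwards [hC κ (by omega)] with x hx hx'
    rw [if_pos hκ]
    refine IsDiffRep.exists_isDiffKernel hl ((hx hx').mono ?_) ?_
    · gcongr; linarith
    · have h1 := le_max_right 0 (x - (4 * m + 4) / 2 ^ κ)
      have h2 := min_le_right 1 (x + (4 * m + 4) / 2 ^ κ)
      have h3 : 2 * ((4 * (m : ℝ) + 4) / 2 ^ κ) ≤ c / 2 ^ κ := by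
        rw [← mul_div_assoc]; gcongr; linarith
      linarith

/-- The product representation combined with the sup bound and the support of the kernels. Both
endpoints of every chain of nodes lie in `(0,1)`, and convexity puts `y` into the domain of the
difference. -/
theorem exists_enorm_tensorOp_le (hl : ∀ j, 1 ≤ l j) (ha : a ≤ m) {c : ℝ}
    (hc : ∀ j, 8 * (m j : ℝ) + 8 ≤ c) : ∃ C : ℝ, 0 ≤ C ∧ ∀ (κ : Fin d → ℕ) (f : (Fin d → ℝ) → ℝ),
      Integrable f → ∀ᵐ x : Fin d → ℝ, x ∈ unitCube d →
        ‖tensorOp l m a κ f x‖ₑ ≤ ENNReal.ofReal (C * ∏ j, ((2 : ℝ) ^ κ j) ^ (a j + 2)) *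
          ∫⁻ ξ in dyadicBox κ (fun _ => c) 0,
            ∫⁻ y in diffDomain (unitCube d) ξ (restrictIndex (activeSet κ) l) ∩
              dyadicBox κ (fun j => 4 * m j + 4) x,
              ‖mixedDiff ξ (restrictIndex (activeSet κ) l) f y‖ₑ := by
  choose C hC0 hC using fun j => exists_isDiffKernel_diffKer (hl j) (ha j) (hc j)
  refine ⟨∏ j, C j, Finset.prod_nonneg fun j _ => hC0 j, fun κ f hf => ?_⟩
  have hae : ∀ᵐ x : Fin d → ℝ, ∀ j, x j ∈ Set.Ioo (0 : ℝ) 1 →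
      ∃ K, IsDiffKernel (if κ j ≠ 0 then l j else 0) (max 0 (x j - (4 * m j + 4) / 2 ^ κ j))
        (min 1 (x j + (4 * m j + 4) / 2 ^ κ j)) (C j * ((2 : ℝ) ^ κ j) ^ (a j + 2)) (c / 2 ^ κ j)
        (diffKer (l j) (m j) (a j) (κ j) (x j)) K :=
    ae_all_iff.2 fun j => by
      have h := Measure.quasiMeasurePreserving_eval (fun _ : Fin d => (volume : Measure ℝ)) j
      have h2 := h.ae (hC j (κ j))
      exact h2
  filter_upwards [hae] with x hx hxc
  choose K hK using fun j => hx j (hxc j)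
  have hl' : ∀ j, restrictIndex (activeSet κ) l j = if κ j ≠ 0 then l j else 0 := fun j => by
    simp [restrictIndex, activeSet]
  set l' := restrictIndex (activeSet κ) l with hl'_def
  have hK' : ∀ j, IsDiffKernel (l' j) (max 0 (x j - (4 * m j + 4) / 2 ^ κ j))
        (min 1 (x j + (4 * m j + 4) / 2 ^ κ j)) (C j * ((2 : ℝ) ^ κ j) ^ (a j + 2)) (c / 2 ^ κ j)
        (diffKer (l j) (m j) (a j) (κ j) (x j)) (K j) := fun j => by rw [hl']; exact hK j
  rw [tensorOp_eq_integral, integral_prod_mul_eq_integral_mixedDiff hK' hf]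
  refine (enorm_integral_le_lintegral_enorm _).trans ?_
  have hKC : ∀ ξ y : Fin d → ℝ, ‖∏ j, K j (y j) (ξ j)‖ₑ ≤
      ENNReal.ofReal ((∏ j, C j) * ∏ j, ((2 : ℝ) ^ κ j) ^ (a j + 2)) := fun ξ y => by
    rw [Real.enorm_eq_ofReal_abs, Finset.abs_prod, ← Finset.prod_mul_distrib]
    exact ENNReal.ofReal_le_ofReal
      (Finset.prod_le_prod (fun j _ => abs_nonneg _) fun j _ => (hK j).abs_le _ _)
  have hsupp : ∀ ξ y : Fin d → ℝ, (∏ j, K j (y j) (ξ j)) ≠ 0 →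
      ξ ∈ dyadicBox κ (fun _ => c) 0 ∧ y ∈ diffDomain (unitCube d) ξ l' ∩
        dyadicBox κ (fun j => 4 * m j + 4) x := fun ξ y h => by
    have h1 := fun j => (hK' j).support _ _ (Finset.prod_ne_zero_iff.1 h j (Finset.mem_univ j))
    refine ⟨fun j => by simpa using (h1 j).2.2, mem_diffDomain_unitCube_of fun j => ⟨?_, ?_⟩,
      fun j => ?_⟩
    · exact ⟨(le_max_left _ _).trans_lt (h1 j).1.1, (h1 j).1.2.trans_le (min_le_left _ _)⟩
    · exact ⟨(le_max_left _ _).trans_lt (h1 j).2.1.1, (h1 j).2.1.2.trans_le (min_le_left _ _)⟩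
    · have h2 := (le_max_right _ _).trans_lt (h1 j).1.1
      have h3 := (h1 j).1.2.trans_le (min_le_right _ _)
      rw [abs_le]; constructor <;> linarith
  rw [← lintegral_const_mul' _ _ ENNReal.ofReal_ne_top,
    ← lintegral_indicator (measurableSet_dyadicBox _ _ _)]
  refine lintegral_mono fun ξ => ?_
  by_cases hξ : ξ ∈ dyadicBox κ (fun _ => c) 0
  · rw [Set.indicator_of_mem hξ]
    refine (enorm_integral_le_lintegral_enorm _).trans ?_
    rw [← lintegral_const_mul' _ _ ENNReal.ofReal_ne_top,
      ← lintegral_indicator ((measurableSet_diffDomain ξ l').inter (measurableSet_dyadicBox _ _ _))]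
    refine lintegral_mono fun y => ?_
    by_cases hy : y ∈ diffDomain (unitCube d) ξ l' ∩ dyadicBox κ (fun j => 4 * m j + 4) x
    · rw [Set.indicator_of_mem hy, enorm_mul]
      exact mul_le_mul_left (hKC ξ y) _
    · have : (∏ j, K j (y j) (ξ j)) = 0 := by
        by_contra h; exact hy (hsupp ξ y h).2
      rw [this, zero_mul, enorm_zero]; exact zero_le
  · have : ∀ y : Fin d → ℝ, (∏ j, K j (y j) (ξ j)) = 0 := fun y => by
      by_contra h; exact hξ (hsupp ξ y h).1
    simp [this]

end Pointwise

/-! ### Local averages -/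

theorem lintegral_le_rpow_mul_lintegral_rpow {Z : Type*} [MeasurableSpace Z] {μ : Measure Z}
    {h : Z → ℝ≥0∞} (hh : AEMeasurable h μ) {p : ℝ} (hp : 1 ≤ p) :
    ∫⁻ z, h z ∂μ ≤ μ Set.univ ^ (1 - 1 / p) * (∫⁻ z, h z ^ p ∂μ) ^ (1 / p) := by
  have := eLpNorm'_le_eLpNorm'_mul_rpow_measure_univ zero_lt_one hp hh.aestronglyMeasurable
  simp only [eLpNorm', enorm_eq_self, ENNReal.rpow_one, div_one] at this
  rwa [mul_comm] at this

/-- With `P x` the integral of `h ^ p` over the slice at `x` and `M` the full integral, Hölder's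
inequality bounds `G` by `P ^ (1/p)`. Interpolating between `P ≤ M` and `∫ P ≤ v M` gives the `L_q`
bound with only `v ^ (1/q)`. -/
theorem eLpNorm_le_of_enorm_le_lintegral {X Z : Type*} [MeasurableSpace X] [MeasurableSpace Z]
    {ν : Measure X} {μ : Measure Z} [SFinite ν] [SFinite μ] {R : Set (X × Z)}
    (hR : MeasurableSet R) {h : Z → ℝ≥0∞} (hh : Measurable h) {G : X → ℝ} {A V v : ℝ≥0∞}
    (hG : ∀ᵐ x ∂ν, ‖G x‖ₑ ≤ A * ∫⁻ z in {z | (x, z) ∈ R}, h z ∂μ)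
    (hV : ∀ x, μ {z | (x, z) ∈ R} ≤ V) (hv : ∀ z, ν {x | (x, z) ∈ R} ≤ v)
    {p : ℝ} (hp : 1 ≤ p) {q : ℝ≥0∞} (hpq : ENNReal.ofReal p ≤ q) :
    eLpNorm G q ν ≤ A * V ^ (1 - 1 / p) * v ^ (q⁻¹).toReal * (∫⁻ z, h z ^ p ∂μ) ^ (1 / p) := by
  have hp0 : 0 < p := by linarith
  have hp1 : 0 ≤ 1 - 1 / p := by rw [sub_nonneg, div_le_one hp0]; exact hp
  set P : X → ℝ≥0∞ := fun x => ∫⁻ z in {z | (x, z) ∈ R}, h z ^ p ∂μ with hP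
  set M := ∫⁻ z, h z ^ p ∂μ with hM
  have hPM : ∀ x, P x ≤ M := fun x => setLIntegral_le_lintegral _ _
  have hRx : ∀ x, MeasurableSet {z | (x, z) ∈ R} := fun x => measurable_prodMk_left hR
  have hRz : ∀ z, MeasurableSet {x | (x, z) ∈ R} := fun z => measurable_prodMk_right hR
  have h1 : ∀ᵐ x ∂ν, ‖G x‖ₑ ≤ A * V ^ (1 - 1 / p) * P x ^ (1 / p) := by
    filter_upwards [hG] with x hx
    refine hx.trans ?_
    rw [mul_assoc]
    gcongr
    refine (lintegral_le_rpow_mul_lintegral_rpow hh.aemeasurable hp).trans ?_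
    gcongr
    rw [Measure.restrict_apply_univ]
    exact hV x
  have hI : Measurable (R.indicator fun w : X × Z => h w.2 ^ p) :=
    ((hh.comp measurable_snd).pow_const p).indicator hR
  have e : ∀ x, P x = ∫⁻ z, R.indicator (fun w => h w.2 ^ p) (x, z) ∂μ := fun x =>
    (lintegral_indicator (hRx x) fun z => h z ^ p).symm
  have hPm : Measurable P := by
    rw [show P = fun x => ∫⁻ z, R.indicator (fun w => h w.2 ^ p) (x, z) ∂μ from funext e]
    exact hI.lintegral_prod_right'
  have hPint : ∫⁻ x, P x ∂ν ≤ v * M := by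
    simp only [e]
    rw [lintegral_lintegral_swap (f := fun x z => R.indicator (fun w : X × Z => h w.2 ^ p) (x, z))
      hI.aemeasurable, ← lintegral_const_mul _ (hh.pow_const p)]
    refine lintegral_mono fun z => ?_
    have e2 : ∀ x, R.indicator (fun w : X × Z => h w.2 ^ p) (x, z) =
        {x | (x, z) ∈ R}.indicator (fun _ => h z ^ p) x := fun x => rfl
    simp only [e2]
    rw [lintegral_indicator (hRz z), setLIntegral_const, mul_comm]
    gcongr
    exact hv z
  by_cases hq : q = ⊤
  · subst hq
    rw [eLpNorm_exponent_top, ENNReal.inv_top, ENNReal.toReal_zero, ENNReal.rpow_zero, mul_one]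
    refine eLpNormEssSup_le_of_ae_enorm_bound ?_
    filter_upwards [h1] with x hx
    refine hx.trans ?_
    gcongr
    exact hPM x
  · have hq0 : q ≠ 0 := by
      rintro rfl
      simp at hpq; linarith
    have hpq' : p ≤ q.toReal := by
      rwa [ENNReal.ofReal_le_iff_le_toReal hq] at hpq
    have hq1 : 0 < q.toReal := hp0.trans_le hpq'
    rw [eLpNorm_eq_lintegral_rpow_enorm_toReal hq0 hq, ENNReal.toReal_inv, ← one_div]
    have hs : 0 ≤ q.toReal / p - 1 := by
      rw [sub_nonneg, le_div_iff₀ hp0, one_mul]; exact hpq'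
    -- The exponent `q/p - 1` is nonnegative, which is where `p ≤ q` enters.
    have hb : ∀ x, (P x ^ (1 / p)) ^ q.toReal ≤ M ^ (q.toReal / p - 1) * P x := fun x => by
      rw [← ENNReal.rpow_mul, show 1 / p * q.toReal = (q.toReal / p - 1) + 1 by ring,
        ENNReal.rpow_add_of_nonneg _ _ hs zero_le_one, ENNReal.rpow_one]
      gcongr
      exact hPM x
    have h2 : ∫⁻ x, ‖G x‖ₑ ^ q.toReal ∂ν ≤
        (A * V ^ (1 - 1 / p)) ^ q.toReal * (v * M ^ (q.toReal / p)) := by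
      calc ∫⁻ x, ‖G x‖ₑ ^ q.toReal ∂ν
          ≤ ∫⁻ x, (A * V ^ (1 - 1 / p)) ^ q.toReal * M ^ (q.toReal / p - 1) * P x ∂ν := by
            refine lintegral_mono_ae ?_
            filter_upwards [h1] with x hx
            calc ‖G x‖ₑ ^ q.toReal ≤ (A * V ^ (1 - 1 / p) * P x ^ (1 / p)) ^ q.toReal := by gcongr
              _ = (A * V ^ (1 - 1 / p)) ^ q.toReal * (P x ^ (1 / p)) ^ q.toReal :=
                ENNReal.mul_rpow_of_nonneg _ _ hq1.le
              _ ≤ _ := by rw [mul_assoc]; gcongr; exact hb x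
        _ = (A * V ^ (1 - 1 / p)) ^ q.toReal * M ^ (q.toReal / p - 1) * ∫⁻ x, P x ∂ν := by
            exact lintegral_const_mul _ hPm
        _ ≤ (A * V ^ (1 - 1 / p)) ^ q.toReal * M ^ (q.toReal / p - 1) * (v * M) := by gcongr
        _ = (A * V ^ (1 - 1 / p)) ^ q.toReal * (v * M ^ (q.toReal / p)) := by
            conv_rhs => rw [show q.toReal / p = (q.toReal / p - 1) + 1 by ring,
              ENNReal.rpow_add_of_nonneg _ _ hs zero_le_one, ENNReal.rpow_one]
            ring
    calc (∫⁻ x, ‖G x‖ₑ ^ q.toReal ∂ν) ^ (1 / q.toReal)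
        ≤ ((A * V ^ (1 - 1 / p)) ^ q.toReal * (v * M ^ (q.toReal / p))) ^ (1 / q.toReal) := by
          gcongr
      _ = _ := by
        have hq2 : 0 ≤ 1 / q.toReal := by positivity
        rw [ENNReal.mul_rpow_of_nonneg _ _ hq2, ENNReal.mul_rpow_of_nonneg _ _ hq2,
          ← ENNReal.rpow_mul, ← ENNReal.rpow_mul, mul_one_div_cancel hq1.ne', ENNReal.rpow_one,
          show q.toReal / p * (1 / q.toReal) = 1 / p by field_simp]
        ring

/-! ### The `L_q` bound for a single level. -/

section Concrete

variable {d : ℕ} {l m a : Fin d → ℕ}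

theorem volume_dyadicBox (κ : Fin d → ℕ) (c x : Fin d → ℝ) :
    volume (dyadicBox κ c x) = ∏ j, ENNReal.ofReal (2 * c j / 2 ^ κ j) := by
  have : dyadicBox κ c x = Set.Icc (fun j => x j - c j / 2 ^ κ j) (fun j => x j + c j / 2 ^ κ j) := by
    ext y
    simp only [dyadicBox, Set.mem_ofPred_eq, Set.mem_Icc, Pi.le_def, ← forall_and, abs_le]
    refine forall_congr' fun j => ?_
    constructor <;> rintro ⟨h1, h2⟩ <;> constructor <;> linarith
  rw [this, Real.volume_Icc_pi]
  refine Finset.prod_congr rfl fun j _ => ?_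
  congr 1; ring

theorem dyadicBox_symm {κ : Fin d → ℕ} {c x y : Fin d → ℝ} :
    y ∈ dyadicBox κ c x ↔ x ∈ dyadicBox κ c y :=
  forall_congr' fun j => by rw [abs_sub_comm]

theorem eLpNorm_tensorOp_le_lintegral (hl : ∀ j, 1 ≤ l j) (ha : a ≤ m) {c : ℝ}
    (hc : ∀ j, 8 * (m j : ℝ) + 8 ≤ c) {p : ℝ} (hp : 1 ≤ p) {q : ℝ≥0∞}
    (hpq : ENNReal.ofReal p ≤ q) : ∃ C : ℝ, 0 ≤ C ∧ ∀ (κ : Fin d → ℕ) (f : (Fin d → ℝ) → ℝ),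
      Measurable f → Integrable f →
      eLpNorm (tensorOp l m a κ f) q (volume.restrict (unitCube d)) ≤
        ENNReal.ofReal (C * ∏ j, ((2 : ℝ) ^ κ j) ^ (a j + 2)) *
          (∏ j, ENNReal.ofReal (2 * c / 2 ^ κ j) *
            ENNReal.ofReal (2 * (4 * m j + 4) / 2 ^ κ j)) ^ (1 - 1 / p) *
          (∏ j, ENNReal.ofReal (2 * (4 * m j + 4) / 2 ^ κ j)) ^ (q⁻¹).toReal *
          (∫⁻ ξ in dyadicBox κ (fun _ => c) 0,
            ∫⁻ y in diffDomain (unitCube d) ξ (restrictIndex (activeSet κ) l),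
              ‖mixedDiff ξ (restrictIndex (activeSet κ) l) f y‖ₑ ^ p) ^ (1 / p) := by
  obtain ⟨C, hC0, hC⟩ := exists_enorm_tensorOp_le hl ha hc
  refine ⟨C, hC0, fun κ f hfm hf => ?_⟩
  have hp0 : 0 < p := by linarith
  set l' := restrictIndex (activeSet κ) l with hl'
  set D : Set ((Fin d → ℝ) × (Fin d → ℝ)) := {z | z.2 ∈ diffDomain (unitCube d) z.1 l'} with hD
  have hDm : MeasurableSet D := measurableSet_diffDomain_prod l'
  set r : Fin d → ℝ := fun j => 4 * m j + 4 with hr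
  set R : Set ((Fin d → ℝ) × ((Fin d → ℝ) × (Fin d → ℝ))) := {w | w.2.2 ∈ dyadicBox κ r w.1} with hR
  have hRm : MeasurableSet R := by
    have h : Measurable fun w : (Fin d → ℝ) × ((Fin d → ℝ) × (Fin d → ℝ)) => (w.1, w.2.2) := by
      fun_prop
    exact h (measurableSet_dyadicBox_prod (κ := κ) (c := r))
  set g : (Fin d → ℝ) × (Fin d → ℝ) → ℝ≥0∞ := fun z => ‖mixedDiff z.1 l' f z.2‖ₑ with hg
  have hgm : Measurable g := (measurable_mixedDiff hfm l').enorm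
  set B := dyadicBox κ (fun _ => c) 0 with hB
  have hslice : ∀ (s : ℝ≥0∞ → ℝ≥0∞), Measurable s → ∀ (S : Set ((Fin d → ℝ) × (Fin d → ℝ))),
      MeasurableSet S → ∫⁻ z, S.indicator (fun z => s (g z)) z ∂((volume.restrict B).prod volume) =
        ∫⁻ ξ in B, ∫⁻ y in {y | (ξ, y) ∈ S}, s ‖mixedDiff ξ l' f y‖ₑ := fun s hs S hS => by
    have hsg : Measurable fun z => s (g z) := hs.comp hgm
    rw [lintegral_prod _ (hsg.indicator hS).aemeasurable]
    congr 1 with ξ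
    exact lintegral_indicator (measurable_prodMk_left hS) fun y => s ‖mixedDiff ξ l' f y‖ₑ
  have key := eLpNorm_le_of_enorm_le_lintegral (ν := volume.restrict (unitCube d))
    (μ := (volume.restrict B).prod volume) hRm (hgm.indicator hDm)
    (G := tensorOp l m a κ f) (A := ENNReal.ofReal (C * ∏ j, ((2 : ℝ) ^ κ j) ^ (a j + 2)))
    (V := ∏ j, ENNReal.ofReal (2 * c / 2 ^ κ j) * ENNReal.ofReal (2 * r j / 2 ^ κ j))
    (v := ∏ j, ENNReal.ofReal (2 * r j / 2 ^ κ j)) ?_ ?_ ?_ hp hpq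
  · refine key.trans (le_of_eq ?_)
    congr 2
    have e : ∀ z, D.indicator g z ^ p = D.indicator (fun z => g z ^ p) z := fun z => by
      by_cases hz : z ∈ D
      · simp [Set.indicator_of_mem hz]
      · simp [Set.indicator_of_notMem hz, hp0]
    simp only [e]
    rw [hslice (fun t => t ^ p) (measurable_id.pow_const p) D hDm]
    rfl
  · rw [ae_restrict_iff' (measurableSet_unitCube d)]
    filter_upwards [hC κ f hf] with x hx hxc
    refine (hx hxc).trans (le_of_eq ?_)
    congr 1
    have hRx : MeasurableSet {z | (x, z) ∈ R} := measurable_prodMk_left hRm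
    rw [← lintegral_indicator hRx, Set.indicator_indicator]
    have h4 := hslice (fun t => t) measurable_id _ (hRx.inter hDm)
    refine Eq.trans ?_ h4.symm
    congr 1 with ξ
    congr 2
    ext y
    simp only [Set.mem_inter_iff, Set.mem_ofPred_eq, hR, hD]
    exact and_comm
  · intro x
    have : {z | (x, z) ∈ R} = Set.univ ×ˢ dyadicBox κ r x := by ext z; simp [hR]
    rw [this, Measure.prod_prod, Measure.restrict_apply_univ, hB, volume_dyadicBox,
      volume_dyadicBox, ← Finset.prod_mul_distrib]
  · intro z
    have : {x | (x, z) ∈ R} = dyadicBox κ r z.2 := by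
      ext x; exact dyadicBox_symm
    rw [this, ← volume_dyadicBox κ r z.2]
    exact Measure.restrict_apply_le _ _

theorem mixedDiff_congr_left {ξ η : Fin d → ℝ} {l : Fin d → ℕ} (h : ∀ j, l j ≠ 0 → ξ j = η j)
    (f : (Fin d → ℝ) → ℝ) (x : Fin d → ℝ) : mixedDiff ξ l f x = mixedDiff η l f x := by
  refine Finset.sum_congr rfl fun k hk => ?_
  congr 2
  funext j
  by_cases hj : l j = 0
  · have : k j = 0 := Nat.le_zero.1 (hj ▸ Finset.mem_Iic.1 hk j)
    simp [this]
  · rw [h j hj]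

theorem diffDomain_congr_left {ξ η : Fin d → ℝ} {l : Fin d → ℕ} (h : ∀ j, l j ≠ 0 → ξ j = η j)
    (D : Set (Fin d → ℝ)) : diffDomain D ξ l = diffDomain D η l := by
  have : ∀ (x t : Fin d → ℝ) j, x j + t j * l j * ξ j = x j + t j * l j * η j := fun x t j => by
    by_cases hj : l j = 0
    · simp [hj]
    · rw [h j hj]
  simp only [diffDomain, this]

/-- The differences do not depend on the steps in inactive coordinates. Integrating these out yields
a power of `2c`, at most the `d`-th since `2c ≥ 1`. -/
theorem lintegral_dyadicBox_le {c : ℝ} (hc : 1 ≤ 2 * c) {p : ℝ} (f : (Fin d → ℝ) → ℝ)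
    (hf : Measurable f) (κ : Fin d → ℕ) :
    ∫⁻ ξ in dyadicBox κ (fun _ => c) 0,
      ∫⁻ y in diffDomain (unitCube d) ξ (restrictIndex (activeSet κ) l),
        ‖mixedDiff ξ (restrictIndex (activeSet κ) l) f y‖ₑ ^ p ≤
    ENNReal.ofReal (2 * c) ^ d *
      ∫⁻ ξ in {ξ : activeSet κ → ℝ | ∀ j, |ξ j| ≤ c * ((2 : ℝ) ^ κ j)⁻¹},
        ∫⁻ x in diffDomain (unitCube d) (extendZero (activeSet κ) ξ)
          (restrictIndex (activeSet κ) l),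
          ‖mixedDiff (extendZero (activeSet κ) ξ) (restrictIndex (activeSet κ) l) f x‖ₑ ^ p := by
  set J := activeSet κ with hJ
  set l' := restrictIndex J l with hl'
  set E : (Fin d → ℝ) → ℝ≥0∞ := fun ξ => ∫⁻ y in diffDomain (unitCube d) ξ l',
    ‖mixedDiff ξ l' f y‖ₑ ^ p with hE
  have hEm : Measurable E := by
    have h1 : Measurable ({z : (Fin d → ℝ) × (Fin d → ℝ) | z.2 ∈ diffDomain (unitCube d) z.1 l'
        }.indicator fun z => ‖mixedDiff z.1 l' f z.2‖ₑ ^ p) :=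
      ((measurable_mixedDiff hf l').enorm.pow_const p).indicator (measurableSet_diffDomain_prod l')
    have h2 : E = fun ξ => ∫⁻ y, {z : (Fin d → ℝ) × (Fin d → ℝ) |
        z.2 ∈ diffDomain (unitCube d) z.1 l'}.indicator
          (fun z => ‖mixedDiff z.1 l' f z.2‖ₑ ^ p) (ξ, y) := funext fun ξ =>
      (lintegral_indicator (measurableSet_diffDomain ξ l') fun y => ‖mixedDiff ξ l' f y‖ₑ ^ p).symm
    rw [h2]; exact h1.lintegral_prod_right'
  have hext : Measurable (extendZero J) := by
    refine measurable_pi_iff.2 fun j => ?_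
    by_cases hj : j ∈ J
    · simp only [extendZero, hj, dif_pos]; exact measurable_pi_apply _
    · simp only [extendZero, hj, dif_neg, not_false_eq_true]; exact measurable_const
  set S : Set (J → ℝ) := {ξ | ∀ j, |ξ j| ≤ c * ((2 : ℝ) ^ κ j)⁻¹} with hS
  have hSm : MeasurableSet S := by
    have : S = ⋂ j, {ξ : J → ℝ | |ξ j| ≤ c * ((2 : ℝ) ^ κ j)⁻¹} := by ext; simp [hS]
    rw [this]
    exact MeasurableSet.iInter fun j => measurableSet_le (by fun_prop) measurable_const
  set S' : Set ({i // ¬ i ∈ J} → ℝ) := Set.Icc (fun _ => -c) (fun _ => c) with hS'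
  have hpt : ∀ ξ : Fin d → ℝ, (dyadicBox κ (fun _ => c) 0).indicator E ξ ≤
      S.indicator (fun η => E (extendZero J η)) (fun j => ξ j) *
        S'.indicator (fun _ => (1 : ℝ≥0∞)) (fun j => ξ j) := fun ξ => by
    by_cases h : ξ ∈ dyadicBox κ (fun _ => c) 0
    · have h1 : (fun j : J => ξ j) ∈ S := fun j => by
        have := h j
        simpa [div_eq_mul_inv] using this
      have h2 : (fun j : {i // ¬ i ∈ J} => ξ j) ∈ S' := by
        rw [hS', Set.mem_Icc, Pi.le_def, Pi.le_def, ← forall_and]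
        intro j
        have h3 := h j
        have h4 : κ j = 0 := by simpa [hJ, activeSet] using j.2
        rw [h4] at h3
        simp only [Pi.zero_apply, sub_zero, pow_zero, div_one] at h3
        exact abs_le.1 h3
      rw [Set.indicator_of_mem h, Set.indicator_of_mem h1, Set.indicator_of_mem h2, mul_one]
      have h5 : ∀ j, l' j ≠ 0 → ξ j = extendZero J (fun j : J => ξ j) j := fun j hj => by
        have : j ∈ J := by
          by_contra h'
          exact hj (by simp [hl', restrictIndex, h'])
        simp [extendZero, this]
      refine le_of_eq ?_
      simp only [hE]
      rw [diffDomain_congr_left h5]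
      simp only [mixedDiff_congr_left h5]
    · rw [Set.indicator_of_notMem h]; exact zero_le
  have hBm := measurableSet_dyadicBox κ (fun _ => c) 0
  have hE2 : Measurable fun η => E (extendZero J η) := hEm.comp hext
  calc ∫⁻ ξ in dyadicBox κ (fun _ => c) 0, E ξ
      = ∫⁻ ξ, (dyadicBox κ (fun _ => c) 0).indicator E ξ := (lintegral_indicator hBm _).symm
    _ ≤ ∫⁻ ξ : Fin d → ℝ, S.indicator (fun η => E (extendZero J η)) (fun j => ξ j) *
        S'.indicator (fun _ => (1 : ℝ≥0∞)) (fun j => ξ j) := lintegral_mono hpt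
    _ = ∫⁻ z : (J → ℝ) × ({i // ¬ i ∈ J} → ℝ), S.indicator (fun η => E (extendZero J η)) z.1 *
        S'.indicator (fun _ => (1 : ℝ≥0∞)) z.2 := by
      have h := (volume_preserving_piEquivPiSubtypeProd (fun _ : Fin d => ℝ) (· ∈ J)).lintegral_comp
        (f := fun z : (J → ℝ) × ({i // ¬ i ∈ J} → ℝ) =>
          S.indicator (fun η => E (extendZero J η)) z.1 * S'.indicator (fun _ => (1 : ℝ≥0∞)) z.2)
        (((hE2.indicator hSm).comp measurable_fst).mul
          ((measurable_const.indicator measurableSet_Icc).comp measurable_snd))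
      convert h <;> rfl
    _ = (∫⁻ η, S.indicator (fun η => E (extendZero J η)) η) *
        ∫⁻ η, S'.indicator (fun _ => (1 : ℝ≥0∞)) η :=
      lintegral_prod_mul (hE2.indicator hSm).aemeasurable
        (measurable_const.indicator measurableSet_Icc).aemeasurable
    _ ≤ ENNReal.ofReal (2 * c) ^ d * ∫⁻ η in S, E (extendZero J η) := by
      rw [lintegral_indicator hSm, mul_comm, lintegral_indicator measurableSet_Icc, setLIntegral_one,
        Real.volume_Icc_pi]
      gcongr
      simp only [sub_neg_eq_add, ← two_mul, Finset.prod_const, Finset.card_univ]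
      refine pow_le_pow_right₀ (ENNReal.one_le_ofReal.2 hc) ?_
      exact (Fintype.card_subtype_le _).trans (by simp)

end Concrete

/-! ### Summation over the levels. -/

section Summation

variable {d : ℕ} {l m a : Fin d → ℕ}

/-- Exponent count with `X = 2^κ` and `s = 1/q`: `(a + 2) - 2 (1 - 1/p) - s = a + 1/p + (1/p - s)`.
-/
theorem rpow_level_identity {X c r s p : ℝ} (hX : 0 < X) (hc : 0 ≤ c) (hr : 0 ≤ r) (a : ℕ) :
    X ^ (a + 2) * ((2 * c / X * (2 * r / X)) ^ (1 - 1 / p)) * (2 * r / X) ^ s =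
      ((4 * c * r) ^ (1 - 1 / p) * (2 * r) ^ s) * X ^ ((a : ℝ) + 1 / p + (1 / p - s)) := by
  have e1 : 2 * c / X * (2 * r / X) = (4 * c * r) * X ^ (-2 : ℝ) := by
    rw [Real.rpow_neg hX.le, show (2 : ℝ) = ((2 : ℕ) : ℝ) by norm_num, Real.rpow_natCast]
    push_cast
    field_simp; ring
  have e2 : 2 * r / X = (2 * r) * X ^ (-1 : ℝ) := by
    rw [Real.rpow_neg_one]; rfl
  rw [e1, Real.mul_rpow (x := 4 * c * r) (by positivity) (by positivity), e2,
    Real.mul_rpow (x := 2 * r) (by positivity) (by positivity), ← Real.rpow_mul hX.le, ← Real.rpow_mul hX.le,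
    ← Real.rpow_natCast]
  have e3 : X ^ ((a : ℝ) + 1 / p + (1 / p - s)) =
      X ^ (((a + 2 : ℕ) : ℝ)) * X ^ (-2 * (1 - 1 / p)) * X ^ (-1 * s) := by
    rw [← Real.rpow_add hX, ← Real.rpow_add hX]
    congr 1; push_cast; ring
  rw [e3]; ring

theorem exists_eLpNorm_tensorOp_le_diffMean (hl : ∀ j, 1 ≤ l j) (ha : a ≤ m) {c : ℝ} (hc1 : 1 ≤ c)
    (hc : ∀ j, 8 * (m j : ℝ) + 8 ≤ c) {p : ℝ} (hp : 1 ≤ p) {q : ℝ≥0∞}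
    (hpq : ENNReal.ofReal p ≤ q) : ∃ C : ℝ≥0∞, C ≠ ⊤ ∧ ∀ (κ : Fin d → ℕ) (f : (Fin d → ℝ) → ℝ),
      Measurable f → Integrable f →
      eLpNorm (tensorOp l m a κ f) q (volume.restrict (unitCube d)) ≤
        C * (∏ j, ENNReal.ofReal (((2 : ℝ) ^ κ j) ^ ((a j : ℝ) + 1 / p + (1 / p - (q⁻¹).toReal)))) *
          diffMean c p l (activeSet κ) f (fun j => ((2 : ℝ) ^ κ j)⁻¹) := by
  obtain ⟨C, hC0, hC⟩ := eLpNorm_tensorOp_le_lintegral hl ha hc hp hpq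
  have hp0 : 0 < p := by linarith
  have hp1 : 0 ≤ 1 - 1 / p := by rw [sub_nonneg, div_le_one hp0]; exact hp
  have hs : 0 ≤ (q⁻¹).toReal := ENNReal.toReal_nonneg
  set s := (q⁻¹).toReal
  refine ⟨ENNReal.ofReal C * (∏ j, ENNReal.ofReal ((4 * c * (4 * m j + 4)) ^ (1 - 1 / p) *
    (2 * (4 * m j + 4)) ^ s)) * (ENNReal.ofReal (2 * c) ^ d) ^ (1 / p), ?_, fun κ f hfm hf => ?_⟩
  · refine ENNReal.mul_ne_top (ENNReal.mul_ne_top ENNReal.ofReal_ne_top ?_) ?_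
    · exact ENNReal.prod_ne_top fun j _ => ENNReal.ofReal_ne_top
    · exact ENNReal.rpow_ne_top_of_nonneg (by positivity) (ENNReal.pow_ne_top ENNReal.ofReal_ne_top)
  · refine (hC κ f hfm hf).trans ?_
    have h1 : ENNReal.ofReal (C * ∏ j, ((2 : ℝ) ^ κ j) ^ (a j + 2)) *
          (∏ j, ENNReal.ofReal (2 * c / 2 ^ κ j) *
            ENNReal.ofReal (2 * (4 * m j + 4) / 2 ^ κ j)) ^ (1 - 1 / p) *
          (∏ j, ENNReal.ofReal (2 * (4 * m j + 4) / 2 ^ κ j)) ^ s =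
        ENNReal.ofReal C * (∏ j, ENNReal.ofReal ((4 * c * (4 * m j + 4)) ^ (1 - 1 / p) *
          (2 * (4 * m j + 4)) ^ s)) *
          ∏ j, ENNReal.ofReal (((2 : ℝ) ^ κ j) ^ ((a j : ℝ) + 1 / p + (1 / p - s))) := by
      rw [ENNReal.ofReal_mul hC0, ENNReal.ofReal_prod_of_nonneg (fun j _ => by positivity),
        ← ENNReal.prod_rpow_of_nonneg hp1, ← ENNReal.prod_rpow_of_nonneg hs, mul_assoc, mul_assoc,
        mul_assoc, ← Finset.prod_mul_distrib, ← Finset.prod_mul_distrib, ← Finset.prod_mul_distrib]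
      congr 1
      refine Finset.prod_congr rfl fun j _ => ?_
      rw [← ENNReal.ofReal_mul (by positivity), ENNReal.ofReal_rpow_of_nonneg (by positivity) hp1,
        ENNReal.ofReal_rpow_of_nonneg (by positivity) hs, ← ENNReal.ofReal_mul (by positivity),
        ← ENNReal.ofReal_mul (by positivity), ← ENNReal.ofReal_mul (by positivity)]
      congr 1
      rw [← rpow_level_identity (by positivity) (by linarith) (by positivity)]
      ring
    rw [h1]
    have h2 := ENNReal.rpow_le_rpow (lintegral_dyadicBox_le (l := l) (by linarith : 1 ≤ 2 * c)
      (p := p) f hfm κ) (by positivity : 0 ≤ 1 / p)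
    rw [ENNReal.mul_rpow_of_nonneg _ _ (by positivity)] at h2
    refine (mul_le_mul_right h2 _).trans (le_of_eq ?_)
    rw [diffMean]
    ring

theorem diffMean_mono {c p : ℝ} (hc : 0 ≤ c) (hp : 0 ≤ p) (J : Finset (Fin d))
    (f : (Fin d → ℝ) → ℝ) {s t : J → ℝ} (hst : ∀ j, s j ≤ t j) :
    diffMean c p l J f s ≤ diffMean c p l J f t := by
  refine ENNReal.rpow_le_rpow (lintegral_mono_set fun ξ hξ j => ?_) (by positivity)
  exact (hξ j).trans (mul_le_mul_of_nonneg_left (hst j) hc)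

/-- The dyadic box `∏_{j ∈ J} [2^{-κ_j}, 2^{1-κ_j})`. -/
def levelBox (J : Finset (Fin d)) (κ : Fin d → ℕ) : Set (J → ℝ) :=
  Set.univ.pi fun j => Set.Ico (((2 : ℝ) ^ κ j)⁻¹) (2 * ((2 : ℝ) ^ κ j)⁻¹)

/-- On the box `diffMean` is at least its value at the lower corner and the negative power at least
its value at the upper corner; the volume `∏ 2^{-κ_j}` accounts for the extra `-1` in the exponent.
-/
theorem prod_rpow_mul_diffMean_le {c p : ℝ} (hc : 0 ≤ c) (hp : 0 ≤ p) (J : Finset (Fin d))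
    (f : (Fin d → ℝ) → ℝ) (e : Fin d → ℝ) (he : ∀ j, 0 ≤ e j) (κ : Fin d → ℕ) :
    (∏ j : J, ENNReal.ofReal (((2 : ℝ) ^ κ j) ^ e j)) *
        diffMean c p l J f (fun j => ((2 : ℝ) ^ κ j)⁻¹) ≤
      (∏ j : J, ENNReal.ofReal (2 ^ (e j + 1))) *
        ∫⁻ t in levelBox J κ, ENNReal.ofReal (∏ j : J, t j ^ (-e j - 1)) * diffMean c p l J f t := by
  have hm : MeasurableSet (levelBox J κ) := MeasurableSet.univ_pi fun _ => measurableSet_Ico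
  set W := ENNReal.ofReal (∏ j : J, (2 * ((2 : ℝ) ^ κ j)⁻¹) ^ (-e j - 1)) *
    diffMean c p l J f (fun j => ((2 : ℝ) ^ κ j)⁻¹) with hW
  have h1 : W * volume (levelBox J κ) ≤
      ∫⁻ t in levelBox J κ, ENNReal.ofReal (∏ j : J, t j ^ (-e j - 1)) * diffMean c p l J f t := by
    rw [← setLIntegral_const]
    refine setLIntegral_mono' hm fun t ht => ?_
    have ht' := fun j => ht j (Set.mem_univ j)
    refine mul_le_mul' (ENNReal.ofReal_le_ofReal ?_) (diffMean_mono hc hp J f fun j => (ht' j).1)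
    refine Finset.prod_le_prod (fun j _ => by positivity) fun j _ => ?_
    have h0 : 0 < t j := lt_of_lt_of_le (by positivity) (ht' j).1
    exact Real.rpow_le_rpow_of_nonpos h0 (ht' j).2.le (by linarith [he j])
  refine le_trans (le_of_eq ?_) (mul_le_mul_right h1 _)
  rw [levelBox, volume_pi_pi, hW, ENNReal.ofReal_prod_of_nonneg (fun j _ => by positivity)]
  have e1 : ∀ j : J, ENNReal.ofReal (((2 : ℝ) ^ κ j) ^ e j) = ENNReal.ofReal (2 ^ (e j + 1)) *
      ENNReal.ofReal ((2 * ((2 : ℝ) ^ κ j)⁻¹) ^ (-e j - 1)) *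
        volume (Set.Ico (((2 : ℝ) ^ κ j)⁻¹) (2 * ((2 : ℝ) ^ κ j)⁻¹)) := fun j => by
    rw [Real.volume_Ico, ← ENNReal.ofReal_mul (by positivity), ← ENNReal.ofReal_mul (by positivity)]
    congr 1
    have hX : (0 : ℝ) < 2 ^ κ j := by positivity
    rw [Real.mul_rpow (by positivity) (by positivity), Real.inv_rpow hX.le, ← Real.rpow_neg hX.le,
      show -e j - 1 = -(e j + 1) by ring, neg_neg, Real.rpow_neg (by norm_num), Real.rpow_add hX,
      Real.rpow_one]
    have : (0 : ℝ) < 2 ^ (e j + 1) := by positivity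
    field_simp
    ring
  simp only [e1, Finset.prod_mul_distrib]
  ring

theorem levelBox_subset {J : Finset (Fin d)} {κ : Fin d → ℕ} (h : ∀ j ∈ J, κ j ≠ 0) :
    levelBox J κ ⊆ {t : J → ℝ | ∀ j, 0 < t j ∧ t j < 1} := fun t ht j => by
  have h1 := ht j (Set.mem_univ j)
  refine ⟨lt_of_lt_of_le (by positivity) h1.1, h1.2.trans_le ?_⟩
  obtain ⟨n, hn⟩ := Nat.exists_eq_succ_of_ne_zero (h j j.2)
  rw [hn, pow_succ, mul_inv]
  have : ((2 : ℝ) ^ n)⁻¹ ≤ 1 := inv_le_one_of_one_le₀ (one_le_pow₀ (by norm_num))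
  linarith

theorem eq_of_mem_Ico_level {k n : ℕ} {t : ℝ}
    (h1 : t ∈ Set.Ico (((2 : ℝ) ^ k)⁻¹) (2 * ((2 : ℝ) ^ k)⁻¹))
    (h2 : t ∈ Set.Ico (((2 : ℝ) ^ n)⁻¹) (2 * ((2 : ℝ) ^ n)⁻¹)) : k = n := by
  have key : ∀ {k n : ℕ}, t ∈ Set.Ico (((2 : ℝ) ^ k)⁻¹) (2 * ((2 : ℝ) ^ k)⁻¹) →
      t ∈ Set.Ico (((2 : ℝ) ^ n)⁻¹) (2 * ((2 : ℝ) ^ n)⁻¹) → ¬ k < n := by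
    intro k n h1 h2 hkn
    have h3 : (2 : ℝ) ^ (k + 1) ≤ 2 ^ n := pow_le_pow_right₀ (by norm_num) hkn
    have h4 : ((2 : ℝ) ^ n)⁻¹ ≤ ((2 : ℝ) ^ (k + 1))⁻¹ := inv_anti₀ (by positivity) h3
    rw [pow_succ, mul_inv] at h4
    linarith [h1.1, h2.2]
  exact le_antisymm (not_lt.1 (key h2 h1)) (not_lt.1 (key h1 h2))

theorem volume_unitCube (d : ℕ) : volume (unitCube d) = 1 := by
  have : unitCube d = Set.univ.pi fun _ => Set.Ioo (0 : ℝ) 1 := by ext x; simp [unitCube]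
  rw [this, Real.volume_pi_Ioo]; simp

instance isProbabilityMeasure_restrict_unitCube (d : ℕ) :
    IsProbabilityMeasure (volume.restrict (unitCube d)) :=
  ⟨by rw [Measure.restrict_apply_univ, volume_unitCube]⟩

theorem memLp_tensorOp {f : (Fin d → ℝ) → ℝ} (hf : IntegrableOn f (unitCube d))
    (l m a κ : Fin d → ℕ) (q : ℝ≥0∞) :
    MemLp (tensorOp l m a κ f) q (volume.restrict (unitCube d)) := by
  obtain ⟨B, hB⟩ := exists_abs_tensorOp_le hf l m a κ
  exact MemLp.of_bound (aestronglyMeasurable_tensorOp hf).restrict B (ae_of_all _ hB)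

/-- Levels are grouped by their active set `J`. For each nonempty `J` the boxes of distinct levels
are disjoint subsets of the unit cube in the coordinates `J`, so their contributions add up to at
most the integral assumed finite. -/
theorem tsum_eLpNorm_tensorOp_lt_top (hl : ∀ j, 1 ≤ l j) (ha : a ≤ m) {c : ℝ} (hc1 : 1 ≤ c)
    (hc : ∀ j, 8 * (m j : ℝ) + 8 ≤ c) {p : ℝ} (hp : 1 ≤ p) {q : ℝ≥0∞}
    (hpq : ENNReal.ofReal p ≤ q) {f : (Fin d → ℝ) → ℝ} (hfm : Measurable f) (hf : Integrable f)
    (hyp : ∀ J : Finset (Fin d), J.Nonempty →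
        ∫⁻ t in {t : J → ℝ | ∀ j, 0 < t j ∧ t j < 1},
          ENNReal.ofReal (∏ j : J, t j ^ (-(a j : ℝ) - 1 / p - max (1 / p - (q⁻¹).toReal) 0 - 1)) *
            diffMean c p l J f t < ⊤) :
    ∑' κ : Fin d → ℕ, eLpNorm (tensorOp l m a κ f) q (volume.restrict (unitCube d)) < ⊤ := by
  obtain ⟨C, hC, hle⟩ := exists_eLpNorm_tensorOp_le_diffMean hl ha hc1 hc hp hpq
  have hp0 : 0 < p := by linarith
  have hs : (q⁻¹).toReal ≤ 1 / p := by
    have h1 : q⁻¹ ≤ (ENNReal.ofReal p)⁻¹ := ENNReal.inv_le_inv.2 hpq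
    have h2 := ENNReal.toReal_mono (by simp [hp0]) h1
    rwa [ENNReal.toReal_inv (ENNReal.ofReal p), ENNReal.toReal_ofReal hp0.le, inv_eq_one_div p] at h2
  set e : Fin d → ℝ := fun j => (a j : ℝ) + 1 / p + (1 / p - (q⁻¹).toReal) with he
  have he0 : ∀ j, 0 ≤ e j := fun j => by
    have : 0 ≤ 1 / p := by positivity
    have : (0 : ℝ) ≤ a j := Nat.cast_nonneg _
    simp only [he]; linarith
  rw [← ENNReal.tsum_fiberwise _ activeSet, tsum_fintype, ENNReal.sum_lt_top]
  intro J _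
  rcases J.eq_empty_or_nonempty with rfl | hJ
  -- The empty active set contains the level zero alone, a single bounded function needing no
  -- hypothesis.
  · have h0 : ∀ κ : activeSet ⁻¹' {(∅ : Finset (Fin d))}, κ.1 = 0 := fun κ => by
      have := κ.2
      simp only [Set.mem_preimage, Set.mem_singleton_iff, activeSet,
        Finset.filter_eq_empty_iff] at this
      funext j
      simpa using this (Finset.mem_univ j)
    have : Subsingleton (activeSet ⁻¹' {(∅ : Finset (Fin d))}) :=
      ⟨fun κ κ' => Subtype.ext ((h0 κ).trans (h0 κ').symm)⟩
    have := Fintype.ofFinite (activeSet ⁻¹' {(∅ : Finset (Fin d))})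
    rw [tsum_fintype, ENNReal.sum_lt_top]
    intro κ _
    exact (memLp_tensorOp hf.integrableOn l m a κ.1 q).2
  · set C' := C * ∏ j : J, ENNReal.ofReal (2 ^ (e j + 1)) with hC'
    set w : (J → ℝ) → ℝ≥0∞ := fun t => ENNReal.ofReal (∏ j : J,
      t j ^ (-(a j : ℝ) - 1 / p - max (1 / p - (q⁻¹).toReal) 0 - 1)) * diffMean c p l J f t with hw
    have hterm : ∀ κ : activeSet ⁻¹' {J},
        eLpNorm (tensorOp l m a κ f) q (volume.restrict (unitCube d)) ≤
          C' * ∫⁻ t in levelBox J κ, w t := fun κ => by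
      have hκ : activeSet κ.1 = J := κ.2
      refine (hle κ f hfm hf).trans ?_
      rw [hκ, hC', mul_assoc, mul_assoc]
      refine mul_le_mul_right ?_ _
      have h1 := prod_rpow_mul_diffMean_le (l := l) (by linarith : 0 ≤ c) hp0.le J f e he0 κ
      have h2 : ∏ j, ENNReal.ofReal (((2 : ℝ) ^ κ.1 j) ^ ((a j : ℝ) + 1 / p +
          (1 / p - (q⁻¹).toReal))) = ∏ j : J, ENNReal.ofReal (((2 : ℝ) ^ κ.1 j) ^ e j) := by
        rw [Finset.prod_coe_sort J fun j => ENNReal.ofReal (((2 : ℝ) ^ κ.1 j) ^ e j)]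
        refine (Finset.prod_subset (Finset.subset_univ J) fun j _ hj => ?_).symm
        have : κ.1 j = 0 := by
          rw [← hκ] at hj
          simpa [activeSet] using hj
        simp [this]
      rw [h2]
      refine h1.trans (le_of_eq ?_)
      have h3 : ∀ j : Fin d, -(a j : ℝ) - 1 / p - max (1 / p - (q⁻¹).toReal) 0 - 1 = -e j - 1 :=
        fun j => by rw [max_eq_left (by linarith)]; simp only [he]; ring
      simp only [hw, h3]
    refine (ENNReal.tsum_le_tsum hterm).trans_lt ?_
    rw [ENNReal.tsum_mul_left]
    refine ENNReal.mul_lt_top (ENNReal.mul_lt_top hC.lt_top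
      (ENNReal.prod_lt_top fun j _ => ENNReal.ofReal_lt_top)) ?_
    have hbm : ∀ κ : activeSet ⁻¹' {J}, MeasurableSet (levelBox J κ) := fun κ =>
      MeasurableSet.univ_pi fun _ => measurableSet_Ico
    rw [← lintegral_iUnion hbm ?_ w]
    · refine (lintegral_mono_set (Set.iUnion_subset fun κ => levelBox_subset fun j hj => ?_)).trans_lt
        (hyp J hJ)
      have hκ : activeSet κ.1 = J := κ.2
      rw [← hκ] at hj
      simpa [activeSet] using hj
    · intro κ κ' hne
      refine Set.disjoint_left.2 fun t ht ht' => hne (Subtype.ext (funext fun j => ?_))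
      by_cases hj : j ∈ J
      · exact eq_of_mem_Ico_level (ht ⟨j, hj⟩ (Set.mem_univ _)) (ht' ⟨j, hj⟩ (Set.mem_univ _))
      · have h1 : ∀ κ : activeSet ⁻¹' {J}, κ.1 j = 0 := fun κ => by
          have hκ : activeSet κ.1 = J := κ.2
          rw [← hκ] at hj
          simpa [activeSet] using hj
        rw [h1, h1]

end Summation

/-! ### Absolutely convergent series in `L_q` -/

/-- Completeness of `L_q`. Convergence along all finite sets is what permits summation over boxes
`Finset.Iic k`. -/
theorem exists_tendsto_eLpNorm_sub_sum {α ι : Type*} [MeasurableSpace α] {μ : Measure α} {q : ℝ≥0∞}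
    (hq : 1 ≤ q) {G : ι → α → ℝ} (hG : ∀ i, MemLp (G i) q μ) (hs : ∑' i, eLpNorm (G i) q μ < ⊤) :
    ∃ F : α → ℝ, MemLp F q μ ∧
      Tendsto (fun s : Finset ι => eLpNorm (fun x => F x - ∑ i ∈ s, G i x) q μ) atTop (𝓝 0) := by
  have : Fact (1 ≤ q) := ⟨hq⟩
  have hsum : Summable fun i => (hG i).toLp (G i) := by
    refine Summable.of_norm ?_
    simp only [Lp.norm_toLp]
    exact ENNReal.summable_toReal hs.ne
  set S := ∑' i, (hG i).toLp (G i) with hS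
  refine ⟨S, Lp.memLp S, ?_⟩
  have h1 : Tendsto (fun s : Finset ι => ∑ i ∈ s, (hG i).toLp (G i)) atTop (𝓝 S) := hsum.hasSum
  rw [Lp.tendsto_Lp_iff_tendsto_eLpNorm'] at h1
  refine h1.congr fun s => ?_
  rw [eLpNorm_sub_comm]
  refine eLpNorm_congr_ae ?_
  have h2 : ∀ᵐ x ∂μ, ∀ i ∈ s, (hG i).toLp (G i) x = G i x :=
    (ae_ball_iff s.countable_toSet).2 fun i _ => (hG i).coeFn_toLp
  filter_upwards [Lp.coeFn_finsetSum s fun i => (hG i).toLp (G i), h2] with x hx hx2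
  rw [Pi.sub_apply, hx, Finset.sum_apply]
  congr 1
  exact Finset.sum_congr rfl hx2

theorem tendsto_finset_Iic_atTop {d : ℕ} :
    Tendsto (fun k : Fin d → ℕ => Finset.Iic k) atTop atTop := by
  refine tendsto_atTop_finset_of_monotone (fun a b h => Finset.Iic_subset_Iic.2 h) fun x =>
    ⟨x, by simp⟩

/-! ### Convergence of the product spline operators in `L_1` -/

section SplineOp

variable {d : ℕ} {l m : Fin d → ℕ}

/-- The product spline operator of level `k`. -/
def splineOp (l m k : Fin d → ℕ) (f : (Fin d → ℝ) → ℝ) (x : Fin d → ℝ) : ℝ :=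
  ∫ y in unitCube d, (∏ j, splineKer (l j) (m j) 0 (k j) (x j) (y j)) * f y

theorem sum_tensorOp {f : (Fin d → ℝ) → ℝ} (hf : IntegrableOn f (unitCube d)) (k x : Fin d → _) :
    ∑ κ ∈ Finset.Iic k, tensorOp l m 0 κ f x = splineOp l m k f x := by
  have h0 : Finset.Iic k = Fintype.piFinset fun j => Finset.Iic (k j) := by
    ext i; simp [Pi.le_def]
  have h1 : ∀ y : Fin d → ℝ, (∏ j, splineKer (l j) (m j) 0 (k j) (x j) (y j)) * f y =
      ∑ κ ∈ Finset.Iic k, tensorKer l m 0 κ x y * f y := fun y => by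
    simp only [← sum_diffKer]
    rw [Finset.prod_univ_sum, ← h0, Finset.sum_mul]
    rfl
  simp only [splineOp, h1]
  rw [integral_finsetSum]
  · rfl
  · intro κ _
    obtain ⟨B, hB⟩ := exists_abs_tensorKer_le l m 0 κ
    have hm : Measurable fun y => tensorKer l m 0 κ x y := by
      have h2 := (measurable_tensorKer (l := l) (m := m) (a := 0) (κ := κ)).comp
        (measurable_prodMk_left (x := x))
      exact h2
    have h3 : Integrable (fun y => tensorKer l m 0 κ x y * f y) (volume.restrict (unitCube d)) :=
      Integrable.bdd_mul hf hm.aestronglyMeasurable (ae_of_all _ fun y => hB x y)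
    exact h3

theorem measurable_prod_splineKer_right (l m k x : Fin d → _) :
    Measurable fun y : Fin d → ℝ => ∏ j, splineKer (l j) (m j) 0 (k j) (x j) (y j) := by
  have h2 := (measurable_prod_splineKer l m k).comp (measurable_prodMk_left (x := x))
  exact h2

theorem integrableOn_prod_splineKer_mul {f : (Fin d → ℝ) → ℝ} (hf : IntegrableOn f (unitCube d))
    (l m k x : Fin d → _) : IntegrableOn
      (fun y => (∏ j, splineKer (l j) (m j) 0 (k j) (x j) (y j)) * f y) (unitCube d) := by
  obtain ⟨B, hB⟩ := exists_abs_prod_splineKer_le l m k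
  have h3 : Integrable (fun y => (∏ j, splineKer (l j) (m j) 0 (k j) (x j) (y j)) * f y)
      (volume.restrict (unitCube d)) :=
    Integrable.bdd_mul hf (measurable_prod_splineKer_right l m k x).aestronglyMeasurable
      (ae_of_all _ fun y => hB x y)
  exact h3

theorem prod_splineKer_ne_zero {k : Fin d → ℕ} {x y : Fin d → ℝ}
    (h : ∏ j, splineKer (l j) (m j) 0 (k j) (x j) (y j) ≠ 0) :
    y ∈ unitCube d ∧ y ∈ dyadicBox k (fun j => 2 * m j + 2) x := by
  have h1 := fun j => splineKer_ne_zero (Finset.prod_ne_zero_iff.1 h j (Finset.mem_univ j))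
  refine ⟨fun j => (h1 j).1, fun j => ?_⟩
  have h2 := (h1 j).2.le
  rw [abs_mul, abs_of_pos (by positivity)] at h2
  rwa [le_div_iff₀ (by positivity), mul_comm]

/-- Height of order `∏ 2^{k_j}` times a support of volume of order `∏ 2^{-k_j}`. The bound in `x`
gives uniform boundedness of the operators on `L_1`, the bound in `y` uniform convergence on
continuous functions. -/
theorem exists_lintegral_prod_splineKer_le (l m : Fin d → ℕ) : ∃ Λ : ℝ≥0∞, Λ ≠ ⊤ ∧
    ∀ k : Fin d → ℕ,
      (∀ x : Fin d → ℝ, ∫⁻ y : Fin d → ℝ, ‖∏ j, splineKer (l j) (m j) 0 (k j) (x j) (y j)‖ₑ ≤ Λ) ∧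
      ∀ y : Fin d → ℝ, ∫⁻ x : Fin d → ℝ, ‖∏ j, splineKer (l j) (m j) 0 (k j) (x j) (y j)‖ₑ ≤ Λ := by
  choose C hC0 hC using fun j => exists_abs_splineKer_le (l j) (m j) 0
  refine ⟨∏ j, ENNReal.ofReal (C j * (2 * (2 * m j + 2))),
    ENNReal.prod_ne_top fun j _ => ENNReal.ofReal_ne_top, fun k => ?_⟩
  have hb : ∀ x y : Fin d → ℝ, ‖∏ j, splineKer (l j) (m j) 0 (k j) (x j) (y j)‖ₑ ≤
      ∏ j, ENNReal.ofReal (C j * 2 ^ k j) := fun x y => by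
    rw [← ENNReal.ofReal_prod_of_nonneg (fun j _ => mul_nonneg (hC0 j) (by positivity)),
      Real.enorm_eq_ofReal_abs, Finset.abs_prod]
    refine ENNReal.ofReal_le_ofReal (Finset.prod_le_prod (fun j _ => abs_nonneg _) fun j _ => ?_)
    simpa using hC j (k j) (x j) (y j)
  have hv : ∀ x : Fin d → ℝ, (∏ j, ENNReal.ofReal (C j * 2 ^ k j)) *
      volume (dyadicBox k (fun j => 2 * m j + 2) x) =
        ∏ j, ENNReal.ofReal (C j * (2 * (2 * m j + 2))) := fun x => by
    rw [volume_dyadicBox, ← Finset.prod_mul_distrib]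
    refine Finset.prod_congr rfl fun j _ => ?_
    rw [← ENNReal.ofReal_mul (mul_nonneg (hC0 j) (by positivity))]
    congr 1
    field_simp
  have hle : ∀ (z : Fin d → ℝ) (g : (Fin d → ℝ) → ℝ≥0∞),
      (∀ w, g w ≤ ∏ j, ENNReal.ofReal (C j * 2 ^ k j)) →
      (∀ w, w ∉ dyadicBox k (fun j => 2 * m j + 2) z → g w = 0) →
      ∫⁻ w, g w ≤ ∏ j, ENNReal.ofReal (C j * (2 * (2 * m j + 2))) := fun z g h1 h2 => by
    rw [← hv z, ← setLIntegral_const, ← lintegral_indicator (measurableSet_dyadicBox _ _ _)]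
    refine lintegral_mono fun w => ?_
    by_cases hw : w ∈ dyadicBox k (fun j => 2 * m j + 2) z
    · rw [Set.indicator_of_mem hw]; exact h1 w
    · rw [h2 w hw]; exact zero_le
  refine ⟨fun x => hle x _ (fun w => hb x w) fun w hw => ?_,
    fun y => hle y _ (fun w => hb w y) fun w hw => ?_⟩
  · by_contra h
    exact hw (prod_splineKer_ne_zero (enorm_ne_zero.1 h)).2
  · by_contra h
    exact hw (dyadicBox_symm.1 (prod_splineKer_ne_zero (enorm_ne_zero.1 h)).2)

theorem integral_prod_splineKer (hl : ∀ j, 1 ≤ l j) (m k : Fin d → ℕ) :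
    ∀ᵐ x : Fin d → ℝ, x ∈ unitCube d →
      ∫ y in unitCube d, ∏ j, splineKer (l j) (m j) 0 (k j) (x j) (y j) = 1 := by
  have hae : ∀ᵐ x : Fin d → ℝ, ∀ j, ∀ n : ℤ, (2 : ℝ) ^ k j * x j ≠ n :=
    ae_all_iff.2 fun j => by
      have h := Measure.quasiMeasurePreserving_eval (fun _ : Fin d => (volume : Measure ℝ)) j
      have h2 := h.ae (ae_two_pow_mul_ne_int (k j))
      exact h2
  filter_upwards [hae] with x hx hxc
  rw [setIntegral_eq_integral_of_forall_compl_eq_zero fun y hy => by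
    by_contra h; exact hy (prod_splineKer_ne_zero h).1]
  rw [integral_fintype_prod_volume_eq_prod
    (fun j y => splineKer (l j) (m j) 0 (k j) (x j) y)]
  refine Finset.prod_eq_one fun j _ => ?_
  have := integral_splineKer_mul_pow (m := m j) (hxc j) (hx j) (hl j)
  simpa using this

theorem lintegral_splineOp_le {Λ : ℝ≥0∞} {k : Fin d → ℕ}
    (hΛ : ∀ y : Fin d → ℝ, ∫⁻ x : Fin d → ℝ, ‖∏ j, splineKer (l j) (m j) 0 (k j) (x j) (y j)‖ₑ ≤ Λ)
    {h : (Fin d → ℝ) → ℝ} (hh : AEMeasurable h) :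
    ∫⁻ x, ‖splineOp l m k h x‖ₑ ≤ Λ * ∫⁻ y, ‖h y‖ₑ := by
  calc ∫⁻ x, ‖splineOp l m k h x‖ₑ
      ≤ ∫⁻ x : Fin d → ℝ, ∫⁻ y : Fin d → ℝ,
          ‖∏ j, splineKer (l j) (m j) 0 (k j) (x j) (y j)‖ₑ * ‖h y‖ₑ := by
        refine lintegral_mono fun x => (enorm_integral_le_lintegral_enorm _).trans ?_
        refine (setLIntegral_le_lintegral _ _).trans (le_of_eq ?_)
        simp only [enorm_mul]
    _ = ∫⁻ y : Fin d → ℝ, ∫⁻ x : Fin d → ℝ,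
          ‖∏ j, splineKer (l j) (m j) 0 (k j) (x j) (y j)‖ₑ * ‖h y‖ₑ := by
        refine lintegral_lintegral_swap ?_
        have h1 := (measurable_prod_splineKer l m k).enorm.aemeasurable
          (μ := (volume : Measure (Fin d → ℝ)).prod volume)
        exact h1.mul hh.enorm.comp_snd
    _ ≤ ∫⁻ y, Λ * ‖h y‖ₑ := by
        refine lintegral_mono fun y => ?_
        have h1 : Measurable fun x : Fin d → ℝ =>
            ‖∏ j, splineKer (l j) (m j) 0 (k j) (x j) (y j)‖ₑ := by
          have h2 := (measurable_prod_splineKer l m k).enorm.comp (measurable_prodMk_right (y := y))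
          exact h2
        rw [lintegral_mul_const _ h1]
        exact mul_le_mul_left (hΛ y) _
    _ = Λ * ∫⁻ y, ‖h y‖ₑ := lintegral_const_mul'' _ hh.enorm

/-- Constants are reproduced, so the error is an integral of `g y - g x` against a kernel of bounded
mass concentrated near `x`; uniform continuity of `g` makes it small. -/
theorem eventually_enorm_splineOp_sub_le (hl : ∀ j, 1 ≤ l j) (m : Fin d → ℕ)
    {g : (Fin d → ℝ) → ℝ} (hg : Continuous g) (hc : HasCompactSupport g) {ε : ℝ≥0∞} (hε : ε ≠ 0) :
    ∀ᶠ k : Fin d → ℕ in atTop, ∀ᵐ x : Fin d → ℝ, x ∈ unitCube d →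
      ‖splineOp l m k g x - g x‖ₑ ≤ ε := by
  obtain ⟨Λ, hΛ, hΛb⟩ := exists_lintegral_prod_splineKer_le l m
  obtain ⟨η, hη0, hη⟩ : ∃ η : ℝ, 0 < η ∧ Λ * ENNReal.ofReal η ≤ ε := by
    have h1 : Tendsto (fun η : ℝ => Λ * ENNReal.ofReal η) (𝓝[>] 0) (𝓝 0) := by
      have : Tendsto (fun η : ℝ => Λ * ENNReal.ofReal η) (𝓝 0) (𝓝 (Λ * ENNReal.ofReal 0)) :=
        ENNReal.Tendsto.const_mul (ENNReal.continuous_ofReal.tendsto 0) (Or.inr hΛ)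
      rw [ENNReal.ofReal_zero, mul_zero] at this
      exact this.mono_left nhdsWithin_le_nhds
    have h2 := (h1.eventually (ge_mem_nhds (pos_iff_ne_zero.2 hε))).and self_mem_nhdsWithin
    obtain ⟨η, h3, h4⟩ := h2.exists
    exact ⟨η, h4, h3⟩
  obtain ⟨δ, hδ0, hδ⟩ := Metric.uniformContinuous_iff.1 (hc.uniformContinuous_of_continuous hg) η hη0
  have hk : ∀ᶠ k : Fin d → ℕ in atTop, ∀ j, (2 * (m j : ℝ) + 2) / 2 ^ k j < δ := by
    refine eventually_all.2 fun j => ?_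
    have h1 : Tendsto (fun k : Fin d → ℕ => (2 * (m j : ℝ) + 2) / 2 ^ k j) atTop (𝓝 0) :=
      tendsto_const_nhds.div_atTop ((tendsto_pow_atTop_atTop_of_one_lt one_lt_two).comp
        (tendsto_atTop.2 fun b => (eventually_ge_atTop fun _ => b).mono fun k hk => hk j))
    exact h1.eventually_lt_const hδ0
  filter_upwards [hk] with k hk
  filter_upwards [integral_prod_splineKer hl m k] with x hx hxc
  set S : (Fin d → ℝ) → ℝ := fun y => ∏ j, splineKer (l j) (m j) 0 (k j) (x j) (y j) with hS
  have hgi : IntegrableOn g (unitCube d) := (hg.integrable_of_hasCompactSupport hc).integrableOn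
  have h1i : IntegrableOn (fun _ => (1 : ℝ)) (unitCube d) := integrable_const (1 : ℝ)
  have hi1 : IntegrableOn (fun y => S y * g y) (unitCube d) :=
    integrableOn_prod_splineKer_mul hgi l m k x
  have hi2 : IntegrableOn (fun y => S y * g x) (unitCube d) := by
    have h2 : IntegrableOn (fun y => S y * 1) (unitCube d) :=
      integrableOn_prod_splineKer_mul h1i l m k x
    simp only [mul_one] at h2
    exact h2.mul_const _
  have e : splineOp l m k g x - g x = ∫ y in unitCube d, (S y * g y - S y * g x) := by
    have h2 : ∫ y in unitCube d, S y * g x = g x := by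
      rw [integral_mul_const, hx hxc, one_mul]
    have h3 := integral_sub hi1 hi2
    rw [h2] at h3
    exact h3.symm
  rw [e]
  refine (enorm_integral_le_lintegral_enorm _).trans ((setLIntegral_le_lintegral _ _).trans ?_)
  calc ∫⁻ y, ‖S y * g y - S y * g x‖ₑ ≤ ∫⁻ y, ‖S y‖ₑ * ENNReal.ofReal η := by
        refine lintegral_mono fun y => ?_
        rw [← mul_sub, enorm_mul]
        by_cases hy : S y = 0
        · rw [hy]; simp
        · refine mul_le_mul_right ?_ _
          rw [Real.enorm_eq_ofReal_abs]
          refine ENNReal.ofReal_le_ofReal ?_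
          have h4 := (prod_splineKer_ne_zero hy).2
          rw [← Real.dist_eq]
          refine (hδ ?_).le
          rw [dist_pi_lt_iff hδ0]
          intro j
          rw [Real.dist_eq]
          exact (h4 j).trans_lt (hk j)
    _ = (∫⁻ y, ‖S y‖ₑ) * ENNReal.ofReal η :=
        lintegral_mul_const _ (measurable_prod_splineKer_right l m k x).enorm
    _ ≤ Λ * ENNReal.ofReal η := mul_le_mul_left ((hΛb k).1 x) _
    _ ≤ ε := hη

theorem splineOp_sub {f g : (Fin d → ℝ) → ℝ} (hf : IntegrableOn f (unitCube d))
    (hg : IntegrableOn g (unitCube d)) (l m k x : Fin d → _) :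
    splineOp l m k f x - splineOp l m k g x = splineOp l m k (fun y => f y - g y) x := by
  have h := integral_sub (integrableOn_prod_splineKer_mul hf l m k x)
    (integrableOn_prod_splineKer_mul hg l m k x)
  simp only [splineOp, mul_sub]
  exact h.symm

/-- Approximation by continuous functions of compact support, together with the uniform `L_1` bound.
-/
theorem tendsto_lintegral_splineOp_sub (hl : ∀ j, 1 ≤ l j) (m : Fin d → ℕ)
    {f : (Fin d → ℝ) → ℝ} (hf : Integrable f) :
    Tendsto (fun k : Fin d → ℕ => ∫⁻ x in unitCube d, ‖splineOp l m k f x - f x‖ₑ)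
      atTop (𝓝 0) := by
  obtain ⟨Λ, hΛ, hΛb⟩ := exists_lintegral_prod_splineKer_le l m
  rw [ENNReal.tendsto_nhds_zero]
  intro ε hε
  set ε' := ε / (Λ + 1 + 1) with hε'
  have hε0 : ε' ≠ 0 := (ENNReal.div_pos hε.ne' (by finiteness)).ne'
  obtain ⟨g, hgc, hfg, hg, hgi⟩ := hf.exists_hasCompactSupport_lintegral_sub_le hε0
  filter_upwards [eventually_enorm_splineOp_sub_le hl m hg hgc hε0] with k hk
  have hfgm : AEMeasurable fun x => f x - g x := (hf.sub hgi).aestronglyMeasurable.aemeasurable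
  calc ∫⁻ x in unitCube d, ‖splineOp l m k f x - f x‖ₑ
      ≤ ∫⁻ x in unitCube d, (‖splineOp l m k (fun y => f y - g y) x‖ₑ + (ε' + ‖f x - g x‖ₑ)) := by
        refine setLIntegral_mono_ae' (measurableSet_unitCube d) ?_
        filter_upwards [hk] with x hx hxc
        have e : splineOp l m k f x - f x = splineOp l m k (fun y => f y - g y) x +
            ((splineOp l m k g x - g x) - (f x - g x)) := by
          rw [← splineOp_sub hf.integrableOn hgi.integrableOn]; ring
        rw [e]
        refine (enorm_add_le _ _).trans ?_
        gcongr
        refine enorm_sub_le.trans ?_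
        gcongr
        exact hx hxc
    _ = (∫⁻ x in unitCube d, ‖splineOp l m k (fun y => f y - g y) x‖ₑ) +
          (ε' * volume (unitCube d) + ∫⁻ x in unitCube d, ‖f x - g x‖ₑ) := by
        rw [lintegral_add_right' _ (hfgm.enorm.const_add ε').restrict,
          lintegral_add_right' _ hfgm.enorm.restrict, setLIntegral_const]
    _ ≤ Λ * ε' + (ε' * 1 + ε') := by
        gcongr
        · refine (setLIntegral_le_lintegral _ _).trans ((lintegral_splineOp_le (hΛb k).2 hfgm).trans ?_)
          gcongr
        · exact (volume_unitCube d).le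
        · exact (setLIntegral_le_lintegral _ _).trans hfg
    _ = (Λ + 1 + 1) * ε' := by ring
    _ ≤ ε := ENNReal.mul_div_le

end SplineOp

/-! ### The generalized derivative as a sum -/

section Limit

variable {d : ℕ} {l m a : Fin d → ℕ}

theorem tendsto_integral_mul_of_tendsto_lintegral {α ι : Type*} [MeasurableSpace α]
    {μ : Measure α} {L : Filter ι} {h : ι → α → ℝ} {g ψ : α → ℝ} (hh : ∀ i, Integrable (h i) μ)
    (hg : Integrable g μ) (hψ : AEStronglyMeasurable ψ μ) {B : ℝ} (hB : ∀ x, |ψ x| ≤ B)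
    (hL : Tendsto (fun i => ∫⁻ x, ‖h i x - g x‖ₑ ∂μ) L (𝓝 0)) :
    Tendsto (fun i => ∫ x, h i x * ψ x ∂μ) L (𝓝 (∫ x, g x * ψ x ∂μ)) := by
  have hb : ∀ᵐ x ∂μ, ‖ψ x‖ ≤ B := ae_of_all _ hB
  refine tendsto_integral_of_L1 _ (hg.mul_bdd hψ hb).aestronglyMeasurable
    (Eventually.of_forall fun i => (hh i).mul_bdd hψ hb) ?_
  have h1 : Tendsto (fun i => (∫⁻ x, ‖h i x - g x‖ₑ ∂μ) * ENNReal.ofReal B) L (𝓝 0) := by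
    have := ENNReal.Tendsto.mul_const hL (Or.inr (ENNReal.ofReal_ne_top (r := B)))
    rwa [zero_mul] at this
  refine tendsto_of_tendsto_of_tendsto_of_le_of_le tendsto_const_nhds h1 (fun _ => zero_le)
    fun i => ?_
  rw [← lintegral_mul_const' _ _ ENNReal.ofReal_ne_top]
  refine lintegral_mono fun x => ?_
  rw [← sub_mul, enorm_mul]
  refine mul_le_mul_right ?_ _
  rw [Real.enorm_eq_ofReal_abs]
  exact ENNReal.ofReal_le_ofReal (hB x)

/-- For each partial sum the weak derivative identity is known. Both of its sides pass to the limit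
by `L_1` convergence: of the operators to `f` on one side, of their derivatives to `F` on the other.
-/
theorem exists_isGeneralizedDeriv_of_tsum_lt_top (hl : ∀ j, 1 ≤ l j) (ha : a ≤ m) {q : ℝ≥0∞}
    (hq : 1 ≤ q) {f : (Fin d → ℝ) → ℝ} (hf : Integrable f)
    (hs : ∑' κ : Fin d → ℕ, eLpNorm (tensorOp l m a κ f) q (volume.restrict (unitCube d)) < ⊤) :
    ∃ F : (Fin d → ℝ) → ℝ, IsGeneralizedDeriv (unitCube d) a f F ∧
      MemLp F q (volume.restrict (unitCube d)) ∧
      Tendsto (fun k : Fin d → ℕ => eLpNorm (fun x => F x - ∑ κ ∈ Finset.Iic k,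
        tensorOp l m a κ f x) q (volume.restrict (unitCube d))) atTop (𝓝 0) := by
  obtain ⟨F, hF, hlim⟩ := exists_tendsto_eLpNorm_sub_sum hq
    (fun κ => memLp_tensorOp hf.integrableOn l m a κ q) hs
  have hlim' := hlim.comp tendsto_finset_Iic_atTop
  have hFi : Integrable F (volume.restrict (unitCube d)) := hF.integrable hq
  refine ⟨F, ⟨IntegrableOn.locallyIntegrableOn hf.integrableOn,
    IntegrableOn.locallyIntegrableOn hFi, fun φ hφ hc hsupp => ?_⟩, hF, hlim'⟩
  have hTi : ∀ (b κ : Fin d → ℕ), Integrable (tensorOp l m b κ f) (volume.restrict (unitCube d)) :=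
    fun b κ => (memLp_tensorOp hf.integrableOn l m b κ 1).integrable le_rfl
  have hSi : ∀ b k : Fin d → ℕ, Integrable (fun x => ∑ κ ∈ Finset.Iic k, tensorOp l m b κ f x)
      (volume.restrict (unitCube d)) := fun b k => integrable_finsetSum _ fun κ _ => hTi b κ
  have hφc := hφ.continuous
  have hψc : Continuous (multiDeriv a φ) := (contDiff_listDeriv hφ a (List.finRange d)).continuous
  obtain ⟨B, hB⟩ := hc.exists_bound_of_continuous hφc
  obtain ⟨B', hB'⟩ := HasCompactSupport.exists_bound_of_continuous
    (hasCompactSupport_listDeriv hc a (List.finRange d)) hψc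
  have h1 : Tendsto (fun k : Fin d → ℕ => ∫ x in unitCube d,
      (∑ κ ∈ Finset.Iic k, tensorOp l m 0 κ f x) * multiDeriv a φ x) atTop
      (𝓝 (∫ x in unitCube d, f x * multiDeriv a φ x)) := by
    refine tendsto_integral_mul_of_tendsto_lintegral (hSi 0) hf.integrableOn
      hψc.aestronglyMeasurable hB' ?_
    simp only [sum_tensorOp hf.integrableOn]
    exact tendsto_lintegral_splineOp_sub hl m hf
  have h2 : Tendsto (fun k : Fin d → ℕ => ∫ x in unitCube d,
      (∑ κ ∈ Finset.Iic k, tensorOp l m a κ f x) * φ x) atTop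
      (𝓝 (∫ x in unitCube d, F x * φ x)) := by
    refine tendsto_integral_mul_of_tendsto_lintegral (hSi a) hFi hφc.aestronglyMeasurable hB ?_
    refine tendsto_of_tendsto_of_tendsto_of_le_of_le tendsto_const_nhds hlim' (fun _ => zero_le)
      fun k => ?_
    refine le_trans (le_of_eq ?_) (eLpNorm_le_eLpNorm_of_exponent_le hq
      (hFi.sub (hSi a k)).aestronglyMeasurable)
    rw [eLpNorm_one_eq_lintegral_enorm]
    congr 1 with x
    exact enorm_sub_rev _ _
  refine tendsto_nhds_unique h1 ((h2.const_mul _).congr fun k => ?_)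
  have hmul : ∀ (b : Fin d → ℕ) (ψ : (Fin d → ℝ) → ℝ), Continuous ψ → ∀ B, (∀ x, ‖ψ x‖ ≤ B) →
      ∫ x in unitCube d, (∑ κ ∈ Finset.Iic k, tensorOp l m b κ f x) * ψ x =
        ∑ κ ∈ Finset.Iic k, ∫ x in unitCube d, tensorOp l m b κ f x * ψ x := by
    intro b ψ hψ B hB
    simp only [Finset.sum_mul]
    exact integral_finsetSum _ fun κ _ =>
      (hTi b κ).mul_bdd hψ.aestronglyMeasurable (ae_of_all _ hB)
  rw [hmul a φ hφc B hB, hmul 0 _ hψc B' hB', Finset.mul_sum]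
  refine Finset.sum_congr rfl fun κ _ => ?_
  have h3 := (isGeneralizedDeriv_mixedApproxOp (κ := κ) hl ha hf.integrableOn).2.2 φ hφ hc hsupp
  have e : mixedApproxOp (fun j => l j - 1) m κ f = tensorOp l m 0 κ f :=
    funext fun x => mixedApproxOp_eq_integral hl κ hf.integrableOn x
  rw [e] at h3
  exact h3.symm

end Limit

/-! ### Independence of the representative -/

section Congr

variable {d : ℕ} {f g : (Fin d → ℝ) → ℝ}

/-- For fixed steps, translations preserve null sets, and all nodes of a difference stay in the cube
for `x` in its domain. -/
theorem diffMean_congr (h : f =ᵐ[volume.restrict (unitCube d)] g) (c p : ℝ) (l : Fin d → ℕ)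
    (J : Finset (Fin d)) (t : J → ℝ) : diffMean c p l J f t = diffMean c p l J g t := by
  have h0 : ∀ᵐ x : Fin d → ℝ, x ∈ unitCube d → f x = g x :=
    (ae_restrict_iff' (measurableSet_unitCube d)).1 h
  have key : ∀ ξ : Fin d → ℝ, ∀ l : Fin d → ℕ, ∀ᵐ x : Fin d → ℝ,
      x ∈ diffDomain (unitCube d) ξ l → mixedDiff ξ l f x = mixedDiff ξ l g x := by
    intro ξ l
    have h1 : ∀ᵐ x : Fin d → ℝ, ∀ k ∈ Finset.Iic l, (fun j => x j + k j * ξ j) ∈ unitCube d →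
        f (fun j => x j + k j * ξ j) = g (fun j => x j + k j * ξ j) := by
      refine (ae_ball_iff (Finset.Iic l).countable_toSet).2 fun k _ => ?_
      exact (measurePreserving_add_right (volume : Measure (Fin d → ℝ))
        (fun j => k j * ξ j)).quasiMeasurePreserving.ae h0
    filter_upwards [h1] with x hx hxD
    refine Finset.sum_congr rfl fun k hk => ?_
    congr 1
    refine hx k hk ?_
    -- The node `k` is reached with `t = k / l`; where `l j = 0` the quotient is zero by convention
    -- and `k j = 0` as well.
    have h2 := hxD.2 (fun j => (k j : ℝ) / l j) fun j => ⟨by positivity, div_le_one_of_le₀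
      (Nat.cast_le.2 (Finset.mem_Iic.1 hk j)) (Nat.cast_nonneg _)⟩
    have h3 : (fun j => x j + (k j : ℝ) / l j * l j * ξ j) = fun j => x j + k j * ξ j := by
      funext j
      by_cases hj : l j = 0
      · have : k j = 0 := Nat.le_zero.1 (hj ▸ Finset.mem_Iic.1 hk j)
        simp [this]
      · have : (l j : ℝ) ≠ 0 := Nat.cast_ne_zero.2 hj
        rw [div_mul_cancel₀ _ this]
    rwa [h3] at h2
  rw [diffMean, diffMean]
  congr 2 with ξ
  refine setLIntegral_congr_fun_ae (measurableSet_diffDomain _ _) ?_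
  filter_upwards [key (extendZero J ξ) (restrictIndex J l)] with x hx hxD
  rw [hx hxD]

theorem tensorOp_congr (h : f =ᵐ[volume.restrict (unitCube d)] g) (l m a κ : Fin d → ℕ) :
    tensorOp l m a κ f = tensorOp l m a κ g := by
  funext x
  refine integral_congr_ae ?_
  filter_upwards [h] with y hy
  rw [hy]

theorem IsGeneralizedDeriv.congr {a : Fin d → ℕ} {F : (Fin d → ℝ) → ℝ}
    (hF : IsGeneralizedDeriv (unitCube d) a f F) (h : f =ᵐ[volume.restrict (unitCube d)] g)
    (hg : IntegrableOn g (unitCube d)) : IsGeneralizedDeriv (unitCube d) a g F := by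
  refine ⟨hg.locallyIntegrableOn, hF.2.1, fun φ h1 h2 h3 => ?_⟩
  rw [← hF.2.2 φ h1 h2 h3]
  refine integral_congr_ae ?_
  filter_upwards [h] with y hy
  rw [hy]

end Congr

end MixedApprox

end

theorem mainTheorem3 (d : ℕ) (hd : 1 ≤ d) (m : Fin d → ℕ) :
    ∃ c : ℝ, 0 < c ∧
      ∀ (l : Fin d → ℕ), (∀ j, 1 ≤ l j) →
      ∀ (p : ℝ), 1 ≤ p →
      ∀ (q : ℝ≥0∞), 1 ≤ q →
      ∀ (a : Fin d → ℕ), a ≤ m →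
      ∀ (f : (Fin d → ℝ) → ℝ), MemLp f (ENNReal.ofReal p) (volume.restrict (unitCube d)) →
      (∀ J : Finset (Fin d), J.Nonempty →
        ∫⁻ t in {t : J → ℝ | ∀ j, 0 < t j ∧ t j < 1},
          ENNReal.ofReal (∏ j : J, t j ^ (-(a j : ℝ) - 1 / p - max (1 / p - (q⁻¹).toReal) 0 - 1)) *
            diffMean c p l J f t < ∞) →
      ∃ (F : (Fin d → ℝ) → ℝ) (G : (Fin d → ℕ) → (Fin d → ℝ) → ℝ),
        IsGeneralizedDeriv (unitCube d) a f F ∧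
        MemLp F q (volume.restrict (unitCube d)) ∧
        (∀ κ, IsGeneralizedDeriv (unitCube d) a (mixedApproxOp (fun j => l j - 1) m κ f) (G κ) ∧
          MemLp (G κ) q (volume.restrict (unitCube d))) ∧
        Tendsto (fun k : Fin d → ℕ =>
            eLpNorm (fun x => F x - ∑ κ ∈ Finset.Iic k, G κ x) q
              (volume.restrict (unitCube d)))
          atTop (𝓝 0) := by
  have hc1 : (1 : ℝ) ≤ 8 * (∑ j, (m j : ℝ)) + 8 := by
    have : (0 : ℝ) ≤ ∑ j, (m j : ℝ) := Finset.sum_nonneg fun j _ => Nat.cast_nonneg _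
    linarith
  have hcm : ∀ j, 8 * (m j : ℝ) + 8 ≤ 8 * (∑ j, (m j : ℝ)) + 8 := fun j => by
    have := Finset.single_le_sum (f := fun j => (m j : ℝ)) (fun i _ => Nat.cast_nonneg _)
      (Finset.mem_univ j)
    linarith
  -- The sum over `j` merely dominates every `8 m_j + 8` at once.
  refine ⟨8 * (∑ j, (m j : ℝ)) + 8, by linarith, fun l hl p hp q hq a ha f hf hyp => ?_⟩
  have hp0 : 0 < p := by linarith
  have hp1 : 1 ≤ ENNReal.ofReal p := ENNReal.one_le_ofReal.2 hp
  have hfi : IntegrableOn f (unitCube d) := hf.integrable hp1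
  -- A Borel representative, extended by zero, so that measurability and integrability hold on the
  -- whole space.
  set f₁ : (Fin d → ℝ) → ℝ := (unitCube d).indicator (hf.1.mk f) with hf₁
  have hf₁m : Measurable f₁ :=
    hf.1.stronglyMeasurable_mk.measurable.indicator (measurableSet_unitCube d)
  have hff : f =ᵐ[volume.restrict (unitCube d)] f₁ :=
    hf.1.ae_eq_mk.trans (indicator_ae_eq_restrict (measurableSet_unitCube d)).symm
  have hf₁i : Integrable f₁ := by
    rw [hf₁, integrable_indicator_iff (measurableSet_unitCube d)]
    exact hfi.congr_fun_ae hf.1.ae_eq_mk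
  -- The estimates require an exponent at least `p`. Any `r ≥ q` giving the same positive part in
  -- the hypothesis will do, as `L_r` convergence on the unit cube implies `L_q` convergence.
  have main : ∀ r : ℝ≥0∞, ENNReal.ofReal p ≤ r → q ≤ r →
      max (1 / p - (r⁻¹).toReal) 0 = max (1 / p - (q⁻¹).toReal) 0 →
      ∃ F : (Fin d → ℝ) → ℝ, IsGeneralizedDeriv (unitCube d) a f F ∧
        MemLp F q (volume.restrict (unitCube d)) ∧
        Tendsto (fun k : Fin d → ℕ => eLpNorm (fun x => F x - ∑ κ ∈ Finset.Iic k,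
          tensorOp l m a κ f x) q (volume.restrict (unitCube d))) atTop (𝓝 0) := by
    intro r hpr hqr hmax
    have hs := tsum_eLpNorm_tensorOp_lt_top hl ha hc1 hcm hp hpr hf₁m hf₁i (fun J hJ => by
      simp only [hmax, ← diffMean_congr hff]
      exact hyp J hJ)
    obtain ⟨F, h1, h2, h3⟩ := exists_isGeneralizedDeriv_of_tsum_lt_top hl ha (hq.trans hqr) hf₁i hs
    refine ⟨F, h1.congr hff.symm hfi, h2.mono_exponent hqr, ?_⟩
    simp only [tensorOp_congr hff]
    refine tendsto_of_tendsto_of_tendsto_of_le_of_le tendsto_const_nhds h3 (fun _ => zero_le)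
      fun k => eLpNorm_le_eLpNorm_of_exponent_le hqr ?_
    exact h2.1.sub (Finset.aestronglyMeasurable_fun_sum _ fun κ _ =>
      (aestronglyMeasurable_tensorOp hf₁i.integrableOn).restrict)
  have hF : ∃ F : (Fin d → ℝ) → ℝ, IsGeneralizedDeriv (unitCube d) a f F ∧
        MemLp F q (volume.restrict (unitCube d)) ∧
        Tendsto (fun k : Fin d → ℕ => eLpNorm (fun x => F x - ∑ κ ∈ Finset.Iic k,
          tensorOp l m a κ f x) q (volume.restrict (unitCube d))) atTop (𝓝 0) := by
    rcases le_total (ENNReal.ofReal p) q with h | h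
    · exact main q h le_rfl rfl
    -- For `q ≤ p` the choice `r = p` makes both positive parts zero.
    · refine main (ENNReal.ofReal p) le_rfl h ?_
      have h1 : ((ENNReal.ofReal p)⁻¹).toReal = 1 / p := by
        rw [ENNReal.toReal_inv, ENNReal.toReal_ofReal hp0.le, one_div]
      have h2 : 1 / p ≤ (q⁻¹).toReal := by
        rw [← h1]
        exact ENNReal.toReal_mono (by simp; exact (zero_lt_one.trans_le hq).ne')
          (ENNReal.inv_le_inv.2 h)
      rw [h1, sub_self, max_self, max_eq_right (by linarith)]
  obtain ⟨F, h1, h2, h3⟩ := hF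
  exact ⟨F, fun κ => tensorOp l m a κ f, h1, h2, fun κ =>
    ⟨isGeneralizedDeriv_mixedApproxOp hl ha hfi, memLp_tensorOp hfi l m a κ q⟩, h3⟩
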